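/- **Machine model.** The Real RAM executes a fixed finite program. It stores integers and exact real numbers in registers and arrays (array cells are addressed by integers). In one step each it can execute $+$ and truncated $-$ on integers, $+,-,\times,/,\sqrt{\cdot}$ on reals, a comparison of two integers or of two reals, a conversion of an integer into a real, and a move between memory and registers (division by $0$ and roots of negative numbers are not allowed). All these steps are counted below as operations. **AFMM.** Let $\xi\ge 1$. An AFMM with exponent $\xi$ is a black box which takes as input an accuracy $\delta\in(0,1/2)$, a kernel $k(x)\in\{\log|x|,\ 1/x,\ 1/x^2\}$, a constant $C>0$, evaluation points $x_1,\dots,x_{M}$, weights $c_1,\dots,c_N$ and sources $y_1,\dots,y_N$, where $N\ge1$ and $M\le N$, all of absolute value less than $C$, such that $|x_i-y_j|\ge a(\delta/N)^{p}$ for all $i,j$, where $a>0$ and $p\in\mathbb{N}$ are constants. It returns $\tilde f(x_1),\dots,\tilde f(x_M)$ with $|\tilde f(x_i)-\sum_{j=1}^{N}c_j\,k(x_i-y_j)|\le\delta$ for all $i$, at a cost of $O(N\log^{\xi}(N/\delta))$ operations, where the implied constant may depend on $C,a,p$ but not on $\delta$ and $N$. (That is, the box is a $(\delta,\xi,N)$-AFMM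 for all $\delta$ and $N$.) A program may call the AFMM; a call costs one step plus the operations of the AFMM. **Theorem.** Let $\alpha\in\mathbb{R}$, $z\in\mathbb{R}^{n-1}$, let $D=\operatorname{diag}(d_1,\dots,d_{n-1})$ be real, and let $$H=\begin{pmatrix}\alpha & z^\top\\ z & D\end{pmatrix}\in\mathbb{R}^{n\times n},\qquad n\ge 1,$$ be an arrowhead matrix with spectral norm $\|H\|\le 1$. Assume that an AFMM with exponent $\xi\ge1$ is given. The programs below do not depend on the input, on $\xi$ or on the AFMM, and the constants implied by $O(\cdot)$ depend only on the AFMM and $\xi$. (i) Let $\epsilon\in(0,1)$ (and $\epsilon\le 1/2$ if $n=1$), $r\ge1$, and let $B\in\mathbb{R}^{n\times r}$ have columns of Euclidean norm at most $1$. There is a program which, on input $n,r,\epsilon,\alpha,z,d,B$, computes with at most $O\big(nr\log^{\xi+1}(n/\epsilon)\big)$ operations a diagonal matrix $\tilde\Lambda\in\mathbb{R}^{n\times n}$ and a matrix $\tilde Q_B\in\mathbb{R}^{n\times r}$ such that, for some exactly orthogonal matrix $Q\in\mathbb{R}^{n\times n}$, $$\|H-Q\tilde\Lambda Q^\top\|\le\epsilon\qquad\text{and}\qquad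 \big|(Q^\top B-\tilde Q_B)_{i,j}\big|\le \epsilon/n^2\quad\text{for all } i,j.$$ (ii) Let $\epsilon\in(0,1/2]$. There is a program which, on input $n,\epsilon,\alpha,z,d$, computes with at most $O\big(n\log(1/\epsilon)\log^{\xi}(n/\epsilon)\big)$ operations values $\tilde\lambda_1,\dots,\tilde\lambda_n$ such that $|\lambda_i(H)-\tilde\lambda_i|\le\epsilon$ for all $i$, where $\lambda_1(H)\le\dots\le\lambda_n(H)$ are the eigenvalues of $H$ with multiplicities. -/

import Mathlib

/-! ## Approximate fast multipole method (AFMM) -/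

/-- The three admissible kernels `log |x|`, `1 / x`, `1 / x ^ 2`. -/
inductive Kernel where
  | log
  | inv
  | invSq

/-- The value of a kernel. `Real.log x` is `log |x|`. -/
noncomputable def Kernel.fn : Kernel → ℝ → ℝ
  | .log, x => Real.log x
  | .inv, x => 1 / x
  | .invSq, x => 1 / x ^ 2

/-- The input of one AFMM call: a kernel, the accuracy `acc`, the bound `bound` on the magnitude of
all data, `m` evaluation points `x`, and `n` sources `y` with weights `c`. -/
structure Query where
  kernel : Kernel
  acc : ℝ
  bound : ℝ
  m : ℕ
  n : ℕ
  x : Fin m → ℝ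
  c : Fin n → ℝ
  y : Fin n → ℝ

/-- The exact sums `f (x i) = ∑ j, c j * k (x i - y j)`. -/
noncomputable def Query.exact (q : Query) (i : Fin q.m) : ℝ :=
  ∑ j, q.c j * q.kernel.fn (q.x i - q.y j)

/-- The inputs on which an AFMM has to work, for the constant `C` and for the separation threshold
`a * (acc / n) ^ k`, which is polynomial in `acc / n`. -/
structure Query.Admissible (q : Query) (C a : ℝ) (k : ℕ) : Prop where
  acc_pos : 0 < q.acc
  acc_lt : q.acc < 1 / 2
  n_pos : 1 ≤ q.n
  m_le : q.m ≤ q.n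
  bound_eq : q.bound = C
  x_lt : ∀ i, |q.x i| < q.bound
  c_lt : ∀ j, |q.c j| < q.bound
  y_lt : ∀ j, |q.y j| < q.bound
  separated : ∀ i j, a * (q.acc / q.n) ^ k ≤ |q.x i - q.y j|

/-- A black box that answers queries, together with the number of arithmetic operations that it
uses for each of them. -/
structure BlackBox where
  eval : (q : Query) → Fin q.m → ℝ
  cost : Query → ℕ

/-- The black box is an `(ε, ξ, n)`-AFMM, for all accuracies `ε` and all sizes `n`: on all inputs
with data bounded by a constant `C` and points that are polynomially separated in `ε / n`, it
returns all sums up to `ε`, using `O(n log^ξ (n / ε))` operations. The implied constant may depend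
on `C` and on the polynomial, but not on `ε` and `n`. -/
def BlackBox.IsAFMM (F : BlackBox) (ξ : ℝ) : Prop :=
  ∀ C a : ℝ, 0 < C → 0 < a → ∀ k : ℕ, ∃ K : ℝ, ∀ q : Query, q.Admissible C a k →
    (∀ i, |F.eval q i - q.exact i| ≤ q.acc) ∧
    (F.cost q : ℝ) ≤ K * (q.n * Real.log (q.n / q.acc) ^ ξ)

/-! ## The Real RAM

Programs are finite texts that do not depend on the input. The memory consists of integer and real
registers and of integer and real arrays, all named by constants of the program; array cells are
addressed by the contents of integer registers. Only `+` and truncated `-` are available on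
integers. Real numbers are stored exactly; the operations on them are `+`, `-`, `*`, `/`, `√` and
comparisons. Integers can be converted into reals, but not conversely. -/

/-- The memory of the machine. -/
structure State where
  /-- integer registers -/
  iv : ℕ → ℕ
  /-- integer arrays -/
  im : ℕ → ℕ → ℕ
  /-- real registers -/
  rv : ℕ → ℝ
  /-- real arrays -/
  rm : ℕ → ℕ → ℝ

/-- The binary arithmetic operations on reals. -/
inductive ROp where
  | add
  | sub
  | mul
  | div

/-- The value of an arithmetic operation. -/
noncomputable def ROp.fn : ROp → ℝ → ℝ → ℝ
  | .add, a, b => a + b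
  | .sub, a, b => a - b
  | .mul, a, b => a * b
  | .div, a, b => a / b

/-- The instructions. The first argument is the target, except for `istore` and `rstore`. -/
inductive Instr where
  /-- integer register `p := k` -/
  | iconst (p k : ℕ)
  /-- integer register `p := a + b` -/
  | iadd (p a b : ℕ)
  /-- integer register `p := a - b`, which is `0` if `a < b` -/
  | isub (p a b : ℕ)
  /-- integer register `p := A[a]`, where `A` is an integer array -/
  | iload (p A a : ℕ)
  /-- `A[a] := p`, where `A` is an integer array -/
  | istore (A a p : ℕ)
  /-- real register `u :=` the integer in register `a` -/
  | rcast (u a : ℕ)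
  /-- real register `u := v op w` -/
  | rop (u : ℕ) (op : ROp) (v w : ℕ)
  /-- real register `u := √v` -/
  | rsqrt (u v : ℕ)
  /-- real register `u := A[a]`, where `A` is a real array -/
  | rload (u A a : ℕ)
  /-- `A[a] := u`, where `A` is a real array -/
  | rstore (A a u : ℕ)
  /-- A call of the AFMM with kernel `κ`: the real registers `e` and `b` hold the accuracy and the
  bound, the integer registers `p` and `q` hold the numbers of evaluation points and of sources,
  the real arrays `X`, `W`, `Y` hold the evaluation points, the weights and the sources, and the
  results are written to the real array `O`. -/
  | fmm (κ : Kernel) (e b p q X W Y O : ℕ)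

/-- The query of an AFMM call. -/
def State.query (s : State) (κ : Kernel) (e b p q X W Y : ℕ) : Query where
  kernel := κ
  acc := s.rv e
  bound := s.rv b
  m := s.iv p
  n := s.iv q
  x := fun i => s.rm X i
  c := fun j => s.rm W j
  y := fun j => s.rm Y j

/-- An instruction is only defined if it does not divide by zero and does not take the square root
of a negative number; otherwise the machine gets stuck. -/
def Instr.Defined (s : State) : Instr → Prop
  | .rop _ .div _ w => s.rv w ≠ 0
  | .rsqrt _ v => 0 ≤ s.rv v
  | _ => True

/-- The effect of an instruction on the memory. -/
noncomputable def Instr.run (F : BlackBox) (s : State) : Instr → State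
  | .iconst p k => { s with iv := Function.update s.iv p k }
  | .iadd p a b => { s with iv := Function.update s.iv p (s.iv a + s.iv b) }
  | .isub p a b => { s with iv := Function.update s.iv p (s.iv a - s.iv b) }
  | .iload p A a => { s with iv := Function.update s.iv p (s.im A (s.iv a)) }
  | .istore A a p =>
      { s with im := Function.update s.im A (Function.update (s.im A) (s.iv a) (s.iv p)) }
  | .rcast u a => { s with rv := Function.update s.rv u (s.iv a : ℝ) }
  | .rop u op v w => { s with rv := Function.update s.rv u (op.fn (s.rv v) (s.rv w)) }
  | .rsqrt u v => { s with rv := Function.update s.rv u (Real.sqrt (s.rv v)) }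
  | .rload u A a => { s with rv := Function.update s.rv u (s.rm A (s.iv a)) }
  | .rstore A a u =>
      { s with rm := Function.update s.rm A (Function.update (s.rm A) (s.iv a) (s.rv u)) }
  | .fmm κ e b p q X W Y O =>
      { s with
        rm := Function.update s.rm O (fun i =>
          if h : i < s.iv p then F.eval (s.query κ e b p q X W Y) ⟨i, h⟩ else s.rm O i) }

/-- Every instruction costs one step; an AFMM call costs in addition the operations of the AFMM. -/
def Instr.cost (F : BlackBox) (s : State) : Instr → ℕ
  | .fmm κ e b p q X W Y _ => F.cost (s.query κ e b p q X W Y) + 1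
  | _ => 1

/-- The tests: comparison of two integer registers or of two real registers. -/
inductive Test where
  | ilt (a b : ℕ)
  | rlt (u v : ℕ)

/-- The outcome of a test. -/
def Test.Holds (s : State) : Test → Prop
  | .ilt a b => s.iv a < s.iv b
  | .rlt u v => s.rv u < s.rv v

/-- Programs. -/
inductive Prog where
  | instr (i : Instr)
  | seq (P Q : Prog)
  | ite (T : Test) (P Q : Prog)
  | loop (T : Test) (P : Prog)

/-- `Exec F P s s' t`: started in the memory `s`, the program `P` with the AFMM `F` terminates with
the memory `s'` after `t` steps. All steps are counted: arithmetic operations, comparisons, moves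
between memory and registers, index computations, and the operations of the AFMM. The program
`loop T P` repeats `P` as long as `T` holds. -/
inductive Exec (F : BlackBox) : Prog → State → State → ℕ → Prop where
  | instr {i : Instr} {s : State} (h : i.Defined s) :
      Exec F (.instr i) s (i.run F s) (i.cost F s)
  | seq {P Q : Prog} {s₁ s₂ s₃ : State} {t u : ℕ} (hP : Exec F P s₁ s₂ t)
      (hQ : Exec F Q s₂ s₃ u) : Exec F (.seq P Q) s₁ s₃ (t + u)
  | ite_true {T : Test} {P Q : Prog} {s s' : State} {t : ℕ} (hT : T.Holds s)
      (hP : Exec F P s s' t) : Exec F (.ite T P Q) s s' (t + 1)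
  | ite_false {T : Test} {P Q : Prog} {s s' : State} {t : ℕ} (hT : ¬ T.Holds s)
      (hQ : Exec F Q s s' t) : Exec F (.ite T P Q) s s' (t + 1)
  | loop_done {T : Test} {P : Prog} {s : State} (hT : ¬ T.Holds s) :
      Exec F (.loop T P) s s 1
  | loop_step {T : Test} {P : Prog} {s₁ s₂ s₃ : State} {t u : ℕ} (hT : T.Holds s₁)
      (hP : Exec F P s₁ s₂ t) (hL : Exec F (.loop T P) s₂ s₃ u) :
      Exec F (.loop T P) s₁ s₃ (t + u + 1)

/-! ## Arrowhead matrices -/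

/-- The arrowhead matrix with corner `α`, shaft `z` and diagonal `d`. Its size is `m + 1`. -/
def arrowhead {m : ℕ} (α : ℝ) (z d : Fin m → ℝ) : Matrix (Fin (m + 1)) (Fin (m + 1)) ℝ :=
  Matrix.of (Fin.cons (Fin.cons α z) (fun i => Fin.cons (z i) (Matrix.diagonal d i)))

/-- The spectral norm of a real square matrix. -/
noncomputable def specNorm {n : ℕ} (A : Matrix (Fin n) (Fin n) ℝ) : ℝ :=
  ‖Matrix.toEuclideanCLM (n := Fin n) (𝕜 := ℝ) A‖

/-- A finite sequence as the content of an array. -/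
def toArray {n : ℕ} (v : Fin n → ℝ) (a : ℕ) : ℝ :=
  if h : a < n then v ⟨a, h⟩ else 0

/-- The initial memory for the arrowhead matrix with data `α`, `z`, `d` and the accuracy `ε`: the
size is in integer register `0`, `ε` and `α` are in the real registers `0` and `1`, `z` and `d` are
in the real arrays `0` and `1`. Everything else is zero. -/
def eigInput {m : ℕ} (ε α : ℝ) (z d : Fin m → ℝ) : State where
  iv := Function.update (fun _ => 0) 0 (m + 1)
  im := fun _ _ => 0
  rv := Function.update (Function.update (fun _ => 0) 0 ε) 1 α
  rm := Function.update (Function.update (fun _ _ => 0) 0 (toArray z)) 1 (toArray d)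

/-- As `eigInput`, with in addition the number `r` of columns of `B` in integer register `1`, and
the matrix `B`, row by row, in the real array `2`: the entry `B i j` is in cell `j + r * i`. -/
def diagInput {m r : ℕ} (ε α : ℝ) (z d : Fin m → ℝ) (B : Matrix (Fin (m + 1)) (Fin r) ℝ) :
    State where
  iv := Function.update (eigInput ε α z d).iv 1 r
  im := (eigInput ε α z d).im
  rv := (eigInput ε α z d).rv
  rm := Function.update (eigInput ε α z d).rm 2
    (toArray (fun a => B (finProdFinEquiv.symm a).1 (finProdFinEquiv.symm a).2))

/-- The vector in the first `n` cells of the real array `3`. -/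
def outVector (s : State) (n : ℕ) : Fin n → ℝ :=
  fun i => s.rm 3 i

/-- The `n × r` matrix that is stored row by row in the real array `4`. -/
def outMatrix (s : State) (n r : ℕ) : Matrix (Fin n) (Fin r) ℝ :=
  Matrix.of fun i j => s.rm 4 (j + r * i)

/-- `lam` lists the eigenvalues of `A` with multiplicities in increasing order. -/
def IsSortedSpectrum {n : ℕ} (A : Matrix (Fin n) (Fin n) ℝ) (lam : Fin n → ℝ) : Prop :=
  Monotone lam ∧ A.charpoly = ∏ i, (Polynomial.X - Polynomial.C (lam i))

/-! Write `n = m + 1` and `σ = ε / (64 n)`. Rounding the diagonal entries to a grid of mesh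
`Θ(ε)` and spreading those in one cell by multiples of `σ`, and pushing the shaft entries away from
zero by `σ`, changes the matrix by at most `ε / 8` in norm. The eigenvalues of the new matrix are
simple, they are the zeros of its secular function `α - x + ∑ j, z j ^ 2 / (x - d j)`, they
interlace its poles, and a power of `σ` bounds their distance from the poles from below. So they
can be bisected simultaneously, at the cost of a single AFMM call per round, where it does no harm
that the signs close to a zero are unreliable.

The vector `(1, z j / (x - d j))` is an eigenvector to the eigenvalue `x`. The squared norms of
these vectors and their products with the columns of `B` are sums with the kernels `1 / x ^ 2` and
`1 / x`, and the orthogonal matrix `Q` of the theorem consists of the exact normalized eigenvectors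
of the new matrix.

The sorting of the poles must not cost a factor `log n`. In the grid, the entries are
counted in a binary tree whose depth is `O(log (1 / ε))`, and the `k`-th pole is found by a descent
from its root.
-/

/-! ## Orthogonal diagonalization and Weyl's inequality -/

section LinearAlgebra

open Matrix
open scoped Matrix.Norms.L2Operator

variable {n : Type*} [Fintype n]

theorem norm_toLp_sq (x : n → ℝ) : ‖WithLp.toLp 2 x‖ ^ 2 = x ⬝ᵥ x := by
  rw [← real_inner_self_eq_norm_sq, EuclideanSpace.inner_toLp_toLp, star_trivial]

theorem dotProduct_self_nonneg (x : n → ℝ) : 0 ≤ x ⬝ᵥ x := norm_toLp_sq x ▸ sq_nonneg _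

theorem dotProduct_self_pos {x : n → ℝ} (hx : x ≠ 0) : 0 < x ⬝ᵥ x :=
  (dotProduct_self_nonneg x).lt_of_ne' (dotProduct_self_eq_zero.not.2 hx)

theorem dotProduct_eq_zero_of_mulVec_eq_smul {A : Matrix n n ℝ} (hA : Aᵀ = A) {x y : n → ℝ}
    {a b : ℝ} (hab : a ≠ b) (hx : A *ᵥ x = a • x) (hy : A *ᵥ y = b • y) : x ⬝ᵥ y = 0 := by
  have h : A *ᵥ x ⬝ᵥ y = x ⬝ᵥ A *ᵥ y := by rw [dotProduct_mulVec, ← mulVec_transpose, hA]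
  rw [hx, hy, smul_dotProduct, dotProduct_smul, smul_eq_mul, smul_eq_mul, ← sub_eq_zero,
    ← sub_mul] at h
  exact (mul_eq_zero.1 h).resolve_left (sub_ne_zero.2 hab)

variable [DecidableEq n]

theorem specNorm_eq_norm {k : ℕ} (A : Matrix (Fin k) (Fin k) ℝ) : specNorm A = ‖A‖ := rfl

theorem mulVec_dotProduct_self_le (A : Matrix n n ℝ) (x : n → ℝ) :
    A *ᵥ x ⬝ᵥ A *ᵥ x ≤ ‖A‖ ^ 2 * (x ⬝ᵥ x) := by
  rw [← norm_toLp_sq, ← norm_toLp_sq, ← mul_pow]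
  exact pow_le_pow_left₀ (norm_nonneg _) (l2_opNorm_mulVec A (WithLp.toLp 2 x)) 2

theorem norm_le_of_mulVec_dotProduct_self_le {A : Matrix n n ℝ} {c : ℝ} (hc : 0 ≤ c)
    (h : ∀ x, A *ᵥ x ⬝ᵥ A *ᵥ x ≤ c ^ 2 * (x ⬝ᵥ x)) : ‖A‖ ≤ c := by
  refine ContinuousLinearMap.opNorm_le_bound _ hc fun x => ?_
  refine abs_le_of_sq_le_sq' ?_ (by positivity) |>.2
  have hx := h x.ofLp
  rw [← norm_toLp_sq, ← norm_toLp_sq, ← mul_pow] at hx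
  exact hx

theorem abs_dotProduct_mulVec_le (A : Matrix n n ℝ) (x : n → ℝ) :
    |x ⬝ᵥ A *ᵥ x| ≤ ‖A‖ * (x ⬝ᵥ x) := by
  have h := abs_real_inner_le_norm (WithLp.toLp 2 (A *ᵥ x)) (WithLp.toLp 2 x)
  rw [EuclideanSpace.inner_toLp_toLp, star_trivial] at h
  rw [← norm_toLp_sq, sq, ← mul_assoc]
  exact h.trans (mul_le_mul_of_nonneg_right (l2_opNorm_mulVec A (WithLp.toLp 2 x)) (norm_nonneg _))

theorem transpose_mulVec_dotProduct_self {U : Matrix n n ℝ} (hU : U ∈ orthogonalGroup n ℝ)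
    (x : n → ℝ) : Uᵀ *ᵥ x ⬝ᵥ Uᵀ *ᵥ x = x ⬝ᵥ x := by
  have hUU : U * Uᵀ = 1 := (mem_orthogonalGroup_iff n ℝ).1 hU
  rw [dotProduct_mulVec, vecMul_transpose, mulVec_mulVec, hUU, one_mulVec]

theorem abs_transpose_mul_apply_le {p : Type*} {U : Matrix n n ℝ} (hU : U ∈ orthogonalGroup n ℝ)
    (B : Matrix n p ℝ) (k : n) (c : p) :
    |(Uᵀ * B) k c| ≤ ‖WithLp.toLp 2 fun i => B i c‖ := by
  refine (PiLp.norm_apply_le (WithLp.toLp 2 (Uᵀ *ᵥ fun i => B i c)) k).trans_eq ?_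
  rw [← sq_eq_sq₀ (norm_nonneg _) (norm_nonneg _), norm_toLp_sq, norm_toLp_sq,
    transpose_mulVec_dotProduct_self hU]

/-- The symmetric matrix `A` is diagonalized by the orthogonal matrix `U`, whose columns are
eigenvectors for the eigenvalues `lam`. -/
structure Diagonalizes (A U : Matrix n n ℝ) (lam : n → ℝ) : Prop where
  orth : U ∈ orthogonalGroup n ℝ
  eq : A = U * diagonal lam * Uᵀ

namespace Diagonalizes

variable {A B U V : Matrix n n ℝ} {lam mu : n → ℝ}

theorem dotProduct_mulVec (h : Diagonalizes A U lam) (x : n → ℝ) :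
    x ⬝ᵥ A *ᵥ x = ∑ j, lam j * (Uᵀ *ᵥ x) j ^ 2 := by
  rw [h.eq, ← mulVec_mulVec, ← mulVec_mulVec, Matrix.dotProduct_mulVec, ← mulVec_transpose,
    dotProduct]
  refine Finset.sum_congr rfl fun j _ => ?_
  rw [mulVec_diagonal]
  ring

theorem norm_sub_le (h : Diagonalizes A U lam) {c : ℝ} (hc : 0 ≤ c)
    (hmu : ∀ i, |lam i - mu i| ≤ c) : ‖A - U * diagonal mu * Uᵀ‖ ≤ c := by
  have hsub : A - U * diagonal mu * Uᵀ = U * diagonal (lam - mu) * Uᵀ := by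
    rw [h.eq, ← Matrix.sub_mul, ← Matrix.mul_sub, diagonal_sub]
    rfl
  rw [hsub, CStarRing.norm_mul_mem_unitary (U := Uᵀ) _ (Unitary.star_mem h.orth),
    CStarRing.norm_mem_unitary_mul _ h.orth, l2_opNorm_diagonal]
  exact (pi_norm_le_iff_of_nonneg hc).2 hmu

section Weyl

variable [LinearOrder n]

theorem mul_dotProduct_self_le (h : Diagonalizes A U lam) (hlam : Monotone lam) {i : n}
    {x : n → ℝ} (hx : ∀ j < i, (Uᵀ *ᵥ x) j = 0) : lam i * (x ⬝ᵥ x) ≤ x ⬝ᵥ A *ᵥ x := by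
  rw [h.dotProduct_mulVec, ← transpose_mulVec_dotProduct_self h.orth, dotProduct, Finset.mul_sum]
  refine Finset.sum_le_sum fun j _ => ?_
  rw [← sq]
  rcases lt_or_ge j i with hj | hj
  · simp [hx j hj]
  · exact mul_le_mul_of_nonneg_right (hlam hj) (sq_nonneg _)

theorem dotProduct_mulVec_le (h : Diagonalizes A U lam) (hlam : Monotone lam) {i : n}
    {x : n → ℝ} (hx : ∀ j, i < j → (Uᵀ *ᵥ x) j = 0) : x ⬝ᵥ A *ᵥ x ≤ lam i * (x ⬝ᵥ x) := by
  rw [h.dotProduct_mulVec, ← transpose_mulVec_dotProduct_self h.orth, dotProduct, Finset.mul_sum]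
  refine Finset.sum_le_sum fun j _ => ?_
  rw [← sq]
  rcases lt_or_ge i j with hj | hj
  · simp [hx j hj]
  · exact mul_le_mul_of_nonneg_right (hlam hj) (sq_nonneg _)

/-- The span of the eigenvectors of `A` from the `i`-th on meets that of the eigenvectors of `B`
up to the `i`-th, by a count of dimensions; here, a square matrix with a zero row is singular. -/
theorem le_add_norm_sub (hA : Diagonalizes A U lam) (hB : Diagonalizes B V mu)
    (hlam : Monotone lam) (hmu : Monotone mu) (i : n) : lam i ≤ mu i + ‖A - B‖ := by
  let M : Matrix n n ℝ := of fun j => if j < i then Uᵀ j else if i < j then Vᵀ j else 0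
  obtain ⟨x, hx, hMx⟩ := exists_mulVec_eq_zero_iff.2
    (det_eq_zero_of_row_eq_zero (A := M) i fun k => by simp [M])
  have hU : ∀ j < i, (Uᵀ *ᵥ x) j = 0 := fun j hj => by
    simpa only [mulVec, M, of_apply, if_pos hj, Pi.zero_apply] using congrFun hMx j
  have hV : ∀ j, i < j → (Vᵀ *ᵥ x) j = 0 := fun j hj => by
    simpa only [mulVec, M, of_apply, if_pos hj, if_neg hj.not_gt, Pi.zero_apply] using
      congrFun hMx j
  have hlower := hA.mul_dotProduct_self_le hlam hU
  have hupper := hB.dotProduct_mulVec_le hmu hV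
  have hdiff := (le_abs_self _).trans (abs_dotProduct_mulVec_le (A - B) x)
  rw [sub_mulVec, dotProduct_sub] at hdiff
  exact le_of_mul_le_mul_right (by linarith) (dotProduct_self_pos hx)

theorem abs_sub_le_norm_sub (hA : Diagonalizes A U lam) (hB : Diagonalizes B V mu)
    (hlam : Monotone lam) (hmu : Monotone mu) (i : n) : |lam i - mu i| ≤ ‖A - B‖ :=
  abs_sub_le_iff.2 ⟨sub_le_iff_le_add'.2 (hA.le_add_norm_sub hB hlam hmu i),
    sub_le_iff_le_add'.2 (norm_sub_rev A B ▸ hB.le_add_norm_sub hA hmu hlam i)⟩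

end Weyl

end Diagonalizes

theorem exists_diagonalizes_isSortedSpectrum {k : ℕ} {A : Matrix (Fin k) (Fin k) ℝ}
    (hA : A.IsHermitian) : ∃ U lam, Diagonalizes A U lam ∧ IsSortedSpectrum A lam := by
  let U : Matrix (Fin k) (Fin k) ℝ := hA.eigenvectorUnitary.1
  have hspec : A = U * diagonal hA.eigenvalues * Uᵀ := by
    conv_lhs => rw [hA.spectral_theorem, Unitary.conjStarAlgAut_apply]
    rfl
  have hU : U * Uᵀ = 1 := (mem_orthogonalGroup_iff (Fin k) ℝ).1 hA.eigenvectorUnitary.2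
  let e := Tuple.sort hA.eigenvalues
  refine ⟨U.submatrix id e, hA.eigenvalues ∘ e, ⟨?_, ?_⟩, Tuple.monotone_sort _, ?_⟩
  · rw [mem_orthogonalGroup_iff]
    change U.submatrix id e * (U.submatrix id e)ᵀ = 1
    rw [transpose_submatrix, submatrix_mul_equiv, hU, submatrix_id_id]
  · rw [← submatrix_diagonal_equiv, transpose_submatrix, submatrix_mul_equiv, submatrix_mul_equiv,
      ← hspec, submatrix_id_id]
  · rw [hA.charpoly_eq]
    exact (Equiv.prod_comp e fun i => Polynomial.X - Polynomial.C (hA.eigenvalues i)).symm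

/-- The matrix whose columns are the vectors `q k`, scaled to Euclidean norm one. -/
noncomputable def normalized (q : n → n → ℝ) : Matrix n n ℝ :=
  of fun i k => q k i / √(q k ⬝ᵥ q k)

variable {A : Matrix n n ℝ} {q : n → n → ℝ} {lam : n → ℝ}

theorem normalized_transpose_mul_self (hq : ∀ k, q k ≠ 0)
    (horth : ∀ k l, k ≠ l → q k ⬝ᵥ q l = 0) : (normalized q)ᵀ * normalized q = 1 := by
  ext k l
  have hentry : ((normalized q)ᵀ * normalized q) k l =
      (q k ⬝ᵥ q l) / (√(q k ⬝ᵥ q k) * √(q l ⬝ᵥ q l)) := by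
    simp only [mul_apply, dotProduct, Finset.sum_div, normalized, transpose_apply, of_apply,
      div_mul_div_comm]
  rw [hentry]
  rcases eq_or_ne k l with rfl | hkl
  · have hpos := dotProduct_self_pos (hq k)
    rw [Real.mul_self_sqrt hpos.le, div_self hpos.ne', one_apply_eq]
  · rw [horth k l hkl, zero_div, one_apply_ne hkl]

theorem diagonalizes_normalized (hA : Aᵀ = A) (hq : ∀ k, q k ≠ 0) (hlam : Function.Injective lam)
    (h : ∀ k, A *ᵥ q k = lam k • q k) : Diagonalizes A (normalized q) lam := by
  have horth : normalized q * (normalized q)ᵀ = 1 := mul_eq_one_comm.1 <|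
    normalized_transpose_mul_self hq fun k l hkl =>
      dotProduct_eq_zero_of_mulVec_eq_smul hA (hlam.ne hkl) (h k) (h l)
  have heig : A * normalized q = normalized q * diagonal lam := by
    ext i k
    have hik := congrFun (h k) i
    rw [mul_diagonal]
    simp only [mul_apply, normalized, of_apply, mulVec, dotProduct, Pi.smul_apply,
      smul_eq_mul, ← mul_div_assoc, ← Finset.sum_div] at hik ⊢
    rw [hik]
    ring
  refine ⟨(mem_orthogonalGroup_iff n ℝ).2 horth, ?_⟩
  rw [← heig, Matrix.mul_assoc, horth, Matrix.mul_one]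

end LinearAlgebra

/-! ## Arrowhead matrices -/

section Arrowhead

open Matrix
open scoped Matrix.Norms.L2Operator

theorem sum_sq_apply_le_norm_sq {n : Type*} [Fintype n] [DecidableEq n] (A : Matrix n n ℝ) (k : n) :
    ∑ i, A i k ^ 2 ≤ ‖A‖ ^ 2 := by
  have h := mulVec_dotProduct_self_le A (Pi.single k 1)
  rw [mulVec_single_one, single_one_dotProduct, Pi.single_eq_same, mul_one] at h
  simpa only [dotProduct, col_apply, ← sq] using h

theorem abs_apply_le_norm {n : Type*} [Fintype n] [DecidableEq n] (A : Matrix n n ℝ) (i k : n) :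
    |A i k| ≤ ‖A‖ :=
  abs_le_of_sq_le_sq ((Finset.single_le_sum (f := fun i => A i k ^ 2) (fun _ _ => sq_nonneg _)
    (Finset.mem_univ i)).trans (sum_sq_apply_le_norm_sq A k)) (norm_nonneg _)

variable {m : ℕ} (α : ℝ) (z d : Fin m → ℝ)

theorem arrowhead_zero_zero : arrowhead α z d 0 0 = α := rfl

theorem arrowhead_succ_zero (i : Fin m) : arrowhead α z d i.succ 0 = z i := rfl

theorem arrowhead_succ_succ (i : Fin m) : arrowhead α z d i.succ i.succ = d i :=
  diagonal_apply_eq d i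

theorem arrowhead_mulVec_zero (x : Fin (m + 1) → ℝ) :
    (arrowhead α z d *ᵥ x) 0 = α * x 0 + ∑ i, z i * x i.succ := by
  simp [arrowhead, mulVec, dotProduct, Fin.sum_univ_succ]

theorem arrowhead_mulVec_succ (x : Fin (m + 1) → ℝ) (i : Fin m) :
    (arrowhead α z d *ᵥ x) i.succ = z i * x 0 + d i * x i.succ := by
  simp [arrowhead, mulVec, dotProduct, Fin.sum_univ_succ, diagonal_apply]

theorem arrowhead_transpose : (arrowhead α z d)ᵀ = arrowhead α z d := by
  ext i j
  cases i using Fin.cases <;> cases j using Fin.cases <;>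
    simp [arrowhead, diagonal_apply, eq_comm]
  all_goals grind

theorem arrowhead_isHermitian : (arrowhead α z d).IsHermitian := arrowhead_transpose α z d

theorem arrowhead_sub (β : ℝ) (z' d' : Fin m → ℝ) :
    arrowhead α z d - arrowhead β z' d' = arrowhead (α - β) (z - z') (d - d') := by
  ext i j
  cases i using Fin.cases <;> cases j using Fin.cases <;>
    simp [arrowhead, diagonal_apply]
  split_ifs <;> simp

theorem arrowhead_zero_left : arrowhead 0 z d = arrowhead 0 z 0 + diagonal (Fin.cons 0 d) := by
  ext i j
  cases i using Fin.cases <;> cases j using Fin.cases <;>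
    simp [arrowhead, diagonal_apply]

variable {α z d}

theorem norm_arrowhead_zero_zero_le {a : ℝ} (ha : 0 ≤ a) (hz : ∑ i, z i ^ 2 ≤ a ^ 2) :
    ‖arrowhead 0 z 0‖ ≤ a := by
  refine norm_le_of_mulVec_dotProduct_self_le ha fun x => ?_
  have hcs := Finset.sum_mul_sq_le_sq_mul_sq Finset.univ z (fun i : Fin m => x i.succ)
  simp only [dotProduct, Fin.sum_univ_succ, arrowhead_mulVec_zero, arrowhead_mulVec_succ,
    Pi.zero_apply, zero_mul, zero_add, add_zero, ← sq, mul_pow, ← Finset.sum_mul] at hcs ⊢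
  have hx : 0 ≤ ∑ i : Fin m, x i.succ ^ 2 := Finset.sum_nonneg fun i _ => sq_nonneg _
  linarith [mul_le_mul_of_nonneg_right hz hx, mul_le_mul_of_nonneg_right hz (sq_nonneg (x 0))]

theorem norm_arrowhead_zero_le {a b : ℝ} (ha : 0 ≤ a) (hb : 0 ≤ b) (hz : ∑ i, z i ^ 2 ≤ a ^ 2)
    (hd : ∀ i, |d i| ≤ b) : ‖arrowhead 0 z d‖ ≤ a + b := by
  rw [arrowhead_zero_left]
  refine (norm_add_le _ _).trans (add_le_add (norm_arrowhead_zero_zero_le ha hz) ?_)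
  rw [l2_opNorm_diagonal, pi_norm_le_iff_of_nonneg hb]
  exact Fin.cases (by simpa using hb) hd

theorem abs_corner_le (h : ‖arrowhead α z d‖ ≤ 1) : |α| ≤ 1 :=
  (abs_apply_le_norm (arrowhead α z d) 0 0).trans h

theorem abs_diag_le (h : ‖arrowhead α z d‖ ≤ 1) (i : Fin m) : |d i| ≤ 1 :=
  arrowhead_succ_succ α z d i ▸ (abs_apply_le_norm _ _ _).trans h

theorem sum_sq_shaft_le (h : ‖arrowhead α z d‖ ≤ 1) : ∑ i, z i ^ 2 ≤ 1 := by
  have hcol := sum_sq_apply_le_norm_sq (arrowhead α z d) 0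
  simp only [Fin.sum_univ_succ, arrowhead_zero_zero, arrowhead_succ_zero] at hcol
  linarith [sq_nonneg α, pow_le_one₀ (n := 2) (norm_nonneg _) h]

theorem abs_shaft_le (h : ‖arrowhead α z d‖ ≤ 1) (i : Fin m) : |z i| ≤ 1 :=
  (abs_apply_le_norm (arrowhead α z d) i.succ 0).trans h

end Arrowhead

/-! ## The secular function -/

section Secular

open Finset

/-- The secular function of an arrowhead matrix with corner `α`, poles (diagonal entries)
`Y 0, …, Y (m - 1)` and weights (squared shaft entries) `W 0, …, W (m - 1)`. -/
noncomputable def secular (m : ℕ) (α : ℝ) (W Y : ℕ → ℝ) (x : ℝ) : ℝ :=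
  α - x + ∑ j ∈ range m, W j * (1 / (x - Y j))

/-- The numbers `e 1 < ⋯ < e m` are the poles `Y 0, …, Y (m - 1)` in increasing order. They lie in
`[-2, 2]` and are separated by `σ`, and they are framed by `e 0 = -8` and `e (m + 1) = 8`. -/
structure IsLadder (m : ℕ) (σ : ℝ) (Y e : ℕ → ℝ) : Prop where
  first : e 0 = -8
  last : e (m + 1) = 8
  abs_le : ∀ i < m, |Y i| ≤ 2
  gap : ∀ k ≤ m, e k + σ ≤ e (k + 1)
  eq : ∀ k < m, ∃ i < m, e (k + 1) = Y i
  avoid : ∀ k ≤ m, ∀ j < m, Y j ≤ e k ∨ e (k + 1) ≤ Y j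

/-- The number `lam k` is a root of the secular function between `e k` and `e (k + 1)`, and it is
at least `σ ^ 4` away from both. -/
structure SecularRoots (m : ℕ) (α σ : ℝ) (W Y e lam : ℕ → ℝ) : Prop where
  root : ∀ k ≤ m, secular m α W Y (lam k) = 0
  left : ∀ k ≤ m, e k + σ ^ 4 ≤ lam k
  right : ∀ k ≤ m, lam k + σ ^ 4 ≤ e (k + 1)

variable {m k : ℕ} {α σ x : ℝ} {W Y e lam : ℕ → ℝ}

theorem secular_neg (m : ℕ) (α : ℝ) (W Y : ℕ → ℝ) (x : ℝ) :
    secular m (-α) W (-Y) (-x) = -secular m α W Y x := by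
  have hterm : ∀ j, W j * (1 / (-x - (-Y) j)) = -(W j * (1 / (x - Y j))) := fun j => by
    rw [Pi.neg_apply, neg_sub_neg, ← neg_sub x, one_div_neg_eq_neg_one_div, mul_neg]
  simp only [secular, hterm, sum_neg_distrib]
  ring

theorem sub_le_secular_sub_secular {y : ℝ} (hW : ∀ j < m, 0 ≤ W j) (hxy : x ≤ y)
    (hY : ∀ j < m, Y j < x ∨ y < Y j) : y - x ≤ secular m α W Y x - secular m α W Y y := by
  have hsum : ∑ j ∈ range m, W j * (1 / (y - Y j)) ≤ ∑ j ∈ range m, W j * (1 / (x - Y j)) := by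
    refine sum_le_sum fun j hj => mul_le_mul_of_nonneg_left ?_ (hW j (mem_range.1 hj))
    rcases hY j (mem_range.1 hj) with h | h
    · exact one_div_le_one_div_of_le (by linarith) (by linarith)
    · exact one_div_le_one_div_of_neg_of_le (by linarith) (by linarith)
  simp only [secular]
  linarith

theorem continuousOn_secular {S : Set ℝ} (hY : ∀ j < m, Y j ∉ S) :
    ContinuousOn (secular m α W Y) S := by
  refine (by fun_prop : ContinuousOn (fun x : ℝ => α - x) S).add <|
    continuousOn_finsetSum _ fun j hj => continuousOn_const.mul <|
      continuousOn_const.div (by fun_prop) fun x hx => sub_ne_zero.2 ?_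
  exact fun h => hY j (mem_range.1 hj) (h ▸ hx)

theorem secular_pos_of_le (hα : |α| ≤ 1) (hW : ∀ j < m, 0 ≤ W j) (hsum : ∑ j ∈ range m, W j ≤ 4)
    (hY : ∀ j < m, -2 ≤ Y j) (hx : x ≤ -7) : 0 < secular m α W Y x := by
  have hterms : ∑ j ∈ range m, W j * (-1) ≤ ∑ j ∈ range m, W j * (1 / (x - Y j)) := by
    refine sum_le_sum fun j hj => mul_le_mul_of_nonneg_left ?_ (hW j (mem_range.1 hj))
    have := hY j (mem_range.1 hj)
    rw [le_div_iff_of_neg (by linarith)]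
    linarith
  rw [← sum_mul] at hterms
  simp only [secular]
  linarith [neg_le_of_abs_le hα]

theorem pow_four_le_div_four (hσ : 0 < σ) (hσ' : σ ≤ 1 / 128) : σ ^ 4 ≤ σ / 4 := by
  have hcube : σ ^ 3 ≤ (1 / 128) ^ 3 := pow_le_pow_left₀ hσ.le hσ' 3
  have : σ ^ 4 = σ * σ ^ 3 := by ring
  nlinarith

theorem secular_pos_of_near_pole {i : ℕ} (hα : |α| ≤ 1) (hW : ∀ j < m, 0 ≤ W j)
    (hsum : ∑ j ∈ range m, W j ≤ 4) (hσ : 0 < σ) (hσ' : σ ≤ 1 / 128) (hx : x ≤ 8) (hi : i < m)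
    (hWi : σ ^ 2 ≤ W i) (hix : Y i < x) (hxi : x ≤ Y i + σ ^ 4)
    (hgap : ∀ j < m, Y j ≤ Y i ∨ Y i + σ ≤ Y j) : 0 < secular m α W Y x := by
  have hσ4 := pow_four_le_div_four hσ hσ'
  have hterm : ∀ j < m, 0 ≤ W j * (1 / (x - Y j) + 2 / σ) := fun j hj => by
    refine mul_nonneg (hW j hj) ?_
    rcases hgap j hj with h | h
    · have : 0 < x - Y j := by linarith
      positivity
    · have : 1 / (Y j - x) ≤ 2 / σ := by
        rw [div_le_div_iff₀ (by linarith) hσ]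
        linarith
      rw [← neg_sub, one_div_neg_eq_neg_one_div]
      linarith
  have hpole : 1 / σ ^ 2 ≤ W i * (1 / (x - Y i)) := by
    rw [mul_one_div, div_le_div_iff₀ (by positivity) (by linarith)]
    nlinarith [pow_pos hσ 2]
  have hsingle := single_le_sum (f := fun j => W j * (1 / (x - Y j) + 2 / σ))
    (fun j hj => hterm j (mem_range.1 hj)) (mem_range.2 hi)
  simp only [mul_add, sum_add_distrib, ← sum_mul] at hsingle
  have hWi' : 0 ≤ W i * (2 / σ) := mul_nonneg (hW i hi) (by positivity)
  have hsum' : (∑ j ∈ range m, W j) * (2 / σ) ≤ 4 * (2 / σ) :=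
    mul_le_mul_of_nonneg_right hsum (by positivity)
  have hlarge : 128 ≤ 1 / σ := by
    rw [le_div_iff₀ hσ]
    linarith
  have hsq : 1 / σ ^ 2 = 1 / σ * (1 / σ) := by rw [sq, one_div_mul_one_div]
  have hlin : 4 * (2 / σ) = 8 * (1 / σ) := by ring
  simp only [secular]
  nlinarith [neg_le_of_abs_le hα]

namespace IsLadder

theorem neg (h : IsLadder m σ Y e) : IsLadder m σ (-Y) (fun k => -e (m + 1 - k)) where
  first := by simp [h.last]
  last := by simp [h.first]
  abs_le i hi := by simpa using h.abs_le i hi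
  gap k hk := by
    have := h.gap (m - k) (Nat.sub_le _ _)
    rw [show m + 1 - k = m - k + 1 by omega, Nat.add_sub_add_right]
    linarith
  eq k hk := by
    obtain ⟨i, hi, hei⟩ := h.eq (m - k - 1) (by omega)
    exact ⟨i, hi, by rw [Pi.neg_apply, ← hei, Nat.add_sub_add_right, Nat.sub_add_cancel (by omega)]⟩
  avoid k hk j hj := by
    rw [show m + 1 - k = m - k + 1 by omega, Nat.add_sub_add_right, Pi.neg_apply, neg_le_neg_iff,
      neg_le_neg_iff]
    exact (h.avoid (m - k) (Nat.sub_le _ _) j hj).symm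

theorem lower (h : IsLadder m σ Y e) (hk : k ≤ m) : -8 ≤ e k := by
  rcases k with _ | k
  · exact h.first.ge
  · obtain ⟨i, hi, hei⟩ := h.eq k hk
    linarith [neg_le_of_abs_le (h.abs_le i hi)]

theorem upper (h : IsLadder m σ Y e) (hk : k ≤ m) : e (k + 1) ≤ 8 := by
  rcases hk.lt_or_eq with hk | rfl
  · obtain ⟨i, hi, hei⟩ := h.eq k hk
    linarith [le_of_abs_le (h.abs_le i hi)]
  · exact h.last.le

theorem le_abs_sub {g : ℝ} {j : ℕ} (h : IsLadder m σ Y e) (hk : k ≤ m) (hj : j < m)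
    (hl : e k + g ≤ x) (hr : x + g ≤ e (k + 1)) : g ≤ |x - Y j| := by
  rcases h.avoid k hk j hj with hY | hY
  · exact le_trans (by linarith) (le_abs_self _)
  · exact le_trans (by linarith) (neg_le_abs _)

theorem secular_pos (h : IsLadder m σ Y e) (hα : |α| ≤ 1) (hσ : 0 < σ) (hσ' : σ ≤ 1 / 128)
    (hW : ∀ j < m, σ ^ 2 ≤ W j) (hsum : ∑ j ∈ range m, W j ≤ 4) (hk : k ≤ m) :
    0 < secular m α W Y (e k + σ ^ 4) := by
  have hW0 : ∀ j < m, 0 ≤ W j := fun j hj => (sq_nonneg σ).trans (hW j hj)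
  have hσ4 := pow_four_le_div_four hσ hσ'
  rcases k with _ | k
  · refine secular_pos_of_le hα hW0 hsum (fun j hj => neg_le_of_abs_le (h.abs_le j hj)) ?_
    linarith [h.first]
  · obtain ⟨i, hi, hei⟩ := h.eq k hk
    have hgap := h.gap (k + 1) hk
    rw [hei] at hgap ⊢
    refine secular_pos_of_near_pole hα hW0 hsum hσ hσ' (by linarith [h.upper hk]) hi (hW i hi)
      (lt_add_of_pos_right _ (pow_pos hσ 4)) le_rfl fun j hj => ?_
    exact (h.avoid (k + 1) hk j hj).imp (fun hY => hei ▸ hY) hgap.trans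

theorem secular_neg (h : IsLadder m σ Y e) (hα : |α| ≤ 1) (hσ : 0 < σ) (hσ' : σ ≤ 1 / 128)
    (hW : ∀ j < m, σ ^ 2 ≤ W j) (hsum : ∑ j ∈ range m, W j ≤ 4) (hk : k ≤ m) :
    secular m α W Y (e (k + 1) - σ ^ 4) < 0 := by
  have hpos := h.neg.secular_pos (α := -α) (by rwa [abs_neg]) hσ hσ' hW hsum (Nat.sub_le m k)
  rw [show m + 1 - (m - k) = k + 1 by omega, neg_add_eq_sub, ← neg_sub, _root_.secular_neg] at hpos
  exact neg_pos.1 hpos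

theorem exists_secularRoots (h : IsLadder m σ Y e) (hα : |α| ≤ 1) (hσ : 0 < σ) (hσ' : σ ≤ 1 / 128)
    (hW : ∀ j < m, σ ^ 2 ≤ W j) (hsum : ∑ j ∈ range m, W j ≤ 4) :
    ∃ lam, SecularRoots m α σ W Y e lam := by
  have hroot : ∀ k ≤ m, ∃ x, secular m α W Y x = 0 ∧ e k + σ ^ 4 ≤ x ∧ x + σ ^ 4 ≤ e (k + 1) := by
    intro k hk
    have hgap := h.gap k hk
    have hσ4 := pow_four_le_div_four hσ hσ'
    have hσ4' := pow_pos hσ 4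
    have hcont : ContinuousOn (secular m α W Y) (Set.Icc (e k + σ ^ 4) (e (k + 1) - σ ^ 4)) :=
      continuousOn_secular fun j hj hY =>
        (h.avoid k hk j hj).elim (fun h => by linarith [hY.1]) (fun h => by linarith [hY.2])
    obtain ⟨x, hx, h0⟩ := intermediate_value_Icc' (by linarith) hcont
      ⟨(h.secular_neg hα hσ hσ' hW hsum hk).le, (h.secular_pos hα hσ hσ' hW hsum hk).le⟩
    exact ⟨x, h0, hx.1, by linarith [hx.2]⟩
  choose! lam hlam using hroot
  exact ⟨lam, fun k hk => (hlam k hk).1, fun k hk => (hlam k hk).2.1, fun k hk => (hlam k hk).2.2⟩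

end IsLadder

namespace SecularRoots

theorem pow_four_le_abs_sub {j : ℕ} (h : SecularRoots m α σ W Y e lam) (hl : IsLadder m σ Y e)
    (hk : k ≤ m) (hj : j < m) : σ ^ 4 ≤ |lam k - Y j| :=
  hl.le_abs_sub hk hj (h.left k hk) (h.right k hk)

theorem strictMono (h : SecularRoots m α σ W Y e lam) (hσ : 0 < σ) :
    StrictMono fun k : Fin (m + 1) => lam k := by
  rw [Fin.strictMono_iff_lt_succ]
  intro k
  have hleft := h.right k (by omega)
  have hright := h.left (k + 1) (by omega)
  have := pow_pos hσ 4
  simp only [Fin.val_castSucc, Fin.val_succ]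
  linarith

theorem sub_le_secular (h : SecularRoots m α σ W Y e lam) (hl : IsLadder m σ Y e) (hσ : 0 < σ)
    (hW : ∀ j < m, 0 ≤ W j) (hk : k ≤ m) (hx : e k < x) (hxk : x ≤ lam k) :
    lam k - x ≤ secular m α W Y x := by
  have := sub_le_secular_sub_secular (α := α) hW hxk (Y := Y) fun j hj =>
    (hl.avoid k hk j hj).imp (fun hY => by linarith)
      (fun hY => by linarith [h.right k hk, pow_pos hσ 4])
  linarith [h.root k hk]

theorem secular_le_sub (h : SecularRoots m α σ W Y e lam) (hl : IsLadder m σ Y e) (hσ : 0 < σ)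
    (hW : ∀ j < m, 0 ≤ W j) (hk : k ≤ m) (hx : x < e (k + 1)) (hxk : lam k ≤ x) :
    secular m α W Y x ≤ lam k - x := by
  have := sub_le_secular_sub_secular (α := α) hW hxk (Y := Y) fun j hj =>
    (hl.avoid k hk j hj).imp (fun hY => by linarith [h.left k hk, pow_pos hσ 4])
      (fun hY => by linarith)
  linarith [h.root k hk]

theorem add_pow_le_of_abs_sub_le (h : SecularRoots m α σ W Y e lam) (hσ : 0 < σ) (hσ' : σ ≤ 1 / 2)
    (hk : k ≤ m) (hx : |x - lam k| ≤ 2 * σ ^ 32) :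
    e k + σ ^ 64 ≤ x ∧ x + σ ^ 64 ≤ e (k + 1) := by
  have hpow {i : ℕ} (hi : 6 ≤ i) : σ ^ i ≤ σ ^ 4 / 4 :=
    calc σ ^ i ≤ σ ^ 6 := pow_le_pow_of_le_one hσ.le (by linarith) hi
      _ = σ ^ 4 * σ ^ 2 := by ring
      _ ≤ σ ^ 4 * (1 / 2) ^ 2 := by gcongr
      _ = σ ^ 4 / 4 := by ring
  obtain ⟨hlo, hhi⟩ := abs_le.1 hx
  have h32 := hpow (show 6 ≤ 32 by norm_num)
  have h64 := hpow (show 6 ≤ 64 by norm_num)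
  constructor <;> linarith [h.left k hk, h.right k hk]

end SecularRoots

/-- The interval `[lo, hi]` after `t` rounds of the bisection with inexact values of the secular
function, whose errors are at most `δ`. -/
structure IsBracket (σ δ : ℝ) (e lam : ℕ → ℝ) (t k : ℕ) (lo hi : ℝ) : Prop where
  left : e k ≤ lo
  right : hi ≤ e (k + 1)
  long : σ / 2 ^ t ≤ hi - lo
  short : hi - lo ≤ 16 / 2 ^ t
  lower : lo - δ ≤ lam k
  upper : lam k ≤ hi + δ

theorem SecularRoots.isBracket_zero {δ : ℝ} (h : SecularRoots m α σ W Y e lam)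
    (hl : IsLadder m σ Y e) (hσ : 0 < σ) (hδ : 0 ≤ δ) (hk : k ≤ m) :
    IsBracket σ δ e lam 0 k (e k) (e (k + 1)) where
  left := le_rfl
  right := le_rfl
  long := by linarith [hl.gap k hk]
  short := by linarith [hl.lower hk, hl.upper hk]
  lower := by linarith [h.left k hk, pow_pos hσ 4]
  upper := by linarith [h.right k hk, pow_pos hσ 4]

namespace IsBracket

variable {δ lo hi g : ℝ} {t : ℕ}

theorem left_add_le_mid (h : IsBracket σ δ e lam t k lo hi) :
    e k + σ / 2 ^ t / 2 ≤ (lo + hi) / 2 := by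
  linarith [h.left, h.long]

theorem mid_add_le_right (h : IsBracket σ δ e lam t k lo hi) :
    (lo + hi) / 2 + σ / 2 ^ t / 2 ≤ e (k + 1) := by
  linarith [h.right, h.long]

theorem upper_half (h : IsBracket σ δ e lam t k lo hi) (hlam : (lo + hi) / 2 - δ ≤ lam k)
    (hlo : lo ≤ hi) : IsBracket σ δ e lam (t + 1) k ((lo + hi) / 2) hi where
  left := by linarith [h.left]
  right := h.right
  long := by
    rw [pow_succ, ← div_div]
    linarith [h.long]
  short := by
    rw [pow_succ, ← div_div]
    linarith [h.short]
  lower := hlam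
  upper := h.upper

theorem lower_half (h : IsBracket σ δ e lam t k lo hi) (hlam : lam k ≤ (lo + hi) / 2 + δ)
    (hlo : lo ≤ hi) : IsBracket σ δ e lam (t + 1) k lo ((lo + hi) / 2) where
  left := h.left
  right := by linarith [h.right]
  long := by
    rw [pow_succ, ← div_div]
    linarith [h.long]
  short := by
    rw [pow_succ, ← div_div]
    linarith [h.short]
  lower := h.lower
  upper := hlam

theorem halve (h : IsBracket σ δ e lam t k lo hi) (hr : SecularRoots m α σ W Y e lam)
    (hl : IsLadder m σ Y e) (hσ : 0 < σ) (hW : ∀ j < m, 0 ≤ W j) (hk : k ≤ m)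
    (hg : |g - secular m α W Y ((lo + hi) / 2)| ≤ δ) :
    if 0 < g then IsBracket σ δ e lam (t + 1) k ((lo + hi) / 2) hi
    else IsBracket σ δ e lam (t + 1) k lo ((lo + hi) / 2) := by
  have hlen : 0 < σ / 2 ^ t := by positivity
  have hleft := h.left_add_le_mid
  have hright := h.mid_add_le_right
  obtain ⟨hg₁, hg₂⟩ := abs_le.1 hg
  split_ifs with h0
  · refine h.upper_half (not_lt.1 fun hlt => ?_) (by linarith [h.long])
    have := hr.secular_le_sub hl hσ hW hk (x := (lo + hi) / 2) (by linarith) (by linarith)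
    linarith
  · refine h.lower_half (not_lt.1 fun hlt => ?_) (by linarith [h.long])
    have := hr.sub_le_secular hl hσ hW hk (x := (lo + hi) / 2) (by linarith) (by linarith)
    linarith

theorem abs_left_sub_le (h : IsBracket σ δ e lam t k lo hi) : |lo - lam k| ≤ 16 / 2 ^ t + δ := by
  have : (0 : ℝ) < 16 / 2 ^ t := by positivity
  rw [abs_le]
  constructor <;> linarith [h.lower, h.upper, h.short]

end IsBracket

end Secular

/-! ## Dyadic cells -/

section Cells

open Finset

/-- The number of the dyadic cell of level `l` that contains `y`. The cells that meet `[1, 2)` are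
the nodes of a binary tree in heap order: the root is `1`, and the children of `v` are `2 * v` and
`2 * v + 1`. -/
noncomputable def node (y : ℝ) (l : ℕ) : ℕ := ⌊y * 2 ^ l⌋₊

/-- In the order by cells `g`, ties being broken by the indices, the `k`-th of the indices
`0, …, m - 1` is the `c`-th index in the cell `v`; ranks start at `0`. -/
structure HasRank (g : ℕ → ℕ) (m k v c : ℕ) : Prop where
  rank : Nat.count (g · < v) m + c = k
  lt : c < Nat.count (g · = v) m

/-- The contents of the counting tree of depth `L` after the insertion of `y 0, …, y (i - 1)`: each
point is counted at all nodes that contain it, except for the root. -/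
noncomputable def treeCount (y : ℕ → ℝ) (L i v : ℕ) : ℕ :=
  ∑ j ∈ range i, Nat.count (fun l => node (y j) (l + 1) = v) L

/-- The perturbed points: the `c`-th point of the cell `v` of width `h` is moved to the left end of
the cell plus `(c + 1) * σ`. The shift by `6` undoes the normalization `y j = (d j + 6) / 4`. -/
noncomputable def spread (g : ℕ → ℕ) (h σ : ℝ) (i : ℕ) : ℝ :=
  g i * h - 6 + (Nat.count (g · = g i) i + 1 : ℕ) * σ

theorem node_zero {y : ℝ} (hy : y ∈ Set.Ico (1 : ℝ) 2) : node y 0 = 1 := by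
  rw [node, pow_zero, mul_one, Nat.floor_eq_iff (by linarith [hy.1])]
  norm_num
  exact hy

theorem node_succ {y : ℝ} (hy : 0 ≤ y) (l : ℕ) :
    node y (l + 1) =
      if y * 2 ^ l * 2 < (2 * node y l + 1 : ℕ) then 2 * node y l else 2 * node y l + 1 := by
  have hle := Nat.floor_le (a := y * 2 ^ l) (by positivity)
  have hlt := Nat.lt_floor_add_one (y * 2 ^ l)
  rw [node, Nat.floor_eq_iff (by positivity), pow_succ, ← mul_assoc, node]
  split_ifs with h <;> push_cast at * <;> constructor <;> linarith

theorem node_div_two {y : ℝ} (hy : 0 ≤ y) (l : ℕ) : node y (l + 1) / 2 = node y l := by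
  rw [node_succ hy]
  split_ifs <;> omega

theorem log_node {y : ℝ} (hy : y ∈ Set.Ico (1 : ℝ) 2) (l : ℕ) : Nat.log 2 (node y l) = l := by
  have hpow : (0 : ℝ) < 2 ^ l := by positivity
  refine Nat.log_eq_of_pow_le_of_lt_pow ?_ ?_
  · rw [node, Nat.le_floor_iff' (by positivity)]
    push_cast
    exact le_mul_of_one_le_left hpow.le hy.1
  · rw [node, Nat.floor_lt' (by positivity), pow_succ']
    push_cast
    exact mul_lt_mul_of_pos_right hy.2 hpow

theorem treeCount_succ (y : ℕ → ℝ) (L i v : ℕ) :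
    treeCount y L (i + 1) v = treeCount y L i v + Nat.count (fun l => node (y i) (l + 1) = v) L :=
  sum_range_succ _ _

theorem treeCount_eq {y : ℕ → ℝ} {L l v : ℕ} (hy : ∀ j, y j ∈ Set.Ico (1 : ℝ) 2) (hl : l < L)
    (hv : Nat.log 2 v = l + 1) (i : ℕ) :
    treeCount y L i v = Nat.count (fun j => node (y j) (l + 1) = v) i := by
  have hpath : ∀ j, Nat.count (fun l' => node (y j) (l' + 1) = v) L =
      if node (y j) (l + 1) = v then 1 else 0 := fun j => by
    have hlevel : ∀ l', node (y j) (l' + 1) = v → l' = l := fun l' h => by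
      have := log_node (hy j) (l' + 1)
      rw [h, hv] at this
      omega
    rw [Nat.count_eq_card_filter_range, card_filter, sum_eq_single l]
    · exact fun l' _ hne => if_neg fun h => hne (hlevel l' h)
    · exact fun h => absurd (mem_range.2 hl) h
  rw [treeCount, Nat.count_eq_card_filter_range, card_filter]
  exact sum_congr rfl fun j _ => hpath j

section Rank

variable {g g' : ℕ → ℕ} {m k v c : ℕ}

theorem HasRank.zero (hg : ∀ j, g j = v) (hk : k < m) : HasRank g m k v k where
  rank := by simp [hg]
  lt := by simpa [hg]

theorem count_lt_two_mul (hg : ∀ j, g' j / 2 = g j) (m v : ℕ) :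
    Nat.count (g' · < 2 * v) m = Nat.count (g · < v) m := by
  simp only [← hg, Nat.div_lt_iff_lt_mul two_pos, mul_comm v]

theorem count_lt_succ (g : ℕ → ℕ) (m v : ℕ) :
    Nat.count (g · < v + 1) m = Nat.count (g · < v) m + Nat.count (g · = v) m := by
  induction m with
  | zero => simp
  | succ m ih =>
    simp only [Nat.count_succ, ih]
    split_ifs <;> omega

theorem count_eq_children (hg : ∀ j, g' j / 2 = g j) (m v : ℕ) :
    Nat.count (g · = v) m =
      Nat.count (g' · = 2 * v) m + Nat.count (g' · = 2 * v + 1) m := by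
  induction m with
  | zero => simp
  | succ m ih =>
    have := hg m
    simp only [Nat.count_succ, ih]
    split_ifs <;> omega

theorem HasRank.descend (h : HasRank g m k v c) (hg : ∀ j, g' j / 2 = g j) :
    if c < Nat.count (g' · = 2 * v) m then HasRank g' m k (2 * v) c
    else HasRank g' m k (2 * v + 1) (c - Nat.count (g' · = 2 * v) m) := by
  have hrank := h.rank
  have hlt := h.lt
  rw [← count_lt_two_mul hg] at hrank
  rw [count_eq_children hg] at hlt
  split_ifs with hc
  · exact ⟨hrank, hc⟩
  · refine ⟨?_, by omega⟩
    rw [count_lt_succ]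
    omega

theorem HasRank.exists_index (h : HasRank g m k v c) :
    ∃ i < m, g i = v ∧ Nat.count (g · = v) i = c :=
  have hcard : ∀ hf : (Set.ofPred (g · = v)).Finite, c < hf.toFinset.card := fun hf =>
    h.lt.trans_le (Nat.count_le_card hf m)
  ⟨Nat.nth (g · = v) c, Nat.nth_lt_of_lt_count h.lt, Nat.nth_mem (p := (g · = v)) c hcard,
    Nat.count_nth hcard⟩

theorem HasRank.log_two_mul {y : ℕ → ℝ} {l : ℕ} (hy : ∀ j, y j ∈ Set.Ico (1 : ℝ) 2)
    (h : HasRank (fun j => node (y j) l) m k v c) : Nat.log 2 (2 * v) = l + 1 := by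
  obtain ⟨i, -, rfl, -⟩ := h.exists_index
  have hpos : 0 < node (y i) l :=
    Nat.floor_pos.2 (one_le_mul_of_one_le_of_one_le (hy i).1 (one_le_pow₀ one_le_two))
  rw [mul_comm, Nat.log_mul_base one_lt_two hpos.ne', log_node (hy i)]

theorem card_lex_eq_count {i : ℕ} (g : ℕ → ℕ) (hi : i < m) :
    #{j ∈ range m | g j < g i ∨ g j = g i ∧ j < i} =
      Nat.count (g · < g i) m + Nat.count (g · = g i) i := by
  have htie : {j ∈ range m | g j = g i ∧ j < i} = {j ∈ range i | g j = g i} := by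
    ext j
    simp only [mem_filter, mem_range]
    constructor <;> intro h <;> refine ⟨?_, ?_⟩ <;> grind
  rw [filter_or, card_union_of_disjoint, htie, Nat.count_eq_card_filter_range,
    Nat.count_eq_card_filter_range]
  exact disjoint_filter.2 fun j _ hlt heq => hlt.ne heq.1

end Rank

section Spread

variable {g : ℕ → ℕ} {m i j : ℕ} {h σ : ℝ}

theorem spread_add_le_spread (hσ : 0 ≤ σ) (hm : m * σ ≤ h) (hi : i < m)
    (hij : g i < g j ∨ g i = g j ∧ i < j) : spread g h σ i + σ ≤ spread g h σ j := by
  rcases hij with hij | ⟨heq, hij⟩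
  · have hcell : ((g i : ℝ) + 1) * h ≤ g j * h :=
      mul_le_mul_of_nonneg_right (by exact_mod_cast hij) (le_trans (by positivity) hm)
    have hcount : ((Nat.count (g · = g i) i + 1 : ℕ) : ℝ) * σ ≤ m * σ :=
      mul_le_mul_of_nonneg_right (by exact_mod_cast ((Nat.count_le _).trans_lt hi)) hσ
    have hcount' : (1 : ℝ) * σ ≤ (Nat.count (g · = g j) j + 1 : ℕ) * σ :=
      mul_le_mul_of_nonneg_right (by exact_mod_cast Nat.le_add_left _ _) hσ
    simp only [spread]
    linarith
  · have hcount : ((Nat.count (g · = g j) i + 1 + 1 : ℕ) : ℝ) * σ ≤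
        (Nat.count (g · = g j) j + 1 : ℕ) * σ :=
      mul_le_mul_of_nonneg_right
        (by exact_mod_cast Nat.succ_le_succ (Nat.count_strict_mono (p := (g · = g j)) heq hij)) hσ
    simp only [spread, heq]
    push_cast at hcount ⊢
    linarith

theorem spread_lt_spread_iff (hσ : 0 < σ) (hm : m * σ ≤ h) (hi : i < m) (hj : j < m) :
    spread g h σ i < spread g h σ j ↔ g i < g j ∨ g i = g j ∧ i < j := by
  refine ⟨fun hlt => ?_, fun hij => ?_⟩
  · by_contra hij
    rcases (by omega : i = j ∨ g j < g i ∨ g j = g i ∧ j < i) with rfl | hji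
    · exact hlt.false
    · linarith [spread_add_le_spread hσ.le hm hj hji]
  · linarith [spread_add_le_spread hσ.le hm hi hij]

theorem abs_spread_sub_le {y : ℕ → ℝ} {L : ℕ} (hσ : 0 ≤ σ) (hy : 0 ≤ y i)
    (hi : (i + 1) * σ ≤ 4 / 2 ^ L) :
    |spread (fun j => node (y j) L) (4 / 2 ^ L) σ i - (4 * y i - 6)| ≤ 4 / 2 ^ L := by
  have hle := Nat.floor_le (a := y i * 2 ^ L) (by positivity)
  have hlt := Nat.lt_floor_add_one (y i * 2 ^ L)
  have hcell : (y i * 2 ^ L) * (4 / 2 ^ L) = 4 * y i := by field_simp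
  have hcount : ((Nat.count (fun j => node (y j) L = node (y i) L) i + 1 : ℕ) : ℝ) * σ ≤
      (i + 1) * σ :=
    mul_le_mul_of_nonneg_right (by exact_mod_cast Nat.succ_le_succ (Nat.count_le _)) hσ
  have hcount' : 0 ≤ ((Nat.count (fun j => node (y j) L = node (y i) L) i + 1 : ℕ) : ℝ) * σ := by
    positivity
  have hpos : (0 : ℝ) < 4 / 2 ^ L := by positivity
  have hle' := mul_le_mul_of_nonneg_right hle hpos.le
  have hlt' := mul_lt_mul_of_pos_right hlt hpos
  rw [add_mul, one_mul] at hlt'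
  simp only [spread]
  rw [abs_le, show (node (y i) L : ℝ) = ⌊y i * 2 ^ L⌋₊ from rfl]
  constructor <;> linarith

end Spread

section Ladder

variable {Y e : ℕ → ℝ} {m : ℕ} {σ : ℝ}

theorem card_lt_lt_card_lt {x x' : ℝ} {i : ℕ} (hi : i < m) (hx : x ≤ Y i) (hx' : Y i < x') :
    #{j ∈ range m | Y j < x} < #{j ∈ range m | Y j < x'} := by
  refine card_lt_card ⟨?_, fun h => ?_⟩
  · exact monotone_filter_right _ fun j _ hj => hj.trans (hx.trans_lt hx')
  · have := h (mem_filter.2 ⟨mem_range.2 hi, hx'⟩)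
    exact (mem_filter.1 this).2.not_ge hx

theorem lt_of_card_lt_lt_card_lt {x x' : ℝ}
    (h : #{j ∈ range m | Y j < x} < #{j ∈ range m | Y j < x'}) : x < x' :=
  lt_of_not_ge fun hx =>
    h.not_ge (card_le_card (monotone_filter_right _ fun _ _ hj => hj.trans_le hx))

theorem isLadder_of_card_lt (hfirst : e 0 = -8) (hlast : e (m + 1) = 8) (hσ : σ ≤ 6)
    (habs : ∀ i < m, |Y i| ≤ 2) (hsep : ∀ i < m, ∀ j < m, Y i < Y j → Y i + σ ≤ Y j)
    (hrank : ∀ k < m, ∃ i < m, e (k + 1) = Y i ∧ #{j ∈ range m | Y j < Y i} = k) :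
    IsLadder m σ Y e where
  first := hfirst
  last := hlast
  abs_le := habs
  gap k hk := by
    rcases k with _ | k
    · rcases m.eq_zero_or_pos with rfl | hm
      · linarith
      · obtain ⟨i, hi, hei, -⟩ := hrank 0 hm
        linarith [neg_le_of_abs_le (habs i hi)]
    · obtain ⟨i, hi, hei, hri⟩ := hrank k hk
      rcases hk.lt_or_eq with hk | rfl
      · obtain ⟨j, hj, hej, hrj⟩ := hrank (k + 1) hk
        rw [hei, hej]
        exact hsep i hi j hj (lt_of_card_lt_lt_card_lt (by rw [hri, hrj]; exact k.lt_succ_self))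
      · linarith [le_of_abs_le (habs i hi)]
  eq k hk := (hrank k hk).imp fun i hi => ⟨hi.1, hi.2.1⟩
  avoid k hk j hj := by
    by_contra! ⟨hlt, hlt'⟩
    have hbelow : k ≤ #{i ∈ range m | Y i < Y j} := by
      rcases k with _ | k
      · exact Nat.zero_le _
      · obtain ⟨i, hi, hei, hri⟩ := hrank k hk
        have := card_lt_lt_card_lt hi le_rfl (hei ▸ hlt)
        omega
    have habove := card_lt_lt_card_lt hj le_rfl hlt'
    rcases hk.lt_or_eq with hk | rfl
    · obtain ⟨i, -, hei, hri⟩ := hrank k hk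
      rw [hei, hri] at habove
      omega
    · have := card_filter_le (range k) (Y · < e (k + 1))
      rw [card_range] at this
      omega

theorem isLadder_spread {g : ℕ → ℕ} {h : ℝ} (hfirst : e 0 = -8) (hlast : e (m + 1) = 8)
    (hσ : 0 < σ) (hσ' : σ ≤ 6) (hm : m * σ ≤ h) (hY : ∀ i < m, Y i = spread g h σ i)
    (habs : ∀ i < m, |Y i| ≤ 2)
    (he : ∀ k < m, ∃ v c, HasRank g m k v c ∧ e (k + 1) = v * h - 6 + (c + 1 : ℕ) * σ) :
    IsLadder m σ Y e := by
  have hlex : ∀ i < m, ∀ j < m, Y i < Y j ↔ g i < g j ∨ g i = g j ∧ i < j := fun i hi j hj => by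
    rw [hY i hi, hY j hj, spread_lt_spread_iff hσ hm hi hj]
  refine isLadder_of_card_lt hfirst hlast hσ' habs (fun i hi j hj hij => ?_) fun k hk => ?_
  · rw [hY i hi, hY j hj]
    exact spread_add_le_spread hσ.le hm hi ((hlex i hi j hj).1 hij)
  · obtain ⟨v, c, hr, hek⟩ := he k hk
    obtain ⟨i, hi, rfl, rfl⟩ := hr.exists_index
    refine ⟨i, hi, by rw [hek, hY i hi, spread], ?_⟩
    rw [filter_congr fun j hj => hlex j (mem_range.1 hj) i hi, card_lex_eq_count g hi, hr.rank]

end Ladder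


end Cells

/-! ## Eigenvectors of arrowhead matrices -/

section Eigen

open Finset Matrix
open scoped Matrix.Norms.L2Operator

variable {m : ℕ} {ε α σ x : ℝ} {z d Z Y e lam : ℕ → ℝ}

/-- The candidate `(1, Z j / (x - Y j))` for an eigenvector to the eigenvalue `x` of the arrowhead
matrix with shaft `Z` and diagonal `Y`. -/
noncomputable def arrowVec (m : ℕ) (Z Y : ℕ → ℝ) (x : ℝ) : Fin (m + 1) → ℝ :=
  Fin.cons 1 fun j : Fin m => Z j / (x - Y j)

theorem arrowVec_ne_zero (m : ℕ) (Z Y : ℕ → ℝ) (x : ℝ) : arrowVec m Z Y x ≠ 0 := fun h =>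
  one_ne_zero (congrFun h 0)

theorem arrowVec_dotProduct_self (m : ℕ) (Z Y : ℕ → ℝ) (x : ℝ) :
    arrowVec m Z Y x ⬝ᵥ arrowVec m Z Y x =
      1 + ∑ j ∈ range m, Z j ^ 2 * (1 / (x - Y j) ^ 2) := by
  simp only [dotProduct, Fin.sum_univ_succ, sum_range, arrowVec, Fin.cons_zero, Fin.cons_succ,
    ← sq, div_pow, mul_one_div, one_pow]

theorem arrowhead_mulVec_arrowVec (hx : secular m α (fun j => Z j ^ 2) Y x = 0)
    (hY : ∀ j < m, x - Y j ≠ 0) :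
    arrowhead α (fun i : Fin m => Z i) (fun i => Y i) *ᵥ arrowVec m Z Y x =
      x • arrowVec m Z Y x := by
  ext i
  cases i using Fin.cases with
  | zero =>
    rw [secular, sum_range] at hx
    simp only [arrowhead_mulVec_zero, arrowVec, Fin.cons_zero, Fin.cons_succ, Pi.smul_apply,
      smul_eq_mul, mul_one, mul_div_assoc', ← sq]
    simp only [mul_one_div] at hx
    linarith
  | succ j =>
    have := hY j j.2
    simp only [arrowhead_mulVec_succ, arrowVec, Fin.cons_zero, Fin.cons_succ, Pi.smul_apply,
      smul_eq_mul]
    field_simp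
    ring

theorem SecularRoots.diagonalizes (h : SecularRoots m α σ (fun j => Z j ^ 2) Y e lam)
    (hl : IsLadder m σ Y e) (hσ : 0 < σ) :
    Diagonalizes (arrowhead α (fun i : Fin m => Z i) (fun i => Y i))
      (normalized fun k : Fin (m + 1) => arrowVec m Z Y (lam k)) (fun k => lam k) :=
  diagonalizes_normalized (arrowhead_transpose _ _ _) (fun _ => arrowVec_ne_zero _ _ _ _)
    (h.strictMono hσ).injective fun k =>
      have hk := Nat.lt_succ_iff.1 k.2
      arrowhead_mulVec_arrowVec (h.root k hk) fun _ hj =>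
        abs_pos.1 <| (pow_pos hσ 4).trans_le <| h.pow_four_le_abs_sub hl hk hj

theorem SecularRoots.abs_lt (h : SecularRoots m α σ (fun j => Z j ^ 2) Y e lam)
    (hl : IsLadder m σ Y e) (hσ : 0 < σ) {k : ℕ} (hk : k ≤ m) : |lam k| < 8 := by
  have := pow_pos hσ 4
  exact _root_.abs_lt.2 ⟨by linarith [hl.lower hk, h.left k hk],
    by linarith [hl.upper hk, h.right k hk]⟩

/-! ## The perturbed matrix -/

/-- The number `x`, moved away from zero by `σ`. -/
noncomputable def pushAway (σ x : ℝ) : ℝ := if x < 0 then x - σ else x + σ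

theorem abs_pushAway_sub (hσ : 0 ≤ σ) : |pushAway σ x - x| ≤ σ := by
  unfold pushAway
  split_ifs <;> rw [abs_le] <;> constructor <;> linarith

theorem sq_le_pushAway_sq (hσ : 0 ≤ σ) : σ ^ 2 ≤ pushAway σ x ^ 2 := by
  unfold pushAway
  split_ifs <;> nlinarith

theorem pushAway_sq_le (σ x : ℝ) : pushAway σ x ^ 2 ≤ 2 * x ^ 2 + 2 * σ ^ 2 := by
  unfold pushAway
  split_ifs <;> nlinarith [sq_nonneg (x - σ), sq_nonneg (x + σ)]

theorem sum_pushAway_sq_le (hσ : 0 ≤ σ) (hmσ : m * σ ≤ 1) (hσ' : σ ≤ 1)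
    (hz : ∑ j ∈ range m, z j ^ 2 ≤ 1) : ∑ j ∈ range m, pushAway σ (z j) ^ 2 ≤ 4 :=
  calc ∑ j ∈ range m, pushAway σ (z j) ^ 2 ≤ ∑ j ∈ range m, (2 * z j ^ 2 + 2 * σ ^ 2) :=
        sum_le_sum fun _ _ => pushAway_sq_le _ _
    _ = 2 * ∑ j ∈ range m, z j ^ 2 + 2 * (m * σ) * σ := by
        rw [sum_add_distrib, ← mul_sum, sum_const, card_range, nsmul_eq_mul]
        ring
    _ ≤ 4 := by nlinarith [mul_le_one₀ hmσ hσ hσ']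

/-- The arrowhead matrix with shaft `Z` and diagonal `Y` is close to the one with shaft `z` and
diagonal `d`, its poles are separated by `σ`, and its eigenvalues `lam` are separated from the
poles. -/
structure IsPerturbation (m : ℕ) (ε α σ : ℝ) (z d Z Y e lam : ℕ → ℝ) : Prop where
  shaft_near : ∀ i < m, |Z i - z i| ≤ σ
  pole_near : ∀ i < m, |Y i - d i| ≤ ε / 16
  ladder : IsLadder m σ Y e
  roots : SecularRoots m α σ (fun j => Z j ^ 2) Y e lam

theorem exists_isPerturbation (hα : |α| ≤ 1) (hσ : 0 < σ) (hσ' : σ ≤ 1 / 128) (hmσ : m * σ ≤ 1)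
    (hz : ∑ j ∈ range m, z j ^ 2 ≤ 1) (hY : ∀ i < m, |Y i - d i| ≤ ε / 16)
    (hl : IsLadder m σ Y e) :
    ∃ lam, IsPerturbation m ε α σ z d (fun i => pushAway σ (z i)) Y e lam :=
  have ⟨lam, hlam⟩ := hl.exists_secularRoots (W := fun j => pushAway σ (z j) ^ 2) hα hσ hσ'
    (fun _ _ => sq_le_pushAway_sq hσ.le) (sum_pushAway_sq_le hσ.le hmσ (by linarith) hz)
  ⟨lam, fun _ _ => abs_pushAway_sub hσ.le, hY, hl, hlam⟩

namespace IsPerturbation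

theorem abs_shaft_le {i : ℕ} (h : IsPerturbation m ε α σ z d Z Y e lam) (hσ' : σ ≤ 1) (hi : i < m)
    (hz : |z i| ≤ 1) : |Z i| ≤ 2 := by
  linarith [abs_sub_abs_le_abs_sub (Z i) (z i), h.shaft_near i hi]

theorem norm_sub_le (h : IsPerturbation m ε α σ z d Z Y e lam) (hσ : 0 ≤ σ)
    (hmσ : (m + 1) * σ = ε / 64) :
    ‖arrowhead α (fun i : Fin m => z i) (fun i => d i) -
      arrowhead α (fun i : Fin m => Z i) (fun i => Y i)‖ ≤ ε / 8 := by
  have hε : 0 ≤ ε := by nlinarith [(Nat.cast_nonneg m : (0 : ℝ) ≤ m)]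
  rw [arrowhead_sub, sub_self]
  refine (norm_arrowhead_zero_le (a := ε / 64) (b := ε / 16) (by linarith) (by linarith) ?_
    fun i => ?_).trans (by linarith)
  · calc ∑ i : Fin m, ((fun i : Fin m => z i) - fun i : Fin m => Z i) i ^ 2
        ≤ ∑ _i : Fin m, σ ^ 2 := sum_le_sum fun i _ =>
          sq_le_sq.2 (by simpa [abs_sub_comm, abs_of_nonneg hσ] using h.shaft_near i i.2)
      _ = m * σ ^ 2 := by simp
      _ ≤ (ε / 64) ^ 2 := by rw [← hmσ]; nlinarith [sq_nonneg σ, sq_nonneg (m * σ)]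
  · rw [Pi.sub_apply, abs_sub_comm]
    exact h.pole_near i i.2

end IsPerturbation

/-! ## Error analysis -/

theorem abs_one_div_sub_le {b t y : ℝ} (hb : 0 < b) (hx : b ≤ |x|) (hy : b ≤ |y|)
    (h : |y - x| ≤ t) : |1 / y - 1 / x| ≤ t / b ^ 2 := by
  have hx' : x ≠ 0 := abs_pos.1 (hb.trans_le hx)
  have hy' : y ≠ 0 := abs_pos.1 (hb.trans_le hy)
  rw [div_sub_div _ _ hy' hx', one_mul, mul_one, abs_div, abs_mul, abs_sub_comm, sq]
  have ht : 0 ≤ t := (abs_nonneg _).trans h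
  gcongr

theorem abs_one_div_sq_sub_le {b t y : ℝ} (hb : 0 < b) (hx : b ≤ |x|) (hy : b ≤ |y|)
    (h : |y - x| ≤ t) : |1 / y ^ 2 - 1 / x ^ 2| ≤ 2 * t / b ^ 3 := by
  have hsum : |1 / y + 1 / x| ≤ 2 / b := by
    refine (abs_add_le _ _).trans ?_
    rw [abs_one_div, abs_one_div, show 2 / b = 1 / b + 1 / b by ring]
    gcongr
  have ht : 0 ≤ t := (abs_nonneg _).trans h
  calc |1 / y ^ 2 - 1 / x ^ 2| = |1 / y - 1 / x| * |1 / y + 1 / x| := by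
        rw [← abs_mul]
        congr 1
        ring
    _ ≤ t / b ^ 2 * (2 / b) := by
        gcongr
        exact abs_one_div_sub_le hb hx hy h
    _ = 2 * t / b ^ 3 := by field_simp

theorem abs_sum_mul_sub_sum_mul_le {c f g : ℕ → ℝ} {C t : ℝ} (hC : 0 ≤ C)
    (hc : ∀ j < m, |c j| ≤ C) (hfg : ∀ j < m, |f j - g j| ≤ t) :
    |∑ j ∈ range m, c j * f j - ∑ j ∈ range m, c j * g j| ≤ m * (C * t) := by
  rw [← sum_sub_distrib]
  refine (abs_sum_le_sum_abs _ _).trans ((sum_le_card_nsmul _ _ (C * t) fun j hj => ?_).trans_eq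
    (by rw [card_range, nsmul_eq_mul]))
  rw [mem_range] at hj
  rw [← mul_sub, abs_mul]
  exact mul_le_mul (hc j hj) (hfg j hj) (abs_nonneg _) hC

theorem abs_sqrt_sub_sqrt_le {G G' : ℝ} (hG : 1 ≤ G) (hG' : 0 ≤ G') : |√G - √G'| ≤ |G - G'| := by
  have h1 : 1 ≤ √G := Real.one_le_sqrt.2 hG
  have hfac : G - G' = (√G - √G') * (√G + √G') := by
    linear_combination -Real.sq_sqrt (zero_le_one.trans hG) + Real.sq_sqrt hG'
  rw [hfac, abs_mul]
  exact le_mul_of_one_le_right (abs_nonneg _)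
    (le_trans (by linarith [Real.sqrt_nonneg G']) (le_abs_self _))

theorem abs_div_sqrt_sub_le {a a' G G' t : ℝ} (hG : 0 ≤ G) (ht : t ≤ 1 / 2) (ha : |a' - a| ≤ t)
    (hGG : |G' - G| ≤ t) (h1 : |a / √(1 + G)| ≤ 1) :
    |a / √(1 + G) - a' / √(1 + G')| ≤ 4 * t := by
  have hG' := (abs_le.1 hGG).1
  have hhalf : 1 / 2 ≤ √(1 + G') := Real.le_sqrt_of_sq_le (by linarith)
  have hsqrt : |√(1 + G') - √(1 + G)| ≤ t := by
    rw [abs_sub_comm]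
    refine (abs_sqrt_sub_sqrt_le (by linarith) (by linarith)).trans ?_
    rwa [add_sub_add_left_eq_sub, abs_sub_comm]
  have hdiff : a / √(1 + G) - a' / √(1 + G') =
      (a / √(1 + G) * (√(1 + G') - √(1 + G)) - (a' - a)) / √(1 + G') := by
    have : √(1 + G') ≠ 0 := by linarith
    field_simp
    ring
  rw [hdiff, abs_div, abs_of_pos (show 0 < √(1 + G') by linarith), div_le_iff₀ (by linarith)]
  calc |a / √(1 + G) * (√(1 + G') - √(1 + G)) - (a' - a)|
      ≤ |a / √(1 + G) * (√(1 + G') - √(1 + G))| + |a' - a| := abs_sub _ _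
    _ ≤ 1 * t + t := by
        rw [abs_mul]
        gcongr
    _ ≤ 4 * t * √(1 + G') := by nlinarith [(abs_nonneg _).trans ha]

theorem pow_five_le_abs {y : ℝ} (hσ : 0 < σ) (hσ' : σ ≤ 1 / 128) (hx : σ ^ 4 ≤ |x|)
    (hxy : |y - x| ≤ 2 * σ ^ 32) : σ ^ 5 ≤ |y| := by
  have h5 : σ ^ 5 ≤ σ ^ 4 / 128 := by
    rw [pow_succ]
    nlinarith [pow_pos hσ 4]
  have h32 : σ ^ 32 ≤ σ ^ 5 := pow_le_pow_of_le_one hσ.le (by linarith) (by norm_num)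
  linarith [abs_sub_abs_le_abs_sub x y, abs_sub_comm x y, pow_pos hσ 4]

section

variable {y : ℝ} {c : ℕ → ℝ} (hσ : 0 < σ) (hσ' : σ ≤ 1 / 128) (hmσ : m * σ ≤ 1 / 64)
  (hxY : ∀ j < m, σ ^ 4 ≤ |x - Y j|) (hxy : |y - x| ≤ 2 * σ ^ 32)

include hσ hσ' hmσ hxY hxy

theorem abs_sum_one_div_sub_le (hc : ∀ j < m, |c j| ≤ 2) :
    |∑ j ∈ range m, c j * (1 / (y - Y j)) - ∑ j ∈ range m, c j * (1 / (x - Y j))| ≤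
      σ ^ 16 / 2 := by
  refine (abs_sum_mul_sub_sum_mul_le zero_le_two hc fun j hj => ?_).trans
    (b := m * (2 * (2 * σ ^ 32 / (σ ^ 5) ^ 2))) ?_
  · have hdist : |(y - Y j) - (x - Y j)| ≤ 2 * σ ^ 32 := by rwa [sub_sub_sub_cancel_right]
    have hfive := pow_five_le_abs hσ hσ' (hxY j hj) hdist
    exact abs_one_div_sub_le (pow_pos hσ 5)
      ((pow_le_pow_of_le_one hσ.le (by linarith) (by norm_num)).trans (hxY j hj)) hfive hdist
  · calc m * (2 * (2 * σ ^ 32 / (σ ^ 5) ^ 2)) = 4 * (m * σ) * σ ^ 21 := by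
          field_simp
          ring
      _ ≤ 4 * (1 / 64) * σ ^ 16 := by
          gcongr 4 * ?_ * ?_
          exact pow_le_pow_of_le_one hσ.le (by linarith) (by norm_num)
      _ ≤ σ ^ 16 / 2 := by linarith [pow_pos hσ 16]

theorem abs_sum_one_div_sq_sub_le (hc : ∀ j < m, |c j| ≤ 4) :
    |∑ j ∈ range m, c j * (1 / (y - Y j) ^ 2) - ∑ j ∈ range m, c j * (1 / (x - Y j) ^ 2)| ≤
      σ ^ 16 / 2 := by
  refine (abs_sum_mul_sub_sum_mul_le zero_le_four hc fun j hj => ?_).trans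
    (b := m * (4 * (2 * (2 * σ ^ 32) / (σ ^ 5) ^ 3))) ?_
  · have hdist : |(y - Y j) - (x - Y j)| ≤ 2 * σ ^ 32 := by rwa [sub_sub_sub_cancel_right]
    have hfive := pow_five_le_abs hσ hσ' (hxY j hj) hdist
    exact abs_one_div_sq_sub_le (pow_pos hσ 5)
      ((pow_le_pow_of_le_one hσ.le (by linarith) (by norm_num)).trans (hxY j hj)) hfive hdist
  · calc m * (4 * (2 * (2 * σ ^ 32) / (σ ^ 5) ^ 3)) = 16 * (m * σ) * σ ^ 16 := by
          field_simp
          ring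
      _ ≤ 16 * (1 / 64) * σ ^ 16 := by gcongr
      _ ≤ σ ^ 16 / 2 := by linarith [pow_pos hσ 16]

/-- The entries of the approximate eigenvector matrix are quotients of two Cauchy-like sums, which
are evaluated at an approximate eigenvalue `y` and with an accuracy of `σ ^ 32`. -/
theorem abs_entry_sub_le {a b g : ℝ} (hc : ∀ j < m, |c j| ≤ 2) (hZ : ∀ j < m, |Z j| ≤ 2)
    (ha : |a - ∑ j ∈ range m, c j * (1 / (y - Y j))| ≤ σ ^ 32)
    (hg : |g - ∑ j ∈ range m, Z j ^ 2 * (1 / (y - Y j) ^ 2)| ≤ σ ^ 32)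
    (h1 : |(b + ∑ j ∈ range m, c j * (1 / (x - Y j))) /
      √(1 + ∑ j ∈ range m, Z j ^ 2 * (1 / (x - Y j) ^ 2))| ≤ 1) :
    |(b + ∑ j ∈ range m, c j * (1 / (x - Y j))) /
      √(1 + ∑ j ∈ range m, Z j ^ 2 * (1 / (x - Y j) ^ 2)) - (b + a) / √(1 + g)| ≤
        4 * σ ^ 16 := by
  have hpow {k l : ℕ} (hkl : k ≤ l) : σ ^ l ≤ σ ^ k :=
    pow_le_pow_of_le_one hσ.le (by linarith) hkl
  have hnum := abs_sum_one_div_sub_le hσ hσ' hmσ hxY hxy hc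
  have hden := abs_sum_one_div_sq_sub_le hσ hσ' hmσ hxY hxy (c := fun j => Z j ^ 2)
    fun j hj => by rw [abs_pow]; nlinarith [hZ j hj, abs_nonneg (Z j)]
  have hsum : σ ^ 32 + σ ^ 16 / 2 ≤ σ ^ 16 := by
    have h17 := hpow (show 17 ≤ 32 by norm_num)
    rw [pow_succ σ 16] at h17
    nlinarith [pow_pos hσ 16]
  refine abs_div_sqrt_sub_le (sum_nonneg fun j _ => by positivity)
    ((hpow (show 1 ≤ 16 by norm_num)).trans (by rw [pow_one]; linarith)) ?_ ?_ h1
  · rw [add_sub_add_left_eq_sub]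
    exact (abs_sub_le _ _ _).trans ((add_le_add ha hnum).trans hsum)
  · exact (abs_sub_le _ _ _).trans ((add_le_add hg hden).trans hsum)

end

/-! ## Matrices in memory -/

theorem toArray_val {n : ℕ} (v : Fin n → ℝ) (i : Fin n) : toArray v i = v i := dif_pos i.2

theorem abs_toArray_le {n : ℕ} {v : Fin n → ℝ} {C : ℝ} (hC : 0 ≤ C) (h : ∀ i, |v i| ≤ C) (a : ℕ) :
    |toArray v a| ≤ C := by
  unfold toArray
  split_ifs with ha
  · exact h _
  · rwa [abs_zero]

/-- The content of the array that holds the matrix `B`, row by row. -/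
noncomputable def matrixArray {n r : ℕ} (B : Matrix (Fin n) (Fin r) ℝ) : ℕ → ℝ :=
  toArray fun a => B (finProdFinEquiv.symm a).1 (finProdFinEquiv.symm a).2

variable {r : ℕ}

theorem matrixArray_apply {n : ℕ} (B : Matrix (Fin n) (Fin r) ℝ) (i : Fin n) (c : Fin r) :
    matrixArray B (c + r * i) = B i c := by
  have h : (c : ℕ) + r * i = (finProdFinEquiv (i, c) : Fin (n * r)) := rfl
  rw [matrixArray, h, toArray_val, Equiv.symm_apply_apply]

theorem abs_matrixArray_le {n : ℕ} {B : Matrix (Fin n) (Fin r) ℝ}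
    (hB : ∀ j, ‖WithLp.toLp 2 (fun i => B i j)‖ ≤ 1) (a : ℕ) : |matrixArray B a| ≤ 1 :=
  abs_toArray_le zero_le_one (fun b => (PiLp.norm_apply_le
    (WithLp.toLp 2 fun i => B i (finProdFinEquiv.symm b).2) (finProdFinEquiv.symm b).1).trans
      (hB _)) a

theorem normalized_transpose_mul_apply (B : Matrix (Fin (m + 1)) (Fin r) ℝ) (Z Y lam : ℕ → ℝ)
    (k : Fin (m + 1)) (c : Fin r) :
    ((normalized fun k : Fin (m + 1) => arrowVec m Z Y (lam k))ᵀ * B) k c =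
      (matrixArray B c + ∑ j ∈ range m,
        Z j * matrixArray B (c + r * (j + 1)) * (1 / (lam k - Y j))) /
        √(1 + ∑ j ∈ range m, Z j ^ 2 * (1 / (lam k - Y j) ^ 2)) := by
  have hzero : matrixArray B c = B 0 c := by simpa using matrixArray_apply B 0 c
  have hsucc (j : Fin m) : matrixArray B (c + r * (j + 1)) = B j.succ c := by
    simpa using matrixArray_apply B j.succ c
  rw [mul_apply, ← arrowVec_dotProduct_self]
  simp only [normalized, transpose_apply, of_apply, div_mul_eq_mul_div, ← sum_div,
    Fin.sum_univ_succ, sum_range, hzero, hsucc]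
  simp only [arrowVec, Fin.cons_zero, Fin.cons_succ, one_mul, div_mul_eq_mul_div, mul_one_div]

/-! ## Error bounds -/

namespace IsPerturbation

variable {mu : ℕ → ℝ}

theorem abs_eigenvalue_sub_le {ev : Fin (m + 1) → ℝ} {U : Matrix (Fin (m + 1)) (Fin (m + 1)) ℝ}
    (h : IsPerturbation m ε α σ z d Z Y e lam) (hσ : 0 < σ) (hσ' : σ ≤ 1)
    (hmσ : (m + 1) * σ = ε / 64)
    (hU : Diagonalizes (arrowhead α (fun i : Fin m => z i) fun i => d i) U ev)
    (hev : Monotone ev) (hmu : ∀ k ≤ m, |mu k - lam k| ≤ ε / 8 + σ ^ 32) (i : Fin (m + 1)) :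
    |ev i - mu i| ≤ ε := by
  have hm : 0 ≤ m * σ := by positivity
  have hpow : σ ^ 32 ≤ σ := pow_le_of_le_one hσ.le hσ' (by norm_num)
  have hweyl := hU.abs_sub_le_norm_sub (h.roots.diagonalizes h.ladder hσ) hev
    (h.roots.strictMono hσ).monotone i
  have happrox := hmu i (Nat.lt_succ_iff.1 i.2)
  rw [abs_sub_comm] at happrox
  refine (abs_sub_le _ _ _).trans
    ((add_le_add (hweyl.trans (h.norm_sub_le hσ.le hmσ)) happrox).trans ?_)
  linarith

theorem norm_sub_normalized_le (h : IsPerturbation m ε α σ z d Z Y e lam) (hσ : 0 < σ)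
    (hσ' : σ ≤ 1) (hmσ : (m + 1) * σ = ε / 64) (hmu : ∀ k ≤ m, |mu k - lam k| ≤ 2 * σ ^ 32) :
    ‖arrowhead α (fun i : Fin m => z i) (fun i => d i) -
      normalized (fun k : Fin (m + 1) => arrowVec m Z Y (lam k)) *
        diagonal (fun k : Fin (m + 1) => mu k) *
        (normalized fun k : Fin (m + 1) => arrowVec m Z Y (lam k))ᵀ‖ ≤ ε := by
  have hpow : σ ^ 32 ≤ σ := pow_le_of_le_one hσ.le hσ' (by norm_num)
  have hm : 0 ≤ m * σ := by positivity
  have happrox := (h.roots.diagonalizes h.ladder hσ).norm_sub_le (mu := fun k : Fin (m + 1) => mu k)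
    (c := 2 * σ ^ 32) (by positivity) fun k =>
      (abs_sub_comm _ _).trans_le (hmu k (Nat.lt_succ_iff.1 k.2))
  refine (norm_sub_le_norm_sub_add_norm_sub _ _ _).trans
    ((add_le_add (h.norm_sub_le hσ.le hmσ) happrox).trans ?_)
  linarith

theorem abs_normalized_transpose_mul_sub_le (h : IsPerturbation m ε α σ z d Z Y e lam)
    (hσ : 0 < σ) (hσ' : σ ≤ 1 / 128) (hε : ε ≤ 1)
    (hmσ : (m + 1) * σ = ε / 64) (hZ : ∀ j < m, |Z j| ≤ 2)
    {B : Matrix (Fin (m + 1)) (Fin r) ℝ} (hB : ∀ j, ‖WithLp.toLp 2 (fun i => B i j)‖ ≤ 1)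
    {k : Fin (m + 1)} {c : Fin r} {y a g : ℝ} (hy : |y - lam k| ≤ 2 * σ ^ 32)
    (ha : |a - ∑ j ∈ range m, Z j * matrixArray B (c + r * (j + 1)) * (1 / (y - Y j))| ≤ σ ^ 32)
    (hg : |g - ∑ j ∈ range m, Z j ^ 2 * (1 / (y - Y j) ^ 2)| ≤ σ ^ 32) :
    |((normalized fun k : Fin (m + 1) => arrowVec m Z Y (lam k))ᵀ * B) k c -
      (matrixArray B c + a) / √(1 + g)| ≤ ε / (m + 1) ^ 2 := by
  have hm : 0 ≤ m * σ := by positivity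
  have hexact := (abs_transpose_mul_apply_le (h.roots.diagonalizes h.ladder hσ).orth B k c).trans
    (hB c)
  rw [normalized_transpose_mul_apply] at hexact ⊢
  refine (abs_entry_sub_le hσ hσ' (by linarith) (fun j hj =>
    h.roots.pow_four_le_abs_sub h.ladder (Nat.lt_succ_iff.1 k.2) hj) hy (fun j hj => ?_) hZ ha hg
    hexact).trans ?_
  · rw [abs_mul]
    exact (mul_le_of_le_one_right (abs_nonneg _) (abs_matrixArray_le hB _)).trans (hZ j hj)
  · rw [le_div_iff₀ (by positivity)]
    calc 4 * σ ^ 16 * (m + 1) ^ 2 = 4 * ((m + 1) * σ) ^ 2 * σ ^ 14 := by ring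
      _ ≤ 4 * (ε / 64) ^ 2 * 1 := by
          rw [hmσ]
          gcongr
          exact pow_le_one₀ hσ.le (by linarith)
      _ ≤ ε := by nlinarith

end IsPerturbation

end Eigen

/-! ## A program logic with costs -/

/-- A memory unit of the machine: an integer register, an integer array, a real register or a real
array. -/
inductive Loc where
  | ireg (p : ℕ)
  | iarr (A : ℕ)
  | rreg (u : ℕ)
  | rarr (A : ℕ)
  deriving DecidableEq

/-- The memory unit that an instruction writes. -/
def Instr.target : Instr → Loc
  | .iconst p _ | .iadd p _ _ | .isub p _ _ | .iload p _ _ => .ireg p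
  | .istore A _ _ => .iarr A
  | .rcast u _ | .rop u _ _ _ | .rsqrt u _ | .rload u _ _ => .rreg u
  | .rstore A _ _ | .fmm _ _ _ _ _ _ _ _ A => .rarr A

/-- The memory units that a program may write. -/
def Prog.targets : Prog → List Loc
  | .instr i => [i.target]
  | .seq P Q | .ite _ P Q => P.targets ++ Q.targets
  | .loop _ P => P.targets

/-- Two memories agree on all memory units that the program `P` does not write. -/
structure Frame (P : Prog) (s s' : State) : Prop where
  iv : ∀ p, Loc.ireg p ∉ P.targets → s'.iv p = s.iv p
  im : ∀ A, Loc.iarr A ∉ P.targets → s'.im A = s.im A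
  rv : ∀ u, Loc.rreg u ∉ P.targets → s'.rv u = s.rv u
  rm : ∀ A, Loc.rarr A ∉ P.targets → s'.rm A = s.rm A

/-- Total correctness with costs: started in `s`, the program `P` terminates, and `Q` holds for the
final memory and the number of steps. -/
def Prog.WP (F : BlackBox) (P : Prog) (Q : State → ℕ → Prop) (s : State) : Prop :=
  ∃ s' t, Exec F P s s' t ∧ Q s' t

section

variable {F : BlackBox} {P P' : Prog} {T : Test} {s s₁ s₂ s₃ : State} {Q Q' : State → ℕ → Prop}

theorem Frame.refl (P : Prog) (s : State) : Frame P s s :=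
  ⟨fun _ _ => rfl, fun _ _ => rfl, fun _ _ => rfl, fun _ _ => rfl⟩

theorem Frame.trans (h : Frame P s₁ s₂) (h' : Frame P s₂ s₃) : Frame P s₁ s₃ :=
  ⟨fun a ha => (h'.iv a ha).trans (h.iv a ha), fun a ha => (h'.im a ha).trans (h.im a ha),
    fun a ha => (h'.rv a ha).trans (h.rv a ha), fun a ha => (h'.rm a ha).trans (h.rm a ha)⟩

theorem Frame.mono (h : Frame P s₁ s₂) (hP : P.targets ⊆ P'.targets) : Frame P' s₁ s₂ :=
  ⟨fun a ha => h.iv a (mt (@hP _) ha), fun a ha => h.im a (mt (@hP _) ha),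
    fun a ha => h.rv a (mt (@hP _) ha), fun a ha => h.rm a (mt (@hP _) ha)⟩

theorem Frame.of_loop (h : Frame (.loop T P) s₁ s₂) : Frame P s₁ s₂ := h.mono (List.Subset.refl _)

theorem Instr.frame_run (F : BlackBox) (i : Instr) (s : State) :
    Frame (.instr i) s (i.run F s) := by
  constructor <;> intro a ha <;> cases i <;>
    simp_all [Prog.targets, Instr.target, Instr.run]

theorem Exec.frame {t : ℕ} (h : Exec F P s s₁ t) : Frame P s s₁ := by
  induction h with
  | instr _ => exact Instr.frame_run F _ _
  | seq _ _ h₁ h₂ =>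
    exact (h₁.mono (List.subset_append_left _ _)).trans (h₂.mono (List.subset_append_right _ _))
  | ite_true _ _ h => exact h.mono (List.subset_append_left _ _)
  | ite_false _ _ h => exact h.mono (List.subset_append_right _ _)
  | loop_done _ => exact .refl _ _
  | loop_step _ _ _ h₁ h₂ => exact .trans (P := .loop _ _) (h₁.mono (List.Subset.refl _)) h₂

namespace Prog

theorem WP.mono (h : P.WP F Q s) (hQ : ∀ s' t, Frame P s s' → Q s' t → Q' s' t) :
    P.WP F Q' s :=
  let ⟨s', t, he, hs⟩ := h
  ⟨s', t, he, hQ s' t he.frame hs⟩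

theorem wp_instr {i : Instr} :
    (Prog.instr i).WP F Q s ↔ i.Defined s ∧ Q (i.run F s) (i.cost F s) :=
  ⟨fun ⟨_, _, .instr hd, hQ⟩ => ⟨hd, hQ⟩, fun ⟨hd, hQ⟩ => ⟨_, _, .instr hd, hQ⟩⟩

theorem wp_seq :
    (Prog.seq P P').WP F Q s ↔ P.WP F (fun s₁ t => P'.WP F (fun s₂ u => Q s₂ (t + u)) s₁) s :=
  ⟨fun ⟨_, _, .seq hP hP', hQ⟩ => ⟨_, _, hP, _, _, hP', hQ⟩,
    fun ⟨_, _, hP, _, _, hP', hQ⟩ => ⟨_, _, .seq hP hP', hQ⟩⟩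

theorem WP.seq {R : State → ℕ → Prop} (h : P.WP F Q s)
    (h' : ∀ s' t, Frame P s s' → Q s' t → P'.WP F (fun s'' u => R s'' (t + u)) s') :
    (Prog.seq P P').WP F R s :=
  wp_seq.2 (h.mono h')

theorem wp_ite : (Prog.ite T P P').WP F Q s ↔
    (T.Holds s → P.WP F (fun s₁ t => Q s₁ (t + 1)) s) ∧
      (¬ T.Holds s → P'.WP F (fun s₁ t => Q s₁ (t + 1)) s) := by
  constructor
  · rintro ⟨_, _, h | h | ⟨hT, hP⟩ | ⟨hT, hP⟩, hQ⟩
    exacts [⟨fun _ => ⟨_, _, hP, hQ⟩, fun h => absurd hT h⟩,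
      ⟨fun h => absurd h hT, fun _ => ⟨_, _, hP, hQ⟩⟩]
  · rintro ⟨h, h'⟩
    by_cases hT : T.Holds s
    · obtain ⟨_, _, hP, hQ⟩ := h hT
      exact ⟨_, _, .ite_true hT hP, hQ⟩
    · obtain ⟨_, _, hP, hQ⟩ := h' hT
      exact ⟨_, _, .ite_false hT hP, hQ⟩

theorem WP.loop (I : ℕ → State → Prop) (N c : ℕ) (h0 : I 0 s)
    (hN : ∀ s', Frame P s s' → I N s' → ¬ T.Holds s')
    (hP : ∀ k < N, ∀ s', Frame P s s' → I k s' → T.Holds s' →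
      P.WP F (fun s₁ t => t ≤ c ∧ I (k + 1) s₁) s') :
    (Prog.loop T P).WP F
      (fun s' t => t ≤ N * (c + 1) + 1 ∧ ∃ k ≤ N, I k s' ∧ ¬ T.Holds s') s := by
  suffices H : ∀ j k s', k + j = N → Frame P s s' → I k s' → (Prog.loop T P).WP F
      (fun s' t => t ≤ j * (c + 1) + 1 ∧ ∃ k ≤ N, I k s' ∧ ¬ T.Holds s') s' from
    H N 0 s (zero_add N) (.refl _ _) h0
  have done {j k s'} (hk : k ≤ N) (hI : I k s') (hT : ¬ T.Holds s') : (Prog.loop T P).WP F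
      (fun s' t => t ≤ j * (c + 1) + 1 ∧ ∃ k ≤ N, I k s' ∧ ¬ T.Holds s') s' :=
    ⟨s', 1, .loop_done hT, Nat.le_add_left _ _, k, hk, hI, hT⟩
  intro j
  induction j with
  | zero =>
    rintro k s' rfl hf hI
    exact done le_rfl hI (hN s' hf hI)
  | succ j ih =>
    intro k s' hk hf hI
    by_cases hT : T.Holds s'
    · obtain ⟨s₁, t, he, ht, hs⟩ := hP k (by omega) s' hf hI hT
      obtain ⟨s₂, u, he', hu, hs'⟩ := ih (k + 1) s₁ (by omega) (hf.trans he.frame) hs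
      exact ⟨s₂, _, .loop_step hT he he', by rw [add_one_mul]; omega, hs'⟩
    · exact done (by omega) hI hT

theorem WP.count {p b : ℕ} (I : ℕ → State → Prop) (N c : ℕ) (hp : s.iv p = 0) (hb : s.iv b = N)
    (hbP : Loc.ireg b ∉ P.targets) (h0 : I 0 s)
    (hP : ∀ k < N, ∀ s', Frame P s s' → s'.iv p = k → I k s' →
      P.WP F (fun s₁ t => t ≤ c ∧ s₁.iv p = k + 1 ∧ I (k + 1) s₁) s') :
    (Prog.loop (.ilt p b) P).WP F (fun s' t => t ≤ N * (c + 1) + 1 ∧ I N s') s := by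
  have hb' : ∀ s', Frame P s s' → s'.iv b = N := fun s' hf => (hf.iv b hbP).trans hb
  refine (WP.loop (fun k s' => s'.iv p = k ∧ I k s') N c ⟨hp, h0⟩ ?_ ?_).mono ?_
  · intro s' hf hI
    simp [Test.Holds, hI.1, hb' s' hf]
  · intro k hk s' hf hI _
    exact hP k hk s' hf hI.1 hI.2
  · rintro s' t hf ⟨ht, k, hk, ⟨hp', hI⟩, hT⟩
    simp only [Test.Holds, hp', hb' s' hf.of_loop, not_lt] at hT
    exact ⟨ht, hk.antisymm hT ▸ hI⟩

end Prog

end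

/-! ## The program -/

/- The names `i…` are integer registers, `r…` real registers, `a…` real arrays, and `aCount` is an
integer array. The numbers of `iSize`, `iCols`, `rEps`, `rCorner`, `aShaft`, `aDiag`, `aCols` are
prescribed by the input, those of `aLo` and `aOut` by the output. -/
namespace Reg

abbrev iSize : ℕ := 0
abbrev iCols : ℕ := 1
abbrev iOne : ℕ := 2
abbrev iShaft : ℕ := 3
abbrev iDepth : ℕ := 4
abbrev iPos : ℕ := 5
abbrev iOuter : ℕ := 6
abbrev iNode : ℕ := 7
abbrev iCount : ℕ := 8
abbrev iRank : ℕ := 9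
abbrev iLit : ℕ := 10
abbrev iAddr : ℕ := 11

abbrev aCount : ℕ := 0

abbrev rEps : ℕ := 0
abbrev rCorner : ℕ := 1
abbrev rSep : ℕ := 2
abbrev rAcc : ℕ := 3
abbrev rBound : ℕ := 4
abbrev rWidth : ℕ := 5
abbrev rCell : ℕ := 6
abbrev rGoal : ℕ := 7
abbrev rZero : ℕ := 8
abbrev rTwo : ℕ := 9
abbrev rFour : ℕ := 10
abbrev rSix : ℕ := 11
abbrev rEight : ℕ := 12
abbrev rSixteen : ℕ := 13
abbrev rX : ℕ := 14
abbrev rY : ℕ := 15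
abbrev rV : ℕ := 16
abbrev rLen : ℕ := 17

abbrev aShaft : ℕ := 0
abbrev aDiag : ℕ := 1
abbrev aCols : ℕ := 2
abbrev aLo : ℕ := 3
abbrev aOut : ℕ := 4
abbrev aHi : ℕ := 5
abbrev aPole : ℕ := 6
abbrev aWeight : ℕ := 7
abbrev aPushed : ℕ := 8
abbrev aPoint : ℕ := 9
abbrev aAnswer : ℕ := 10
abbrev aNorm : ℕ := 11
abbrev aColWeight : ℕ := 12

end Reg

open Reg

notation:60 P:61 " ;; " Q:60 => Prog.seq P Q

/-- The sequence of the instructions `l`. As the machine has no empty program, the empty sequence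
writes the register for literals, which is never read before it is written again. -/
def block : List Instr → Prog
  | [] => .instr (.iconst iLit 0)
  | [i] => .instr i
  | i :: j :: l => .instr i ;; block (j :: l)

/-- Real register `u := k`. -/
def literal (u k : ℕ) : Prog :=
  block [.iconst iLit k, .rcast u iLit]

/-- The computation of the constants of `Consts` for the depth `0`, and of the width `ε / 16`, which
the cells may not exceed in the end. -/
def constProg : Prog :=
  literal rZero 0 ;; literal rTwo 2 ;; literal rFour 4 ;; literal rSix 6 ;; literal rEight 8 ;;
  literal rSixteen 16 ;; literal rBound 32 ;; literal rCell 4 ;; literal rX 64 ;;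
  block [.iconst iOne 1, .isub iShaft iSize iOne, .iconst iDepth 0,
    .rcast rY iSize, .rop rX .mul rX rY, .rop rSep .div rEps rX,
    .rop rAcc .mul rSep rSep, .rop rAcc .mul rAcc rAcc, .rop rAcc .mul rAcc rAcc,
    .rop rAcc .mul rAcc rAcc, .rop rAcc .mul rAcc rAcc,
    .rop rWidth .div rEps rEight, .rop rGoal .div rEps rSixteen]

/-- The choice of the depth of the counting tree. -/
def depthProg : Prog :=
  .loop (.rlt rGoal rCell) (block [.rop rCell .div rCell rTwo, .iadd iDepth iDepth iOne])

/-- The step of an insertion from a node of the counting tree to a child. -/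
def insertLevelProg : Prog :=
  block [.rop rX .mul rX rTwo, .iadd iNode iNode iNode, .iadd iCount iNode iOne,
    .rcast rY iCount] ;;
  .ite (.rlt rX rY) (block []) (block [.iadd iNode iNode iOne]) ;;
  block [.iload iCount aCount iNode, .iadd iCount iCount iOne, .istore aCount iNode iCount,
    .iadd iOuter iOuter iOne]

/-- The insertion of one diagonal entry, normalized to `[1, 2)`, into the counting tree. -/
def insertPointProg : Prog :=
  block [.rload rX aDiag iPos, .rop rX .add rX rSix, .rop rX .div rX rFour, .iconst iNode 1,
    .iconst iOuter 0] ;;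
  .loop (.ilt iOuter iDepth) insertLevelProg

/-- Real register `rV :=` the perturbed pole number `k` of the cell in `iNode`, where `k` is in the
integer register `p`. -/
def poleProg (p : ℕ) : Prog :=
  block [.rcast rY p, .rop rY .mul rY rSep, .rcast rV iNode, .rop rV .mul rV rCell,
    .rop rV .sub rV rSix, .rop rV .add rV rY]

/-- The perturbation of one shaft entry, and the weight of the pole. -/
def pushProg : Prog :=
  block [.rload rX aShaft iPos] ;;
  .ite (.rlt rX rZero) (block [.rop rX .sub rX rSep]) (block [.rop rX .add rX rSep]) ;;
  block [.rstore aPushed iPos rX, .rop rX .mul rX rX, .rstore aWeight iPos rX]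

/-- The perturbation of one diagonal entry and of the corresponding shaft entry. -/
def insertStepProg : Prog :=
  insertPointProg ;; block [.iload iCount aCount iNode] ;; poleProg iCount ;;
  block [.rstore aPole iPos rV] ;; pushProg ;; block [.iadd iPos iPos iOne]

/-- The perturbation of all diagonal entries and of the shaft. -/
def insertProg : Prog :=
  block [.iconst iPos 0] ;; .loop (.ilt iPos iShaft) insertStepProg

/-- The step of a search from a node of the counting tree to a child. -/
def searchLevelProg : Prog :=
  block [.iadd iNode iNode iNode, .iload iCount aCount iNode] ;;
  .ite (.ilt iRank iCount) (block [])
    (block [.isub iRank iRank iCount, .iadd iNode iNode iOne]) ;;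
  block [.iadd iOuter iOuter iOne]

/-- The search for the cell of the pole of rank `iPos`. -/
def searchPointProg : Prog :=
  block [.iconst iLit 0, .iadd iRank iPos iLit, .iconst iNode 1, .iconst iOuter 0] ;;
  .loop (.ilt iOuter iDepth) searchLevelProg

/-- The pole of rank `iPos` becomes the right end of one initial interval of the bisection and the
left end of the next one. -/
def searchStepProg : Prog :=
  searchPointProg ;; block [.iadd iRank iRank iOne] ;; poleProg iRank ;;
  block [.rstore aHi iPos rV, .iadd iPos iPos iOne, .rstore aLo iPos rV]

/-- The initial intervals of the bisection, and an additional source of weight zero: there must be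
as many sources as evaluation points. -/
def searchProg : Prog :=
  block [.iconst iPos 0, .rop rV .sub rZero rEight, .rstore aLo iPos rV] ;;
  .loop (.ilt iPos iShaft) searchStepProg ;;
  block [.rstore aHi iShaft rEight, .rop rV .sub rZero rSixteen, .rstore aPole iShaft rV,
    .rstore aWeight iShaft rZero]

/-- The AFMM call with kernel `κ` at the points in `X`, for the weights in `W`. -/
def fmmProg (κ : Kernel) (X W : ℕ) : Prog :=
  .instr (.fmm κ rAcc rBound iSize iSize X W aPole aAnswer)

/-- The midpoint of one interval. -/
def midpointProg : Prog :=
  block [.rload rX aLo iPos, .rload rY aHi iPos, .rop rX .add rX rY, .rop rX .div rX rTwo,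
    .rstore aPoint iPos rX, .iadd iPos iPos iOne]

/-- The choice of a half of one interval, by the sign of the secular function. -/
def halveProg : Prog :=
  block [.rload rX aPoint iPos, .rop rY .sub rCorner rX, .rload rV aAnswer iPos,
    .rop rY .add rY rV] ;;
  .ite (.rlt rZero rY) (block [.rstore aLo iPos rX]) (block [.rstore aHi iPos rX]) ;;
  block [.iadd iPos iPos iOne]

/-- One round of the simultaneous bisection. -/
def bisectStepProg : Prog :=
  block [.rop rLen .div rLen rTwo, .iconst iPos 0] ;; .loop (.ilt iPos iSize) midpointProg ;;
  fmmProg .inv aPoint aWeight ;; block [.iconst iPos 0] ;; .loop (.ilt iPos iSize) halveProg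

/-- The simultaneous bisection, down to the width in the real register `u`. -/
def bisectProg (u : ℕ) : Prog :=
  block [.rop rLen .add rSixteen rZero] ;; .loop (.rlt u rLen) bisectStepProg

/-- The constants of the program. -/
def setupProg : Prog :=
  constProg ;; depthProg

/-- The perturbation of the matrix, and the initial intervals of the bisection. -/
def perturbProg : Prog :=
  insertProg ;; searchProg

/-- The program for the eigenvalues; the real register `u` contains the final width of the
bisection. -/
def eigProg (u : ℕ) : Prog :=
  setupProg ;; perturbProg ;; bisectProg u

/-- The norm of one eigenvector. -/
def normStepProg : Prog :=
  block [.rload rX aAnswer iPos, .rop rX .add rX rY, .rsqrt rX rX, .rstore aNorm iPos rX,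
    .iadd iPos iPos iOne]

/-- The norms of the eigenvectors. -/
def normProg : Prog :=
  fmmProg .invSq aLo aWeight ;; block [.iconst iPos 0, .rcast rY iOne] ;;
  .loop (.ilt iPos iSize) normStepProg

/-- One weight for a column of `B`. -/
def weightStepProg : Prog :=
  block [.rload rX aPushed iPos, .rload rY aCols iAddr, .rop rX .mul rX rY,
    .rstore aColWeight iPos rX, .iadd iAddr iAddr iCols, .iadd iPos iPos iOne]

/-- The weights for the column `iOuter` of `B`; its first entry goes to `rV`. -/
def weightsProg : Prog :=
  block [.rload rV aCols iOuter, .iadd iAddr iOuter iCols, .iconst iPos 0] ;;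
  .loop (.ilt iPos iShaft) weightStepProg ;; block [.rstore aColWeight iShaft rZero]

/-- One entry of a column of the output. -/
def entryStepProg : Prog :=
  block [.rload rX aAnswer iPos, .rop rX .add rX rV, .rload rY aNorm iPos, .rop rX .div rX rY,
    .rstore aOut iAddr rX, .iadd iAddr iAddr iCols, .iadd iPos iPos iOne]

/-- The entries of the column `iOuter` of the output. -/
def entriesProg : Prog :=
  block [.iconst iPos 0, .iadd iAddr iOuter iPos] ;; .loop (.ilt iPos iSize) entryStepProg

/-- One column of the output. -/
def columnStepProg : Prog :=
  weightsProg ;; fmmProg .inv aLo aColWeight ;; entriesProg ;; block [.iadd iOuter iOuter iOne]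

/-- The columns of the output. -/
def columnsProg : Prog :=
  block [.iconst iOuter 0] ;; .loop (.ilt iOuter iCols) columnStepProg

/-- The program for the diagonalization. -/
def diagProg : Prog :=
  eigProg rAcc ;; normProg ;; columnsProg

/-- The constants of the program for a matrix of size `m + 1` and the accuracy `ε`: the depth `L` of
the counting tree, whose cells have width `4 / 2 ^ L`, the separation `σ`, the accuracy `σ ^ 32` of
the AFMM calls, and some literals. -/
structure Consts (m r L : ℕ) (ε α σ : ℝ) (s : State) : Prop where
  size : s.iv iSize = m + 1
  cols : s.iv iCols = r
  one : s.iv iOne = 1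
  shaft : s.iv iShaft = m
  depth : s.iv iDepth = L
  corner : s.rv rCorner = α
  sep : s.rv rSep = σ
  acc : s.rv rAcc = σ ^ 32
  bound : s.rv rBound = 32
  width : s.rv rWidth = ε / 8
  cell : s.rv rCell = 4 / 2 ^ L
  zero : s.rv rZero = 0
  two : s.rv rTwo = 2
  four : s.rv rFour = 4
  six : s.rv rSix = 6
  eight : s.rv rEight = 8
  sixteen : s.rv rSixteen = 16

/-- The registers of the constants other than the depth and the width of the cells. -/
def constLocs : List Loc :=
  [iSize, iCols, iOne, iShaft].map .ireg ++
    [rCorner, rSep, rAcc, rBound, rWidth, rZero, rTwo, rFour, rSix, rEight, rSixteen].map .rreg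

theorem Consts.of_frame {m r L L' : ℕ} {ε α σ : ℝ} {P : Prog} {s s' : State}
    (hs : Consts m r L ε α σ s) (hf : Frame P s s') (hdepth : s'.iv iDepth = L')
    (hcell : s'.rv rCell = 4 / 2 ^ L') (hP : ∀ x ∈ constLocs, x ∉ P.targets := by decide) :
    Consts m r L' ε α σ s' where
  size := (hf.iv _ (hP _ (by decide))).trans hs.size
  cols := (hf.iv _ (hP _ (by decide))).trans hs.cols
  one := (hf.iv _ (hP _ (by decide))).trans hs.one
  shaft := (hf.iv _ (hP _ (by decide))).trans hs.shaft
  depth := hdepth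
  corner := (hf.rv _ (hP _ (by decide))).trans hs.corner
  sep := (hf.rv _ (hP _ (by decide))).trans hs.sep
  acc := (hf.rv _ (hP _ (by decide))).trans hs.acc
  bound := (hf.rv _ (hP _ (by decide))).trans hs.bound
  width := (hf.rv _ (hP _ (by decide))).trans hs.width
  cell := hcell
  zero := (hf.rv _ (hP _ (by decide))).trans hs.zero
  two := (hf.rv _ (hP _ (by decide))).trans hs.two
  four := (hf.rv _ (hP _ (by decide))).trans hs.four
  six := (hf.rv _ (hP _ (by decide))).trans hs.six
  eight := (hf.rv _ (hP _ (by decide))).trans hs.eight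
  sixteen := (hf.rv _ (hP _ (by decide))).trans hs.sixteen

theorem Consts.frame {m r L : ℕ} {ε α σ : ℝ} {P : Prog} {s s' : State}
    (hs : Consts m r L ε α σ s) (hf : Frame P s s')
    (hP : ∀ x ∈ .ireg iDepth :: .rreg rCell :: constLocs, x ∉ P.targets := by decide) :
    Consts m r L ε α σ s' :=
  hs.of_frame hf ((hf.iv _ (hP _ (by decide))).trans hs.depth)
    ((hf.rv _ (hP _ (by decide))).trans hs.cell) fun x hx => hP x (by simp [hx])

section Execution

attribute [local simp] Prog.wp_instr Prog.wp_seq Prog.wp_ite block literal Instr.Defined Instr.cost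
  Instr.run ROp.fn Test.Holds

variable {F : BlackBox} {m r L i k : ℕ} {ε α σ y : ℝ} {s : State}

/-! ## Specification: constants and perturbation -/

theorem constProg_spec (hsize : s.iv iSize = m + 1) (hcols : s.iv iCols = r)
    (heps : s.rv rEps = ε) (hcorner : s.rv rCorner = α) :
    constProg.WP F (fun s' t => t = 31 ∧ Consts m r 0 ε α (ε / (64 * (m + 1))) s' ∧
      s'.rv rGoal = ε / 16) s := by
  have hm : (64 : ℝ) * (m + 1) ≠ 0 := by positivity
  simp only [constProg, literal, block, ↓Prog.wp_seq, ↓Prog.wp_instr]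
  simp [hsize, heps, hm]
  constructor <;> simp [hsize, hcols, hcorner]
  ring

theorem depthProg_spec {N : ℕ} (hs : Consts m r 0 ε α σ s) (hgoal : s.rv rGoal = ε / 16)
    (hε : ε ≤ 1) (hN : 4 / 2 ^ N ≤ ε / 16) :
    depthProg.WP F (fun s' t => t ≤ N * 3 + 1 ∧ ∃ L ≤ N,
      Consts m r L ε α σ s' ∧ 4 / 2 ^ L ≤ ε / 16 ∧ ε / 32 < 4 / 2 ^ L) s := by
  refine (Prog.WP.loop (fun l s' => s'.iv iDepth = l ∧ s'.rv rCell = 4 / 2 ^ l ∧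
    ε / 32 < 4 / 2 ^ l) N 2 ⟨hs.depth, hs.cell, by norm_num; linarith⟩ ?_ ?_).mono ?_
  · rintro s' hf ⟨-, hcell, -⟩
    simpa [hcell, hf.rv rGoal (by decide), hgoal] using hN
  · rintro l - s' hf ⟨hdepth, hcell, -⟩ hT
    simp only [Test.Holds, hcell, hf.rv rGoal (by decide), hgoal] at hT
    have hhalf : (4 : ℝ) / 2 ^ (l + 1) = 4 / 2 ^ l / 2 := by rw [pow_succ, div_div]
    simp [hf.rv rTwo (by decide), hs.two, hf.iv iOne (by decide), hs.one, hdepth, hcell, hhalf]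
    linarith
  · rintro s' t hf ⟨ht, L, hL, ⟨hdepth, hcell, hlt⟩, hT⟩
    simp only [Test.Holds, hcell, hf.rv rGoal (by decide), hgoal, not_lt] at hT
    exact ⟨ht, L, hL, hs.of_frame hf hdepth hcell, hT, hlt⟩

theorem insertLevelProg_spec (hs : Consts m r L ε α σ s) :
    insertLevelProg.WP F (fun s' t => t ≤ 10 ∧
      s'.iv iOuter = s.iv iOuter + 1 ∧ s'.rv rX = s.rv rX * 2 ∧
      s'.iv iNode = (if s.rv rX * 2 < (2 * s.iv iNode + 1 : ℕ) then 2 * s.iv iNode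
        else 2 * s.iv iNode + 1) ∧
      s'.im aCount = Function.update (s.im aCount) (s'.iv iNode) (s.im aCount (s'.iv iNode) + 1))
      s := by
  simp +contextual [insertLevelProg, two_mul, hs.two, hs.one]

theorem insertPointProg_spec (hs : Consts m r L ε α σ s) (hy : s.rm aDiag (s.iv iPos) = 4 * y - 6)
    (hy' : y ∈ Set.Ico (1 : ℝ) 2) :
    insertPointProg.WP F (fun s' t => t ≤ L * 11 + 6 ∧ s'.iv iNode = node y L ∧
      ∀ v, s'.im aCount v = s.im aCount v + Nat.count (fun l => node y (l + 1) = v) L) s := by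
  refine Prog.WP.seq (Q := fun s' t => t = 5 ∧ s'.rv rX = y ∧ s'.iv iNode = 1 ∧ s'.iv iOuter = 0)
    ?_ ?_
  · simp [hs.six, hs.four, hy]
  rintro s₁ _ hf₁ ⟨rfl, hX, hnode, houter⟩
  have hs₁ := hs.frame hf₁
  refine (Prog.WP.count (fun l s' => s'.iv iNode = node y l ∧ s'.rv rX = y * 2 ^ l ∧
    ∀ v, s'.im aCount v = s.im aCount v + Nat.count (fun l => node y (l + 1) = v) l)
    L 10 houter hs₁.depth (by decide) ?_ ?_).mono ?_
  · simp [hnode, node_zero hy', hX, hf₁.im aCount (by decide)]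
  · rintro l - s₂ hf₂ houter₂ ⟨hnode₂, hX₂, hcount₂⟩
    refine (insertLevelProg_spec (hs₁.frame hf₂)).mono ?_
    rintro s₃ t - ⟨ht, houter₃, hX₃, hnode₃, hcount₃⟩
    have hnode₃ : s₃.iv iNode = node y (l + 1) := by
      rw [hnode₃, node_succ (by linarith [hy'.1]), hX₂, hnode₂]
    refine ⟨ht, by rw [houter₃, houter₂], hnode₃, by rw [hX₃, hX₂, pow_succ, mul_assoc], ?_⟩
    intro v
    rw [hcount₃, hnode₃, Nat.count_succ, Function.update_apply]
    grind
  · rintro s₂ t - ⟨ht, hnode₂, -, hcount₂⟩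
    exact ⟨by omega, hnode₂, hcount₂⟩

theorem poleProg_spec {p : ℕ} (hs : Consts m r L ε α σ s) :
    (poleProg p).WP F (fun s' t => t = 6 ∧
      s'.rv rV = s.iv iNode * (4 / 2 ^ L) - 6 + s.iv p * σ) s := by
  simp [poleProg, hs.sep, hs.cell, hs.six]

theorem pushProg_spec (hs : Consts m r L ε α σ s) (hi : s.iv iPos = i) :
    pushProg.WP F (fun s' t => t ≤ 6 ∧
      s'.rm aPushed = Function.update (s.rm aPushed) i (pushAway σ (s.rm aShaft i)) ∧
      s'.rm aWeight = Function.update (s.rm aWeight) i (pushAway σ (s.rm aShaft i) ^ 2)) s := by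
  by_cases h : s.rm aShaft i < 0 <;>
    simp [pushProg, pushAway, h, hs.zero, hs.sep, hi, pow_two]

theorem insertStepProg_spec (hs : Consts m r L ε α σ s) (hi : s.iv iPos = i)
    (hy : s.rm aDiag i = 4 * y - 6) (hy' : y ∈ Set.Ico (1 : ℝ) 2) :
    insertStepProg.WP F (fun s' t => t ≤ L * 11 + 21 ∧ s'.iv iPos = i + 1 ∧
      (∀ v, s'.im aCount v = s.im aCount v + Nat.count (fun l => node y (l + 1) = v) L) ∧
      s'.rm aPole = Function.update (s.rm aPole) i
        (node y L * (4 / 2 ^ L) - 6 + s'.im aCount (node y L) * σ) ∧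
      s'.rm aPushed = Function.update (s.rm aPushed) i (pushAway σ (s.rm aShaft i)) ∧
      s'.rm aWeight = Function.update (s.rm aWeight) i (pushAway σ (s.rm aShaft i) ^ 2)) s := by
  subst hi
  refine (insertPointProg_spec hs hy hy').seq ?_
  rintro s₁ t₁ hf₁ ⟨ht₁, hnode, hcount⟩
  refine Prog.WP.seq (Q := fun s' t => t = 1 ∧ s'.iv iCount = s₁.im aCount (node y L)) ?_ ?_
  · simp [hnode]
  rintro s₂ _ hf₂ ⟨rfl, hcount₂⟩
  have hs₂ := (hs.frame hf₁).frame hf₂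
  refine (poleProg_spec hs₂).seq ?_
  rintro s₃ _ hf₃ ⟨rfl, hpole⟩
  refine Prog.WP.seq (Q := fun s' t => t = 1 ∧ s'.rm aPole =
    Function.update (s₃.rm aPole) (s₃.iv iPos) (s₃.rv rV)) ?_ ?_
  · simp
  rintro s₄ _ hf₄ ⟨rfl, hpole₄⟩
  have hs₄ := (hs₂.frame hf₃).frame hf₄
  refine (pushProg_spec hs₄ rfl).seq ?_
  rintro s₅ t₅ hf₅ ⟨ht₅, hpushed, hweight⟩
  have hs₅ := hs₄.frame hf₅
  simp +decide [hs₅.one, hf₅.iv, hf₄.iv, hf₃.iv, hf₂.iv, hf₁.iv, hf₅.im, hf₄.im, hf₃.im, hf₂.im,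
    hcount, hpushed, hweight, hf₅.rm, hpole₄, hpole, hf₄.rm, hf₃.rm, hf₂.rm, hf₁.rm, hcount₂, hnode]
  omega

theorem insertProg_spec {y : ℕ → ℝ} (hs : Consts m r L ε α σ s) (hL : 0 < L)
    (hy : ∀ j, s.rm aDiag j = 4 * y j - 6) (hy' : ∀ j, y j ∈ Set.Ico (1 : ℝ) 2)
    (hcount : ∀ v, s.im aCount v = 0) :
    insertProg.WP F (fun s' t => t ≤ m * (L * 11 + 22) + 2 ∧ s'.im aCount = treeCount y L m ∧
      ∀ i < m, s'.rm aPole i = spread (fun j => node (y j) L) (4 / 2 ^ L) σ i ∧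
        s'.rm aPushed i = pushAway σ (s.rm aShaft i) ∧
        s'.rm aWeight i = pushAway σ (s.rm aShaft i) ^ 2) s := by
  refine Prog.WP.seq (Q := fun s' t => t = 1 ∧ s'.iv iPos = 0) (by simp) ?_
  rintro s₁ _ hf₁ ⟨rfl, hpos⟩
  have hs₁ := hs.frame hf₁
  refine (Prog.WP.count (fun i s' => (∀ v, s'.im aCount v = treeCount y L i v) ∧
    ∀ j < i, s'.rm aPole j = spread (fun j => node (y j) L) (4 / 2 ^ L) σ j ∧
      s'.rm aPushed j = pushAway σ (s.rm aShaft j) ∧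
      s'.rm aWeight j = pushAway σ (s.rm aShaft j) ^ 2)
    m (L * 11 + 21) hpos hs₁.shaft (by decide) ?_ ?_).mono ?_
  · simp [hf₁.im aCount (by decide), hcount, treeCount]
  · rintro i - s₂ hf₂ hi ⟨hcount₂, hprev⟩
    have hdiag : s₂.rm aDiag i = 4 * y i - 6 := by
      rw [hf₂.rm _ (by decide), hf₁.rm _ (by decide), hy]
    refine (insertStepProg_spec (hs₁.frame hf₂) hi hdiag (hy' i)).mono ?_
    rintro s₃ t - ⟨ht, hi₃, hcount₃, hpole, hpushed, hweight⟩
    have hcount₃ : ∀ v, s₃.im aCount v = treeCount y L (i + 1) v := fun v => by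
      rw [hcount₃, hcount₂, treeCount_succ]
    have hrank : treeCount y L (i + 1) (node (y i) L) =
        Nat.count (fun j => node (y j) L = node (y i) L) i + 1 := by
      obtain ⟨l, rfl⟩ := Nat.exists_eq_add_one.2 hL
      rw [treeCount_eq hy' l.lt_succ_self (log_node (hy' i) _), Nat.count_succ, if_pos rfl]
    have hshaft : s₂.rm aShaft = s.rm aShaft := by
      rw [hf₂.rm _ (by decide), hf₁.rm _ (by decide)]
    refine ⟨ht, hi₃, hcount₃, fun j hj => ?_⟩
    rw [hpole, hpushed, hweight, hcount₃, hrank, hshaft]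
    obtain rfl | hne := eq_or_ne j i
    · simp [spread]
    · simpa [hne] using hprev j (by omega)
  · rintro s₂ t - ⟨ht, hcount₂, hdone⟩
    exact ⟨by linarith, funext hcount₂, hdone⟩

end Execution

section Execution

attribute [local simp] Prog.wp_instr Prog.wp_seq Prog.wp_ite block literal Instr.Defined Instr.cost
  Instr.run ROp.fn Test.Holds

variable {F : BlackBox} {m r L i k l v c : ℕ} {ε α σ : ℝ} {s : State} {y : ℕ → ℝ}

/-! ## Specification: initial intervals -/

theorem searchLevelProg_spec (hs : Consts m r L ε α σ s) (hy : ∀ j, y j ∈ Set.Ico (1 : ℝ) 2)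
    (hcount : s.im aCount = treeCount y L m) (hl : l < L)
    (hr : HasRank (fun j => node (y j) l) m k (s.iv iNode) (s.iv iRank)) :
    searchLevelProg.WP F (fun s' t => t ≤ 6 ∧ s'.iv iOuter = s.iv iOuter + 1 ∧
      HasRank (fun j => node (y j) (l + 1)) m k (s'.iv iNode) (s'.iv iRank)) s := by
  have hleft : s.im aCount (s.iv iNode + s.iv iNode) =
      Nat.count (fun j => node (y j) (l + 1) = 2 * s.iv iNode) m := by
    rw [hcount, ← two_mul, treeCount_eq hy hl (hr.log_two_mul hy)]
  have hchild := hr.descend fun j => node_div_two (by linarith [(hy j).1]) l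
  rw [← hleft] at hchild
  split_ifs at hchild with h
  · simpa [searchLevelProg, h, hs.one, two_mul] using hchild
  · simpa [searchLevelProg, not_lt.1 h, hs.one, two_mul] using hchild

theorem searchPointProg_spec (hs : Consts m r L ε α σ s) (hy : ∀ j, y j ∈ Set.Ico (1 : ℝ) 2)
    (hcount : s.im aCount = treeCount y L m) (hpos : s.iv iPos < m) :
    searchPointProg.WP F (fun s' t => t ≤ L * 7 + 5 ∧
      HasRank (fun j => node (y j) L) m (s.iv iPos) (s'.iv iNode) (s'.iv iRank)) s := by
  refine Prog.WP.seq (Q := fun s' t => t = 4 ∧ s'.iv iRank = s.iv iPos ∧ s'.iv iNode = 1 ∧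
    s'.iv iOuter = 0) (by simp) ?_
  rintro s₁ _ hf₁ ⟨rfl, hrank, hnode, houter⟩
  have hs₁ := hs.frame hf₁
  refine (Prog.WP.count (fun l s' => HasRank (fun j => node (y j) l) m (s.iv iPos) (s'.iv iNode)
    (s'.iv iRank)) L 6 houter hs₁.depth (by decide) ?_ ?_).mono ?_
  · rw [hrank, hnode]
    exact .zero (fun j => node_zero (hy j)) hpos
  · rintro l hl s₂ hf₂ houter₂ hr
    refine (searchLevelProg_spec (hs₁.frame hf₂) hy ?_ hl hr).mono ?_
    · rw [hf₂.im _ (by decide), hf₁.im _ (by decide), hcount]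
    · rintro s₃ t - ⟨ht, houter₃, hr₃⟩
      exact ⟨ht, by rw [houter₃, houter₂], hr₃⟩
  · rintro s₂ t - ⟨ht, hr⟩
    exact ⟨by omega, hr⟩

theorem searchStepProg_spec (hs : Consts m r L ε α σ s) (hy : ∀ j, y j ∈ Set.Ico (1 : ℝ) 2)
    (hcount : s.im aCount = treeCount y L m) (hpos : s.iv iPos = k) (hk : k < m) :
    searchStepProg.WP F (fun s' t => t ≤ L * 7 + 15 ∧ s'.iv iPos = k + 1 ∧
      ∃ v c, HasRank (fun j => node (y j) L) m k v c ∧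
        s'.rm aHi = Function.update (s.rm aHi) k (v * (4 / 2 ^ L) - 6 + (c + 1 : ℕ) * σ) ∧
        s'.rm aLo = Function.update (s.rm aLo) (k + 1)
          (v * (4 / 2 ^ L) - 6 + (c + 1 : ℕ) * σ)) s := by
  subst hpos
  refine (searchPointProg_spec hs hy hcount hk).seq ?_
  rintro s₁ t₁ hf₁ ⟨ht₁, hr⟩
  have hs₁ := hs.frame hf₁
  refine Prog.WP.seq (Q := fun s' t => t = 1 ∧ s'.iv iRank = s₁.iv iRank + 1) ?_ ?_
  · simp [hs₁.one]
  rintro s₂ _ hf₂ ⟨rfl, hrank⟩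
  have hs₂ := hs₁.frame hf₂
  refine (poleProg_spec hs₂).seq ?_
  rintro s₃ _ hf₃ ⟨rfl, hpole⟩
  have hs₃ := hs₂.frame hf₃
  rw [hrank, hf₂.iv _ (by decide)] at hpole
  refine Prog.WP.mono (Q := fun s' t => t = 3 ∧ s'.iv iPos = s.iv iPos + 1 ∧
    s'.rm aHi = Function.update (s.rm aHi) (s.iv iPos) (s₃.rv rV) ∧
    s'.rm aLo = Function.update (s.rm aLo) (s.iv iPos + 1) (s₃.rv rV))
    (by simp +decide [hs₃.one, hf₃.iv, hf₂.iv, hf₁.iv, hf₃.rm, hf₂.rm, hf₁.rm]) ?_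
  rintro s₄ _ - ⟨rfl, hpos₄, hhi, hlo⟩
  rw [hpole] at hhi hlo
  exact ⟨by omega, hpos₄, _, _, hr, hhi, hlo⟩

theorem searchProg_spec (hs : Consts m r L ε α σ s) (hy : ∀ j, y j ∈ Set.Ico (1 : ℝ) 2)
    (hcount : s.im aCount = treeCount y L m) :
    searchProg.WP F (fun s' t => t ≤ m * (L * 7 + 16) + 8 ∧
      s'.rm aLo 0 = -8 ∧ s'.rm aHi m = 8 ∧ s'.rm aPole = Function.update (s.rm aPole) m (-16) ∧
      s'.rm aWeight = Function.update (s.rm aWeight) m 0 ∧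
      ∀ k < m, ∃ v c, HasRank (fun j => node (y j) L) m k v c ∧
        s'.rm aHi k = v * (4 / 2 ^ L) - 6 + (c + 1 : ℕ) * σ ∧ s'.rm aLo (k + 1) = s'.rm aHi k)
      s := by
  refine Prog.WP.seq (Q := fun s' t => t = 3 ∧ s'.iv iPos = 0 ∧ s'.rm aLo 0 = -8)
    (by simp [hs.zero, hs.eight]) ?_
  rintro s₁ _ hf₁ ⟨rfl, hpos, hlo⟩
  have hs₁ := hs.frame hf₁
  refine (Prog.WP.count (fun i s' => s'.rm aLo 0 = -8 ∧
    ∀ k < i, ∃ v c, HasRank (fun j => node (y j) L) m k v c ∧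
      s'.rm aHi k = v * (4 / 2 ^ L) - 6 + (c + 1 : ℕ) * σ ∧ s'.rm aLo (k + 1) = s'.rm aHi k)
    m (L * 7 + 15) hpos hs₁.shaft (by decide) ⟨hlo, by simp⟩ ?_).seq ?_
  · rintro i hi s₂ hf₂ hpos₂ ⟨hlo₂, hprev⟩
    refine (searchStepProg_spec (hs₁.frame hf₂) hy ?_ hpos₂ hi).mono ?_
    · rw [hf₂.im _ (by decide), hf₁.im _ (by decide), hcount]
    rintro s₃ t - ⟨ht, hpos₃, v, c, hr, hhi₃, hlo₃⟩
    refine ⟨ht, hpos₃, by simp [hlo₃, hlo₂], fun k hk => ?_⟩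
    obtain rfl | hne := eq_or_ne k i
    · exact ⟨v, c, hr, by simp [hhi₃], by simp [hhi₃, hlo₃]⟩
    · simpa [hhi₃, hlo₃, hne] using hprev k (by omega)
  · rintro s₂ t₂ hf₂ ⟨ht₂, hlo₂, hdone⟩
    have hs₂ := hs₁.frame hf₂
    refine Prog.WP.mono (Q := fun s' t => t = 4 ∧ s'.rm aLo = s₂.rm aLo ∧
      s'.rm aHi = Function.update (s₂.rm aHi) m 8 ∧
      s'.rm aPole = Function.update (s.rm aPole) m (-16) ∧
      s'.rm aWeight = Function.update (s.rm aWeight) m 0)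
      (by simp +decide [hs₂.zero, hs₂.shaft, hs₂.eight, hs₂.sixteen, hf₂.rm, hf₁.rm]) ?_
    rintro s₃ _ - ⟨rfl, hlo₃, hhi₃, hpole, hweight⟩
    refine ⟨by linarith, by rw [hlo₃, hlo₂], by simp [hhi₃], hpole, hweight, fun k hk => ?_⟩
    simpa [hlo₃, hhi₃, hk.ne] using hdone k hk

end Execution

/-! ## Specification: calls of the AFMM -/

/-- The black box answers the queries with `n` sources and accuracy `δ` correctly, for the constants
that the program uses, and needs at most `Φ` operations for each of them. -/
def BlackBox.AnswersWithin (F : BlackBox) (n : ℕ) (δ : ℝ) (Φ : ℕ) : Prop :=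
  ∀ q : Query, q.Admissible 32 1 2 → q.n = n → q.acc = δ →
    (∀ i, |F.eval q i - q.exact i| ≤ δ) ∧ F.cost q ≤ Φ

/-- The memory contains the poles `Y j`, the shaft entries `Z j` and the weights `Z j ^ 2`, and the
additional source of weight zero. -/
structure Sources (m : ℕ) (Z Y : ℕ → ℝ) (s : State) : Prop where
  pole : ∀ j < m, s.rm aPole j = Y j
  pushed : ∀ j < m, s.rm aPushed j = Z j
  weight : ∀ j < m, s.rm aWeight j = Z j ^ 2
  last_pole : s.rm aPole m = -16
  last_weight : s.rm aWeight m = 0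

theorem Sources.frame {m : ℕ} {Z Y : ℕ → ℝ} {P : Prog} {s s' : State} (hs : Sources m Z Y s)
    (hf : Frame P s s')
    (hP : ∀ A ∈ [aPole, aPushed, aWeight], Loc.rarr A ∉ P.targets := by decide) :
    Sources m Z Y s' := by
  have hpole := hf.rm aPole (hP _ (by decide))
  have hpushed := hf.rm aPushed (hP _ (by decide))
  have hweight := hf.rm aWeight (hP _ (by decide))
  exact ⟨by simpa only [hpole] using hs.pole, by simpa only [hpushed] using hs.pushed,
    by simpa only [hweight] using hs.weight, by rw [hpole, hs.last_pole],
    by rw [hweight, hs.last_weight]⟩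

section Execution

attribute [local simp] Prog.wp_instr Prog.wp_seq Prog.wp_ite block literal Instr.Defined Instr.cost
  Instr.run ROp.fn Test.Holds

variable {F : BlackBox} {m r L k t Φ : ℕ} {ε α σ : ℝ} {s : State} {Z Y e lam : ℕ → ℝ}

theorem fmmProg_wp {n : ℕ} {δ : ℝ} {κ : Kernel} {X W : ℕ} (hF : F.AnswersWithin n δ Φ)
    (hn : 1 ≤ n) (hδ : 0 < δ) (hδ' : δ < 1 / 2) (hacc : s.rv rAcc = δ) (hbound : s.rv rBound = 32)
    (hsize : s.iv iSize = n) (hX : ∀ i < n, |s.rm X i| < 32) (hW : ∀ j < n, |s.rm W j| < 32)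
    (hY : ∀ j < n, |s.rm aPole j| < 32)
    (hsep : ∀ i < n, ∀ j < n, δ ^ 2 ≤ |s.rm X i - s.rm aPole j|) :
    (fmmProg κ X W).WP F (fun s' t => t ≤ Φ + 1 ∧ ∀ i < n, |s'.rm aAnswer i -
      ∑ j ∈ Finset.range n, s.rm W j * κ.fn (s.rm X i - s.rm aPole j)| ≤ δ) s := by
  subst hsize hacc
  have hq : (s.query κ rAcc rBound iSize iSize X W aPole).Admissible 32 1 2 :=
    { acc_pos := hδ
      acc_lt := hδ'
      n_pos := hn
      m_le := le_rfl
      bound_eq := hbound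
      x_lt := fun i => (hX i i.2).trans_eq hbound.symm
      c_lt := fun j => (hW j j.2).trans_eq hbound.symm
      y_lt := fun j => (hY j j.2).trans_eq hbound.symm
      separated := fun i j => by
        refine le_trans ?_ (hsep i i.2 j j.2)
        rw [one_mul, div_pow]
        exact div_le_self (by positivity) (one_le_pow₀ (by exact_mod_cast hn)) }
  obtain ⟨hans, hcost⟩ := hF _ hq rfl rfl
  refine Prog.wp_instr.2 ⟨trivial, Nat.succ_le_succ hcost, fun i hi => ?_⟩
  simp only [Instr.run, Function.update_self, dif_pos hi, Finset.sum_range]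
  exact hans ⟨i, hi⟩

theorem fmmProg_spec {κ : Kernel} {X W : ℕ} (hs : Consts m r L ε α σ s)
    (hF : F.AnswersWithin (m + 1) (σ ^ 32) Φ) (hσ : 0 < σ) (hσ' : σ ≤ 1 / 32)
    (hl : IsLadder m σ Y e) (hsrc : Sources m Z Y s) (hW : ∀ j < m, |s.rm W j| < 32)
    (hlast : s.rm W m = 0)
    (hX : ∀ k ≤ m, e k + σ ^ 64 ≤ s.rm X k ∧ s.rm X k + σ ^ 64 ≤ e (k + 1)) :
    (fmmProg κ X W).WP F (fun s' t => t ≤ Φ + 1 ∧ ∀ k ≤ m, |s'.rm aAnswer k -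
      ∑ j ∈ Finset.range m, s.rm W j * κ.fn (s.rm X k - Y j)| ≤ σ ^ 32) s := by
  have hδ : σ ^ 32 < 1 / 2 := (pow_le_pow_left₀ hσ.le hσ' 32).trans_lt (by norm_num)
  have hδ' : σ ^ 64 < 1 / 2 := (pow_le_pow_left₀ hσ.le hσ' 64).trans_lt (by norm_num)
  have hX8 : ∀ k ≤ m, |s.rm X k| ≤ 8 := fun k hk => abs_le.2
    ⟨by linarith [hl.lower hk, hX k hk, pow_pos hσ 64],
      by linarith [hl.upper hk, hX k hk, pow_pos hσ 64]⟩
  refine (fmmProg_wp hF m.succ_pos (pow_pos hσ 32) hδ hs.acc hs.bound hs.size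
    (fun k hk => (hX8 k (by omega)).trans_lt (by norm_num)) (fun j hj => ?_) (fun j hj => ?_)
    fun k hk j hj => ?_).mono ?_
  · obtain hj | rfl := (Nat.lt_succ_iff.1 hj).lt_or_eq
    · exact hW j hj
    · norm_num [hlast]
  · obtain hj | rfl := (Nat.lt_succ_iff.1 hj).lt_or_eq
    · linarith [hsrc.pole j hj ▸ hl.abs_le j hj]
    · norm_num [hsrc.last_pole]
  · rw [← pow_mul σ 32 2]
    obtain hj | rfl := (Nat.lt_succ_iff.1 hj).lt_or_eq
    · exact hsrc.pole j hj ▸ hl.le_abs_sub (by omega) hj (hX k (by omega)).1 (hX k (by omega)).2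
    · rw [hsrc.last_pole]
      exact hδ'.le.trans (le_trans (by linarith [neg_le_of_abs_le (hX8 k (by omega))])
        (le_abs_self _))
  · rintro s' t - ⟨ht, hans⟩
    refine ⟨ht, fun k hk => ?_⟩
    have hsum : ∑ j ∈ Finset.range m, s.rm W j * κ.fn (s.rm X k - s.rm aPole j) =
        ∑ j ∈ Finset.range m, s.rm W j * κ.fn (s.rm X k - Y j) :=
      Finset.sum_congr rfl fun j hj => by rw [hsrc.pole j (Finset.mem_range.1 hj)]
    simpa [Finset.sum_range_succ, hlast, hsum] using hans k (by omega)

/-! ## Specification: bisection -/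

theorem midpoints_spec (hs : Consts m r L ε α σ s) (hpos : s.iv iPos = 0) :
    (Prog.loop (.ilt iPos iSize) midpointProg).WP F (fun s' t => t ≤ (m + 1) * 7 + 1 ∧
      ∀ k ≤ m, s'.rm aPoint k = (s.rm aLo k + s.rm aHi k) / 2) s := by
  refine (Prog.WP.count (fun i s' => ∀ k < i, s'.rm aPoint k = (s.rm aLo k + s.rm aHi k) / 2)
    (m + 1) 6 hpos hs.size (by decide) (by simp) ?_).mono
    fun s' t _ h => ⟨h.1, fun k hk => h.2 k (by omega)⟩
  intro i _ s₁ hf hi hprev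
  have hs₁ := hs.frame hf
  refine Prog.WP.mono (Q := fun s' t => t = 6 ∧ s'.iv iPos = i + 1 ∧ s'.rm aPoint =
    Function.update (s₁.rm aPoint) i ((s.rm aLo i + s.rm aHi i) / 2))
    (by simp +decide [midpointProg, hs₁.two, hs₁.one, hi, hf.rm]) ?_
  rintro s₂ _ - ⟨rfl, hi₂, hpoint⟩
  refine ⟨le_rfl, hi₂, fun k hk => ?_⟩
  rw [hpoint]
  obtain rfl | hne := eq_or_ne k i
  · simp
  · simpa [hne] using hprev k (by omega)

theorem halveProg_spec (hs : Consts m r L ε α σ s) (hk : s.iv iPos = k) :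
    halveProg.WP F (fun s' t => t ≤ 7 ∧ s'.iv iPos = k + 1 ∧
      if 0 < α - s.rm aPoint k + s.rm aAnswer k then
        s'.rm aLo = Function.update (s.rm aLo) k (s.rm aPoint k) ∧ s'.rm aHi = s.rm aHi
      else
        s'.rm aLo = s.rm aLo ∧ s'.rm aHi = Function.update (s.rm aHi) k (s.rm aPoint k)) s := by
  by_cases h : 0 < α - s.rm aPoint k + s.rm aAnswer k <;>
    simp [halveProg, h, hs.corner, hs.zero, hs.one, hk]

theorem halves_spec (hs : Consts m r L ε α σ s) (hpos : s.iv iPos = 0) :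
    (Prog.loop (.ilt iPos iSize) halveProg).WP F (fun s' t => t ≤ (m + 1) * 8 + 1 ∧ ∀ k ≤ m,
      if 0 < α - s.rm aPoint k + s.rm aAnswer k then
        s'.rm aLo k = s.rm aPoint k ∧ s'.rm aHi k = s.rm aHi k
      else s'.rm aLo k = s.rm aLo k ∧ s'.rm aHi k = s.rm aPoint k) s := by
  refine (Prog.WP.count (fun i s' => (∀ k < i,
      if 0 < α - s.rm aPoint k + s.rm aAnswer k then
        s'.rm aLo k = s.rm aPoint k ∧ s'.rm aHi k = s.rm aHi k
      else s'.rm aLo k = s.rm aLo k ∧ s'.rm aHi k = s.rm aPoint k) ∧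
    ∀ k, i ≤ k → s'.rm aLo k = s.rm aLo k ∧ s'.rm aHi k = s.rm aHi k)
    (m + 1) 7 hpos hs.size (by decide) (by simp) ?_).mono
    fun s' t _ h => ⟨h.1, fun k hk => h.2.1 k (by omega)⟩
  rintro i - s₁ hf hi ⟨hprev, hrest⟩
  refine (halveProg_spec (hs.frame hf) hi).mono ?_
  rintro s₂ t - ⟨ht, hi₂, h⟩
  rw [hf.rm aPoint (by decide), hf.rm aAnswer (by decide)] at h
  refine ⟨ht, hi₂, fun k hk => ?_, fun k hk => ?_⟩
  · obtain rfl | hne := eq_or_ne k i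
    · have := hrest k le_rfl
      split_ifs at h ⊢ <;> simp [h, this]
    · have := hprev k (by omega)
      split_ifs at h <;> simpa [h, hne] using this
  · have hne : k ≠ i := by omega
    have := hrest k (by omega)
    split_ifs at h <;> simp [h, this, hne]

theorem pow_sixtyFour_le_div (hσ : 0 < σ) (hσ' : σ ≤ 1 / 32) (ht : σ ^ 32 ≤ 16 / 2 ^ t) :
    σ ^ 64 ≤ σ / 2 ^ t / 2 := by
  calc σ ^ 64 ≤ σ ^ 34 := pow_le_pow_of_le_one hσ.le (by linarith) (by norm_num)
    _ = σ ^ 32 * (σ * σ) := by ring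
    _ ≤ 16 / 2 ^ t * (σ * (1 / 32)) := by gcongr
    _ = σ / 2 ^ t / 2 := by ring

theorem bisectStepProg_spec (hs : Consts m r L ε α σ s)
    (hF : F.AnswersWithin (m + 1) (σ ^ 32) Φ) (hσ : 0 < σ) (hσ' : σ ≤ 1 / 32)
    (hl : IsLadder m σ Y e) (hsrc : Sources m Z Y s) (hZ : ∀ j < m, |Z j| ≤ 2)
    (hlam : SecularRoots m α σ (fun j => Z j ^ 2) Y e lam) (ht : σ ^ 32 ≤ 16 / 2 ^ t)
    (hb : ∀ k ≤ m, IsBracket σ (σ ^ 32) e lam t k (s.rm aLo k) (s.rm aHi k)) :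
    bisectStepProg.WP F (fun s' u => u ≤ Φ + 15 * (m + 1) + 6 ∧ s'.rv rLen = s.rv rLen / 2 ∧
      ∀ k ≤ m, IsBracket σ (σ ^ 32) e lam (t + 1) k (s'.rm aLo k) (s'.rm aHi k)) s := by
  refine Prog.WP.seq (Q := fun s' t => t = 2 ∧ s'.rv rLen = s.rv rLen / 2 ∧ s'.iv iPos = 0)
    (by simp [hs.two]) ?_
  rintro s₁ _ hf₁ ⟨rfl, hlen, hpos⟩
  have hs₁ := hs.frame hf₁
  refine (midpoints_spec hs₁ hpos).seq ?_
  rintro s₂ t₂ hf₂ ⟨ht₂, hpoint⟩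
  have hs₂ := hs₁.frame hf₂
  have hsrc₂ := (hsrc.frame hf₁).frame hf₂
  rw [hf₁.rm aLo (by decide), hf₁.rm aHi (by decide)] at hpoint
  have hsep := pow_sixtyFour_le_div hσ hσ' ht
  refine (fmmProg_spec hs₂ hF hσ hσ' hl hsrc₂ (fun j hj => ?_) hsrc₂.last_weight
    fun k hk => ?_).seq ?_
  · rw [hsrc₂.weight j hj, abs_pow]
    linarith [pow_le_pow_left₀ (abs_nonneg _) (hZ j hj) 2]
  · rw [hpoint k hk]
    exact ⟨by linarith [(hb k hk).left_add_le_mid], by linarith [(hb k hk).mid_add_le_right]⟩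
  rintro s₃ t₃ hf₃ ⟨ht₃, hans⟩
  refine Prog.WP.seq (Q := fun s' t => t = 1 ∧ s'.iv iPos = 0) (by simp) ?_
  rintro s₄ _ hf₄ ⟨rfl, hpos₄⟩
  refine (halves_spec ((hs₂.frame hf₃).frame hf₄) hpos₄).mono ?_
  rintro s₅ t₅ hf₅ ⟨ht₅, hhalf⟩
  refine ⟨by omega, by simpa +decide [hf₅.rv, hf₄.rv, hf₃.rv, hf₂.rv] using hlen, fun k hk => ?_⟩
  have hsec : |α - s₂.rm aPoint k + s₃.rm aAnswer k -
      secular m α (fun j => Z j ^ 2) Y ((s.rm aLo k + s.rm aHi k) / 2)| ≤ σ ^ 32 := by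
    have hsum : ∑ j ∈ Finset.range m, s₂.rm aWeight j * Kernel.inv.fn (s₂.rm aPoint k - Y j) =
        ∑ j ∈ Finset.range m, Z j ^ 2 * (1 / (s₂.rm aPoint k - Y j)) :=
      Finset.sum_congr rfl fun j hj => by rw [hsrc₂.weight j (Finset.mem_range.1 hj), Kernel.fn]
    rw [← hpoint k hk, secular, add_sub_add_left_eq_sub, ← hsum]
    exact hans k hk
  have hhalf := hhalf k hk
  have hnew := (hb k hk).halve hlam hl hσ (fun j _ => sq_nonneg (Z j)) hk hsec
  simp +decide only [hf₄.rm, hf₃.rm, hf₂.rm, hf₁.rm] at hhalf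
  rw [← hpoint k hk] at hnew
  split_ifs at hhalf hnew <;> rwa [hhalf.1, hhalf.2]

theorem bisectProg_spec {u N : ℕ} {η : ℝ} (hs : Consts m r L ε α σ s)
    (hF : F.AnswersWithin (m + 1) (σ ^ 32) Φ) (hσ : 0 < σ) (hσ' : σ ≤ 1 / 32)
    (hl : IsLadder m σ Y e) (hsrc : Sources m Z Y s) (hZ : ∀ j < m, |Z j| ≤ 2)
    (hlam : SecularRoots m α σ (fun j => Z j ^ 2) Y e lam)
    (hlo : ∀ k ≤ m, s.rm aLo k = e k) (hhi : ∀ k ≤ m, s.rm aHi k = e (k + 1))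
    (hu : s.rv u = η) (huP : Loc.rreg u ∉ (bisectProg rAcc).targets) (hη : σ ^ 32 ≤ η)
    (hN : 16 / 2 ^ N ≤ η) :
    (bisectProg u).WP F (fun s' t => t ≤ N * (Φ + 15 * (m + 1) + 7) + 2 ∧
      ∀ k ≤ m, |s'.rm aLo k - lam k| ≤ η + σ ^ 32) s := by
  refine Prog.WP.seq (Q := fun s' t => t = 1 ∧ s'.rv rLen = 16)
    (by simp [hs.zero, hs.sixteen]) ?_
  rintro s₁ _ hf₁ ⟨rfl, hlen⟩
  have hs₁ := hs.frame hf₁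
  have hu₁ : s₁.rv u = η := (hf₁.rv u fun h => huP (List.mem_append_left _ h)).trans hu
  have hsrc₁ := hsrc.frame hf₁
  have hu₂ : ∀ s', Frame bisectStepProg s₁ s' → s'.rv u = η := fun s' hf =>
    (hf.rv u fun h => huP (List.mem_append_right _ h)).trans hu₁
  refine (Prog.WP.loop (fun t s' => s'.rv rLen = 16 / 2 ^ t ∧
    ∀ k ≤ m, IsBracket σ (σ ^ 32) e lam t k (s'.rm aLo k) (s'.rm aHi k)) N
    (Φ + 15 * (m + 1) + 6) ⟨by simp [hlen], fun k hk => ?_⟩ ?_ ?_).mono ?_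
  · rw [hf₁.rm aLo (by decide), hf₁.rm aHi (by decide), hlo k hk, hhi k hk]
    exact hlam.isBracket_zero hl hσ (by positivity) hk
  · rintro s₂ hf₂ ⟨hlen₂, -⟩
    simpa [hlen₂, hu₂ s₂ hf₂] using hN
  · rintro t - s₂ hf₂ ⟨hlen₂, hb⟩ hT
    simp only [Test.Holds, hlen₂, hu₂ s₂ hf₂] at hT
    refine (bisectStepProg_spec (hs₁.frame hf₂) hF hσ hσ' hl (hsrc₁.frame hf₂) hZ hlam
      (hη.trans hT.le) hb).mono ?_
    rintro s₃ t₃ - ⟨ht₃, hlen₃, hb₃⟩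
    exact ⟨ht₃, by rw [hlen₃, hlen₂, pow_succ, div_div], hb₃⟩
  · rintro s₂ t₂ hf₂ ⟨ht₂, t, -, ⟨hlen₂, hb⟩, hT⟩
    simp only [Test.Holds, hlen₂, hu₂ s₂ hf₂.of_loop, not_lt] at hT
    exact ⟨by linarith, fun k hk => (hb k hk).abs_left_sub_le.trans (by linarith)⟩

end Execution

/-! ## Specification: eigenvalues -/

section Execution

variable {F : BlackBox} {m r L N T Φ : ℕ} {ε α σ η : ℝ} {s : State} {z d : ℕ → ℝ}

theorem setupProg_spec (hsize : s.iv iSize = m + 1) (hcols : s.iv iCols = r)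
    (heps : s.rv rEps = ε) (hcorner : s.rv rCorner = α) (hε : ε ≤ 1) (hN : 4 / 2 ^ N ≤ ε / 16) :
    setupProg.WP F (fun s' t => t ≤ N * 3 + 32 ∧ ∃ L ≤ N,
      Consts m r L ε α (ε / (64 * (m + 1))) s' ∧ 4 / 2 ^ L ≤ ε / 16 ∧ ε / 32 < 4 / 2 ^ L) s := by
  refine (constProg_spec hsize hcols heps hcorner).seq ?_
  rintro s₁ _ - ⟨rfl, hs₁, hgoal⟩
  refine (depthProg_spec hs₁ hgoal hε hN).mono ?_
  rintro s₂ t₂ - ⟨ht₂, hL⟩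
  exact ⟨by omega, hL⟩

theorem exists_isLadder_spread {g : ℕ → ℕ} {h : ℝ} {Y lo hi : ℕ → ℝ} (hσ : 0 < σ) (hσ' : σ ≤ 6)
    (hm : m * σ ≤ h) (hY : ∀ i < m, Y i = spread g h σ i) (habs : ∀ i < m, |Y i| ≤ 2)
    (hlo : lo 0 = -8) (hhi : hi m = 8)
    (hrank : ∀ k < m, ∃ v c, HasRank g m k v c ∧ hi k = v * h - 6 + (c + 1 : ℕ) * σ ∧
      lo (k + 1) = hi k) :
    ∃ e, IsLadder m σ Y e ∧ ∀ k ≤ m, lo k = e k ∧ hi k = e (k + 1) := by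
  set e : ℕ → ℝ := fun k => if k = m + 1 then 8 else lo k
  have he : ∀ k ≤ m, e k = lo k := fun k hk => if_neg (by omega)
  have hlast : e (m + 1) = 8 := if_pos rfl
  refine ⟨e, isLadder_spread ((he 0 m.zero_le).trans hlo) hlast hσ hσ' hm hY habs fun k hk => ?_,
    fun k hk => ⟨(he k hk).symm, ?_⟩⟩
  · obtain ⟨v, c, hvc, hhi, hlo⟩ := hrank k hk
    exact ⟨v, c, hvc, by rw [he (k + 1) hk, hlo, hhi]⟩
  obtain hk | rfl := hk.lt_or_eq
  · obtain ⟨v, c, -, -, hlo⟩ := hrank k hk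
    rw [he (k + 1) hk, hlo]
  · rw [hlast, hhi]

theorem perturbProg_spec (hs : Consts m r L ε α σ s) (hz : s.rm aShaft = z) (hd : s.rm aDiag = d)
    (hcount : ∀ v, s.im aCount v = 0) (hL : 4 / 2 ^ L ≤ (1 : ℝ)) (hσ : 0 < σ)
    (hcell : (m + 1) * σ ≤ 4 / 2 ^ L) (hd' : ∀ i, |d i| ≤ 1) :
    perturbProg.WP F (fun s' t => t ≤ m * (L * 18 + 38) + 10 ∧ ∃ Y e, IsLadder m σ Y e ∧
      Sources m (fun i => pushAway σ (z i)) Y s' ∧ (∀ i < m, |Y i - d i| ≤ 4 / 2 ^ L) ∧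
      ∀ k ≤ m, s'.rm aLo k = e k ∧ s'.rm aHi k = e (k + 1)) s := by
  subst hz hd
  set y : ℕ → ℝ := fun i => (s.rm aDiag i + 6) / 4
  have hy : ∀ i, s.rm aDiag i = 4 * y i - 6 := fun i => by simp only [y]; ring
  have hy' : ∀ i, y i ∈ Set.Ico (1 : ℝ) 2 := fun i => by
    constructor <;> simp only [y] <;> linarith [abs_le.1 (hd' i)]
  have hL' : 0 < L := Nat.pos_of_ne_zero fun h => by norm_num [h] at hL
  have hmσ : 0 ≤ m * σ := by positivity
  refine (insertProg_spec hs hL' hy hy' hcount).seq ?_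
  rintro s₁ t₁ hf₁ ⟨ht₁, hcount₁, hins⟩
  refine (searchProg_spec (hs.frame hf₁) hy' hcount₁).mono ?_
  rintro s₂ t₂ hf₂ ⟨ht₂, hlo, hhi, hpole, hweight, hrank⟩
  set Y := spread (fun j => node (y j) L) (4 / 2 ^ L) σ
  have hnear : ∀ i < m, |Y i - s.rm aDiag i| ≤ 4 / 2 ^ L := fun i hi => by
    rw [hy]
    refine abs_spread_sub_le hσ.le (by linarith [(hy' i).1]) (le_trans ?_ hcell)
    exact mul_le_mul_of_nonneg_right (by exact_mod_cast Nat.le_succ_of_le hi) hσ.le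
  have habs : ∀ i < m, |Y i| ≤ 2 := fun i hi => by
    linarith [abs_sub_abs_le_abs_sub (Y i) (s.rm aDiag i), hnear i hi, hd' i]
  obtain ⟨e, hl, hends⟩ := exists_isLadder_spread hσ (by linarith) (by linarith) (fun _ _ => rfl)
    habs hlo hhi hrank
  have hsrc : Sources m (fun i => pushAway σ (s.rm aShaft i)) Y s₂ :=
    { pole := fun j hj => by rw [hpole, Function.update_of_ne hj.ne, (hins j hj).1]
      pushed := fun j hj => by rw [hf₂.rm aPushed (by decide), (hins j hj).2.1]
      weight := fun j hj => by rw [hweight, Function.update_of_ne hj.ne, (hins j hj).2.2]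
      last_pole := by rw [hpole, Function.update_self]
      last_weight := by rw [hweight, Function.update_self] }
  exact ⟨by linarith, Y, e, hl, hsrc, hnear, hends⟩

theorem eigProg_spec {u : ℕ} (hsize : s.iv iSize = m + 1) (hcols : s.iv iCols = r)
    (heps : s.rv rEps = ε) (hcorner : s.rv rCorner = α) (hz : s.rm aShaft = z)
    (hd : s.rm aDiag = d) (hcount : ∀ v, s.im aCount v = 0) (hε : 0 < ε) (hε' : ε ≤ 1)
    (hε'' : 2 * ε ≤ m + 1) (hσ : σ = ε / (64 * (m + 1)))
    (hu : ∀ L s', Consts m r L ε α σ s' → s'.rv u = η)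
    (huP : Loc.rreg u ∉ (bisectProg rAcc).targets) (hη : σ ^ 32 ≤ η)
    (hN : 4 / 2 ^ N ≤ ε / 16) (hT : 16 / 2 ^ T ≤ η) (hF : F.AnswersWithin (m + 1) (σ ^ 32) Φ)
    (hα : |α| ≤ 1) (hd' : ∀ i, |d i| ≤ 1) (hz' : ∑ j ∈ Finset.range m, z j ^ 2 ≤ 1) :
    (eigProg u).WP F (fun s' t => t ≤ 100 * (N + 1) * (m + 1) + T * (Φ + 15 * (m + 1) + 7) ∧
      ∃ L Z Y e lam, Consts m r L ε α σ s' ∧ IsPerturbation m ε α σ z d Z Y e lam ∧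
        Sources m Z Y s' ∧ ∀ k ≤ m, |s'.rm aLo k - lam k| ≤ η + σ ^ 32) s := by
  have hσ0 : 0 < σ := by rw [hσ]; positivity
  have hmσ : (m + 1) * σ = ε / 64 := by rw [hσ]; field_simp
  have hσ' : σ ≤ 1 / 128 := by
    rw [hσ, div_le_div_iff₀ (by positivity) (by norm_num)]
    linarith
  refine (setupProg_spec hsize hcols heps hcorner hε' hN).seq ?_
  rintro s₁ t₁ hf₁ ⟨ht₁, L, hL, hs₁, hcell, hcell'⟩
  rw [← hσ] at hs₁
  refine (perturbProg_spec hs₁ ((hf₁.rm aShaft (by decide)).trans hz)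
    ((hf₁.rm aDiag (by decide)).trans hd) (by rwa [hf₁.im aCount (by decide)]) (by linarith) hσ0
    (by linarith) hd').seq ?_
  rintro s₂ t₂ hf₂ ⟨ht₂, Y, e, hl, hsrc, hnear, hends⟩
  have hs₂ := hs₁.frame hf₂
  obtain ⟨lam, hper⟩ := exists_isPerturbation hα hσ0 hσ' (by linarith) hz'
    (fun i hi => (hnear i hi).trans hcell) hl
  refine (bisectProg_spec hs₂ hF hσ0 (by linarith) hl hsrc
    (fun j hj => ?_) hper.roots (fun k hk => (hends k hk).1)
    (fun k hk => (hends k hk).2) (hu L s₂ hs₂) huP hη hT).mono ?_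
  · refine hper.abs_shaft_le (by linarith) hj ((sq_le_one_iff_abs_le_one _).1 (le_trans ?_ hz'))
    exact Finset.single_le_sum (f := fun j => z j ^ 2) (fun _ _ => sq_nonneg _)
      (Finset.mem_range.2 hj)
  · rintro s₃ t₃ hf ⟨ht₃, hlo⟩
    have hf₃ : Frame (bisectProg rAcc) s₂ s₃ := hf.mono (List.Subset.refl _)
    refine ⟨?_, L, _, Y, e, lam, hs₂.frame hf₃, hper, hsrc.frame hf₃, hlo⟩
    nlinarith

end Execution

/-! ## Specification: eigenvectors -/

section Execution

attribute [local simp] Prog.wp_instr Prog.wp_seq Prog.wp_ite block literal Instr.Defined Instr.cost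
  Instr.run ROp.fn Test.Holds

variable {F : BlackBox} {m r c L Φ : ℕ} {ε α σ : ℝ} {s : State} {Z Y e b : ℕ → ℝ}

theorem norms_spec (hs : Consts m r L ε α σ s) (hpos : s.iv iPos = 0) (hone : s.rv rY = 1)
    (hans : ∀ k ≤ m, 0 ≤ 1 + s.rm aAnswer k) :
    (Prog.loop (.ilt iPos iSize) normStepProg).WP F (fun s' t => t ≤ (m + 1) * 6 + 1 ∧
      ∀ k ≤ m, s'.rm aNorm k = √(1 + s.rm aAnswer k)) s := by
  refine (Prog.WP.count (fun i s' => ∀ k < i, s'.rm aNorm k = √(1 + s.rm aAnswer k))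
    (m + 1) 5 hpos hs.size (by decide) (by simp) ?_).mono
    fun s' t _ h => ⟨h.1, fun k hk => h.2 k (by omega)⟩
  intro i hi s₁ hf hi₁ hprev
  have hnonneg : 0 ≤ s.rm aAnswer i + 1 := by linarith [hans i (by omega)]
  refine Prog.WP.mono (Q := fun s' t => t = 5 ∧ s'.iv iPos = i + 1 ∧ s'.rm aNorm =
    Function.update (s₁.rm aNorm) i (√(1 + s.rm aAnswer i)))
    (by simp +decide [normStepProg, (hs.frame hf).one, hi₁, hf.rm, hf.rv, hone, hnonneg,
      add_comm (1 : ℝ)]) ?_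
  rintro s₂ _ - ⟨rfl, hi₂, hnorm⟩
  refine ⟨le_rfl, hi₂, fun k hk => ?_⟩
  rw [hnorm]
  obtain rfl | hne := eq_or_ne k i
  · simp
  · simpa [hne] using hprev k (by omega)

theorem normProg_spec (hs : Consts m r L ε α σ s) (hF : F.AnswersWithin (m + 1) (σ ^ 32) Φ)
    (hσ : 0 < σ) (hσ' : σ ≤ 1 / 32) (hl : IsLadder m σ Y e) (hsrc : Sources m Z Y s)
    (hZ : ∀ j < m, |Z j| ≤ 2)
    (hX : ∀ k ≤ m, e k + σ ^ 64 ≤ s.rm aLo k ∧ s.rm aLo k + σ ^ 64 ≤ e (k + 1)) :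
    normProg.WP F (fun s' t => t ≤ Φ + 6 * (m + 1) + 4 ∧ ∀ k ≤ m, ∃ g,
      |g - ∑ j ∈ Finset.range m, Z j ^ 2 * (1 / (s.rm aLo k - Y j) ^ 2)| ≤ σ ^ 32 ∧
      0 < 1 + g ∧ s'.rm aNorm k = √(1 + g)) s := by
  refine (fmmProg_spec (κ := .invSq) hs hF hσ hσ' hl hsrc (fun j hj => ?_) hsrc.last_weight
    hX).seq ?_
  · rw [hsrc.weight j hj, abs_pow]
    linarith [pow_le_pow_left₀ (abs_nonneg _) (hZ j hj) 2]
  rintro s₁ t₁ hf₁ ⟨ht₁, hans⟩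
  have hs₁ := hs.frame hf₁
  have hsum : ∀ k, ∑ j ∈ Finset.range m, s.rm aWeight j * Kernel.invSq.fn (s.rm aLo k - Y j) =
      ∑ j ∈ Finset.range m, Z j ^ 2 * (1 / (s.rm aLo k - Y j) ^ 2) := fun k =>
    Finset.sum_congr rfl fun j hj => by rw [hsrc.weight j (Finset.mem_range.1 hj), Kernel.fn]
  simp only [hsum] at hans
  have hδ : σ ^ 32 < 1 := pow_lt_one₀ hσ.le (by linarith) (by norm_num)
  have hpos : ∀ k ≤ m, 0 < 1 + s₁.rm aAnswer k := fun k hk => by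
    have hnonneg : 0 ≤ ∑ j ∈ Finset.range m, Z j ^ 2 * (1 / (s.rm aLo k - Y j) ^ 2) :=
      Finset.sum_nonneg fun j _ => by positivity
    linarith [neg_le_of_abs_le (hans k hk)]
  refine Prog.WP.seq (Q := fun s' t => t = 2 ∧ s'.iv iPos = 0 ∧ s'.rv rY = 1)
    (by simp [hs₁.one]) ?_
  rintro s₂ _ hf₂ ⟨rfl, hi, hone⟩
  have hanswer := hf₂.rm aAnswer (by decide)
  refine (norms_spec (hs₁.frame hf₂) hi hone fun k hk => ?_).mono ?_
  · rw [hanswer]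
    exact (hpos k hk).le
  · rintro s₃ t₃ - ⟨ht₃, hnorm⟩
    rw [hanswer] at hnorm
    exact ⟨by linarith, fun k hk => ⟨_, hans k hk, hpos k hk, hnorm k hk⟩⟩

theorem weightsProg_spec (hs : Consts m r L ε α σ s) (hsrc : Sources m Z Y s)
    (hb : s.rm aCols = b) (hc : s.iv iOuter = c) :
    weightsProg.WP F (fun s' t => t ≤ 7 * m + 5 ∧ s'.rv rV = b c ∧ s'.rm aColWeight m = 0 ∧
      ∀ j < m, s'.rm aColWeight j = Z j * b (c + r * (j + 1))) s := by
  refine Prog.WP.seq (Q := fun s' t => t = 3 ∧ s'.rv rV = b c ∧ s'.iv iAddr = c + r ∧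
    s'.iv iPos = 0) (by simp [hc, hb, hs.cols]) ?_
  rintro s₁ _ hf₁ ⟨rfl, hrow, haddr, hpos⟩
  have hs₁ := hs.frame hf₁
  refine (Prog.WP.count (fun i s' => s'.iv iAddr = c + r * (i + 1) ∧
    ∀ j < i, s'.rm aColWeight j = Z j * b (c + r * (j + 1))) m 6 hpos hs₁.shaft (by decide)
    (by simp [haddr]) ?_).seq ?_
  · rintro i hi s₂ hf₂ hi₂ ⟨haddr₂, hprev⟩
    have hs₂ := hs₁.frame hf₂
    have hpush : s₂.rm aPushed i = Z i := ((hsrc.frame hf₁).frame hf₂).pushed i hi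
    have hb₂ : s₂.rm aCols = b := by rw [hf₂.rm aCols (by decide), hf₁.rm aCols (by decide), hb]
    refine Prog.WP.mono (Q := fun s' t => t = 6 ∧ s'.iv iPos = i + 1 ∧
      s'.iv iAddr = c + r * (i + 1) + r ∧ s'.rm aColWeight =
      Function.update (s₂.rm aColWeight) i (Z i * b (c + r * (i + 1))))
      (by simp [weightStepProg, hs₂.one, hs₂.cols, hi₂, hpush, hb₂, haddr₂]) ?_
    rintro s₃ _ - ⟨rfl, hi₃, haddr₃, hweight⟩
    refine ⟨le_rfl, hi₃, by rw [haddr₃]; ring, fun j hj => ?_⟩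
    rw [hweight]
    obtain rfl | hne := eq_or_ne j i
    · simp
    · simpa [hne] using hprev j (by omega)
  · rintro s₂ t₂ hf₂ ⟨ht₂, -, hweight⟩
    have hs₂ := hs₁.frame hf₂
    refine Prog.WP.mono (Q := fun s' t => t = 1 ∧
      s'.rm aColWeight = Function.update (s₂.rm aColWeight) m 0)
      (by simp [hs₂.shaft, hs₂.zero]) ?_
    rintro s₃ _ hf₃ ⟨rfl, hlast⟩
    refine ⟨by omega, ?_, by simp [hlast], fun j hj => by simp [hlast, hj.ne, hweight j hj]⟩
    rw [hf₃.rv rV (by decide), hf₂.rv rV (by decide), hrow]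

theorem entriesProg_spec (hs : Consts m r L ε α σ s) (hc : s.iv iOuter = c) (hcr : c < r)
    (hnorm : ∀ k ≤ m, s.rm aNorm k ≠ 0) :
    entriesProg.WP F (fun s' t => t ≤ 8 * (m + 1) + 3 ∧
      (∀ k ≤ m, s'.rm aOut (c + r * k) = (s.rv rV + s.rm aAnswer k) / s.rm aNorm k) ∧
      ∀ a, a % r ≠ c → s'.rm aOut a = s.rm aOut a) s := by
  refine Prog.WP.seq (Q := fun s' t => t = 2 ∧ s'.iv iAddr = c ∧ s'.iv iPos = 0)
    (by simp [hc]) ?_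
  rintro s₁ _ hf₁ ⟨rfl, haddr, hpos⟩
  have hs₁ := hs.frame hf₁
  refine (Prog.WP.count (fun i s' => s'.iv iAddr = c + r * i ∧
    (∀ k < i, s'.rm aOut (c + r * k) = (s.rv rV + s.rm aAnswer k) / s.rm aNorm k) ∧
    ∀ a, a % r ≠ c → s'.rm aOut a = s.rm aOut a) (m + 1) 7 hpos hs₁.size (by decide)
    (by simp [haddr, hf₁.rm aOut (by decide)]) ?_).mono
    fun s' t _ h => ⟨by omega, fun k hk => h.2.2.1 k (by omega), h.2.2.2⟩
  rintro i hi s₂ hf₂ hi₂ ⟨haddr₂, hprev, hrest⟩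
  have hs₂ := hs₁.frame hf₂
  refine Prog.WP.mono (Q := fun s' t => t = 7 ∧ s'.iv iPos = i + 1 ∧
    s'.iv iAddr = c + r * i + r ∧ s'.rm aOut = Function.update (s₂.rm aOut) (c + r * i)
      ((s.rv rV + s.rm aAnswer i) / s.rm aNorm i))
    (by simp +decide [entryStepProg, hs₂.one, hs₂.cols, hi₂, haddr₂, hf₂.rm, hf₁.rm, hf₂.rv,
      hf₁.rv, hnorm i (by omega), add_comm]) ?_
  rintro s₃ _ - ⟨rfl, hi₃, haddr₃, hout⟩
  refine ⟨le_rfl, hi₃, by rw [haddr₃]; ring, fun k hk => ?_, fun a ha => ?_⟩ <;> rw [hout]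
  · obtain rfl | hne := eq_or_ne k i
    · simp
    · have hr : r ≠ 0 := by omega
      simpa [hne, hr] using hprev k (by omega)
  · rw [Function.update_of_ne, hrest a ha]
    rintro rfl
    simp [Nat.mod_eq_of_lt hcr] at ha

theorem columnStepProg_spec (hs : Consts m r L ε α σ s)
    (hF : F.AnswersWithin (m + 1) (σ ^ 32) Φ) (hσ : 0 < σ) (hσ' : σ ≤ 1 / 32)
    (hl : IsLadder m σ Y e) (hsrc : Sources m Z Y s)
    (hX : ∀ k ≤ m, e k + σ ^ 64 ≤ s.rm aLo k ∧ s.rm aLo k + σ ^ 64 ≤ e (k + 1))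
    (hb : s.rm aCols = b) (hZb : ∀ j < m, ∀ a, |Z j * b a| < 32)
    (hnorm : ∀ k ≤ m, s.rm aNorm k ≠ 0) (hc : s.iv iOuter = c) (hcr : c < r) :
    columnStepProg.WP F (fun s' t => t ≤ Φ + 15 * (m + 1) + 10 ∧ s'.iv iOuter = c + 1 ∧
      (∀ k ≤ m, ∃ g, |g - ∑ j ∈ Finset.range m,
          Z j * b (c + r * (j + 1)) * (1 / (s.rm aLo k - Y j))| ≤ σ ^ 32 ∧
        s'.rm aOut (c + r * k) = (b c + g) / s.rm aNorm k) ∧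
      ∀ a, a % r ≠ c → s'.rm aOut a = s.rm aOut a) s := by
  refine (weightsProg_spec hs hsrc hb hc).seq ?_
  rintro s₁ t₁ hf₁ ⟨ht₁, hrow, hlast, hweight⟩
  have hs₁ := hs.frame hf₁
  have hlo := hf₁.rm aLo (by decide)
  refine (fmmProg_spec (κ := .inv) hs₁ hF hσ hσ' hl (hsrc.frame hf₁) (fun j hj => ?_) hlast
    (by rwa [hlo])).seq ?_
  · rw [hweight j hj]
    exact hZb j hj _
  rintro s₂ t₂ hf₂ ⟨ht₂, hans⟩
  have hs₂ := hs₁.frame hf₂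
  have hcol : s₂.iv iOuter = c := by
    rw [hf₂.iv iOuter (by decide), hf₁.iv iOuter (by decide), hc]
  have hnorm₂ : s₂.rm aNorm = s.rm aNorm := by
    rw [hf₂.rm aNorm (by decide), hf₁.rm aNorm (by decide)]
  refine (entriesProg_spec hs₂ hcol hcr (by rwa [hnorm₂])).seq ?_
  rintro s₃ t₃ hf₃ ⟨ht₃, hout, hrest⟩
  rw [hf₂.rv rV (by decide), hrow, hnorm₂] at hout
  have hone := (hs₂.frame hf₃).one
  refine Prog.WP.mono (Q := fun s' t => t = 1 ∧ s'.iv iOuter = c + 1 ∧ s'.rm aOut = s₃.rm aOut)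
    (by simp [hone, hf₃.iv iOuter (by decide), hcol]) ?_
  rintro s₄ _ - ⟨rfl, hcol₄, hout₄⟩
  refine ⟨by omega, hcol₄, fun k hk => ⟨_, ?_, by rw [hout₄, hout k hk]⟩, fun a ha => ?_⟩
  · have hsum : ∑ j ∈ Finset.range m, s₁.rm aColWeight j * Kernel.inv.fn (s₁.rm aLo k - Y j) =
        ∑ j ∈ Finset.range m, Z j * b (c + r * (j + 1)) * (1 / (s.rm aLo k - Y j)) :=
      Finset.sum_congr rfl fun j hj => by rw [hweight j (Finset.mem_range.1 hj), hlo, Kernel.fn]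
    rw [← hsum]
    exact hans k hk
  · rw [hout₄, hrest a ha, hf₂.rm aOut (by decide), hf₁.rm aOut (by decide)]

theorem columnsProg_spec (hs : Consts m r L ε α σ s)
    (hF : F.AnswersWithin (m + 1) (σ ^ 32) Φ) (hσ : 0 < σ) (hσ' : σ ≤ 1 / 32)
    (hl : IsLadder m σ Y e) (hsrc : Sources m Z Y s)
    (hX : ∀ k ≤ m, e k + σ ^ 64 ≤ s.rm aLo k ∧ s.rm aLo k + σ ^ 64 ≤ e (k + 1))
    (hb : s.rm aCols = b) (hZb : ∀ j < m, ∀ a, |Z j * b a| < 32)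
    (hnorm : ∀ k ≤ m, s.rm aNorm k ≠ 0) :
    columnsProg.WP F (fun s' t => t ≤ r * (Φ + 15 * (m + 1) + 11) + 2 ∧ ∀ c < r, ∀ k ≤ m, ∃ g,
      |g - ∑ j ∈ Finset.range m,
        Z j * b (c + r * (j + 1)) * (1 / (s.rm aLo k - Y j))| ≤ σ ^ 32 ∧
      s'.rm aOut (c + r * k) = (b c + g) / s.rm aNorm k) s := by
  refine Prog.WP.seq (Q := fun s' t => t = 1 ∧ s'.iv iOuter = 0) (by simp) ?_
  rintro s₁ _ hf₁ ⟨rfl, hzero⟩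
  have hs₁ := hs.frame hf₁
  refine (Prog.WP.count (fun i s' => ∀ c < i, ∀ k ≤ m, ∃ g,
    |g - ∑ j ∈ Finset.range m,
      Z j * b (c + r * (j + 1)) * (1 / (s.rm aLo k - Y j))| ≤ σ ^ 32 ∧
    s'.rm aOut (c + r * k) = (b c + g) / s.rm aNorm k) r (Φ + 15 * (m + 1) + 10) hzero hs₁.cols
    (by decide) (by simp) ?_).mono fun s' t _ h => ⟨by linarith [h.1], h.2⟩
  intro c hcr s₂ hf₂ hc hprev
  have hrm : ∀ A ∈ [aCols, aLo, aNorm], s₂.rm A = s.rm A := by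
    simp +decide [hf₂.rm, hf₁.rm]
  refine (columnStepProg_spec (hs₁.frame hf₂) hF hσ hσ' hl ((hsrc.frame hf₁).frame hf₂)
    (by rwa [hrm aLo (by simp)]) ((hrm aCols (by simp)).trans hb) hZb
    (by rwa [hrm aNorm (by simp)]) hc hcr).mono ?_
  rintro s₃ t₃ - ⟨ht₃, hc₃, hcol, hrest⟩
  rw [hrm aLo (by simp), hrm aNorm (by simp)] at hcol
  refine ⟨ht₃, hc₃, fun c' hc' k hk => ?_⟩
  obtain hc' | rfl := (Nat.lt_succ_iff.1 hc').lt_or_eq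
  · have hmod : (c' + r * k) % r ≠ c := by
      rw [Nat.add_mul_mod_self_left, Nat.mod_eq_of_lt (hc'.trans hcr)]
      exact hc'.ne
    rw [hrest _ hmod]
    exact hprev c' hc' k hk
  · exact hcol k hk

end Execution

section Execution

open scoped Matrix.Norms.L2Operator

variable {F : BlackBox} {m r L Φ N T : ℕ} {ε α σ : ℝ} {s : State} {Z Y e lam b : ℕ → ℝ}

theorem eigenvectorsProg_spec (hs : Consts m r L ε α σ s)
    (hF : F.AnswersWithin (m + 1) (σ ^ 32) Φ) (hσ : 0 < σ) (hσ' : σ ≤ 1 / 32)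
    (hl : IsLadder m σ Y e) (hsrc : Sources m Z Y s)
    (hX : ∀ k ≤ m, e k + σ ^ 64 ≤ s.rm aLo k ∧ s.rm aLo k + σ ^ 64 ≤ e (k + 1))
    (hb : s.rm aCols = b) (hZ : ∀ j < m, |Z j| ≤ 2) (hb' : ∀ a, |b a| ≤ 1) :
    (normProg ;; columnsProg).WP F (fun s' t =>
      t ≤ (Φ + 6 * (m + 1) + 4) + (r * (Φ + 15 * (m + 1) + 11) + 2) ∧
      s'.rm aLo = s.rm aLo ∧ ∀ c < r, ∀ k ≤ m, ∃ a g,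
        |a - ∑ j ∈ Finset.range m,
          Z j * b (c + r * (j + 1)) * (1 / (s.rm aLo k - Y j))| ≤ σ ^ 32 ∧
        |g - ∑ j ∈ Finset.range m, Z j ^ 2 * (1 / (s.rm aLo k - Y j) ^ 2)| ≤ σ ^ 32 ∧
        s'.rm aOut (c + r * k) = (b c + a) / √(1 + g)) s := by
  refine (normProg_spec hs hF hσ hσ' hl hsrc hZ hX).seq ?_
  rintro s₁ t₁ hf₁ ⟨ht₁, hnorm⟩
  have hlo := hf₁.rm aLo (by decide)
  refine (columnsProg_spec (hs.frame hf₁) hF hσ hσ' hl (hsrc.frame hf₁) (by rwa [hlo])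
    ((hf₁.rm aCols (by decide)).trans hb) (fun j hj a => ?_) fun k hk => ?_).mono ?_
  · rw [abs_mul]
    linarith [(mul_le_of_le_one_right (abs_nonneg _) (hb' a)).trans (hZ j hj)]
  · obtain ⟨g, -, hg, hroot⟩ := hnorm k hk
    rw [hroot]
    exact (Real.sqrt_pos.2 hg).ne'
  · rintro s₂ t₂ hf₂ ⟨ht₂, hout⟩
    refine ⟨add_le_add ht₁ ht₂, (hf₂.rm aLo (by decide)).trans hlo, fun c hc k hk => ?_⟩
    obtain ⟨g, hg, -, hroot⟩ := hnorm k hk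
    obtain ⟨a, ha, hentry⟩ := hout c hc k hk
    rw [hlo] at ha
    exact ⟨a, g, ha, hg, hentry.trans (by rw [hroot])⟩

theorem diagProg_spec {z d : Fin m → ℝ} {B : Matrix (Fin (m + 1)) (Fin r) ℝ} (hε : 0 < ε)
    (hε' : ε ≤ 1) (hε'' : 2 * ε ≤ m + 1) (hσ : σ = ε / (64 * (m + 1)))
    (hN : 4 / 2 ^ N ≤ ε / 16) (hT : 16 / 2 ^ T ≤ σ ^ 32) (hF : F.AnswersWithin (m + 1) (σ ^ 32) Φ)
    (hH : ‖arrowhead α z d‖ ≤ 1) (hB : ∀ j, ‖WithLp.toLp 2 (fun i => B i j)‖ ≤ 1) :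
    diagProg.WP F (fun s t => t ≤ 100 * (N + 1) * (m + 1) + T * (Φ + 15 * (m + 1) + 7) +
        ((Φ + 6 * (m + 1) + 4) + (r * (Φ + 15 * (m + 1) + 11) + 2)) ∧
      ∃ Q ∈ Matrix.orthogonalGroup (Fin (m + 1)) ℝ,
        specNorm (arrowhead α z d -
          Q * Matrix.diagonal (outVector s (m + 1)) * Q.transpose) ≤ ε ∧
        ∀ i j, |(Q.transpose * B - outMatrix s (m + 1) r) i j| ≤ ε / ((m + 1 : ℕ) : ℝ) ^ 2)
      (diagInput ε α z d B) := by
  have hσ0 : 0 < σ := by rw [hσ]; positivity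
  have hmσ : (m + 1) * σ = ε / 64 := by rw [hσ]; field_simp
  have hσ' : σ ≤ 1 / 128 := by
    rw [hσ, div_le_div_iff₀ (by positivity) (by norm_num)]
    linarith
  have hz : ∀ i, |toArray z i| ≤ 1 := abs_toArray_le zero_le_one (abs_shaft_le hH)
  refine (eigProg_spec (m := m) (r := r) (ε := ε) (α := α) (z := toArray z) (d := toArray d)
    (s := diagInput ε α z d B) rfl rfl rfl rfl rfl rfl (fun _ => rfl) hε
    hε' hε'' hσ (fun _ _ h => h.acc) (by decide) le_rfl hN hT hF (abs_corner_le hH)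
    (abs_toArray_le zero_le_one (abs_diag_le hH))
    (by simpa only [Finset.sum_range, toArray_val] using sum_sq_shaft_le hH)).seq ?_
  rintro s₁ t₁ hf₁ ⟨ht₁, L, Z, Y, e, lam, hs₁, hper, hsrc, happrox⟩
  simp only [← two_mul] at happrox
  have hZ : ∀ j < m, |Z j| ≤ 2 := fun j hj => hper.abs_shaft_le (by linarith) hj (hz j)
  refine (eigenvectorsProg_spec hs₁ hF hσ0 (by linarith) hper.ladder hsrc
    (fun k hk => hper.roots.add_pow_le_of_abs_sub_le hσ0 (by linarith) hk (happrox k hk))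
    (b := matrixArray B) (hf₁.rm aCols (by decide)) hZ (abs_matrixArray_le hB)).mono ?_
  rintro s₂ t₂ - ⟨ht₂, hlo, hout⟩
  refine ⟨add_le_add ht₁ ht₂, _, (hper.roots.diagonalizes hper.ladder hσ0).orth, ?_, fun k c => ?_⟩
  · have hnorm := hper.norm_sub_normalized_le hσ0 (by linarith) hmσ happrox
    simp only [toArray_val, ← hlo] at hnorm
    rwa [specNorm_eq_norm]
  · obtain ⟨a, g, ha, hg, hentry⟩ := hout c c.2 k (Nat.lt_succ_iff.1 k.2)
    rw [Matrix.sub_apply, show outMatrix s₂ (m + 1) r k c = _ from hentry, Nat.cast_succ]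
    exact hper.abs_normalized_transpose_mul_sub_le hσ0 hσ' hε' hmσ hZ hB
      (happrox k (Nat.lt_succ_iff.1 k.2)) ha hg

end Execution

/-! ## Costs -/

section Cost

variable {A c k l n p r x ξ T Φ : ℝ}

theorem half_lt_log_of_two_le (hx : 2 ≤ x) : 1 / 2 < Real.log x := by
  linarith [Real.log_two_gt_d9, Real.log_le_log two_pos hx]

theorem sixty_four_le_pow_six (hx : 2 ≤ x) : 64 ≤ x ^ 6 :=
  (by norm_num : (64 : ℝ) ≤ 2 ^ 6).trans (pow_le_pow_left₀ zero_le_two hx 6)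

theorem exists_div_two_pow_le {a y : ℝ} (hx : 2 ≤ x) (hy : 0 ≤ y) {k : ℕ} (h : a ≤ y * x ^ k) :
    ∃ N : ℕ, a / 2 ^ N ≤ y ∧ (N : ℝ) ≤ (2 * k + 2) * Real.log x := by
  have hlog : Real.logb 2 x ≤ 2 * Real.log x := by
    rw [Real.logb, div_le_iff₀ (Real.log_pos one_lt_two)]
    nlinarith [half_lt_log_of_two_le hx, half_lt_log_of_two_le le_rfl]
  have hlog0 : 0 ≤ Real.logb 2 x := Real.logb_nonneg one_lt_two (by linarith)
  refine ⟨⌈k * Real.logb 2 x⌉₊, ?_, ?_⟩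
  · have hpow : x ^ k ≤ 2 ^ ⌈k * Real.logb 2 x⌉₊ :=
      calc x ^ k = 2 ^ (k * Real.logb 2 x) := by
            rw [mul_comm, Real.rpow_mul_natCast zero_le_two,
              Real.rpow_logb two_pos (by norm_num) (by linarith)]
        _ ≤ 2 ^ ((⌈k * Real.logb 2 x⌉₊ : ℕ) : ℝ) :=
          Real.rpow_le_rpow_of_exponent_le one_le_two (Nat.le_ceil _)
        _ = 2 ^ ⌈k * Real.logb 2 x⌉₊ := Real.rpow_natCast _ _
    rw [div_le_iff₀ (by positivity)]
    exact h.trans (mul_le_mul_of_nonneg_left hpow hy)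
  · have hceil := Nat.ceil_lt_add_one (mul_nonneg k.cast_nonneg hlog0)
    have hmul := mul_le_mul_of_nonneg_left hlog (Nat.cast_nonneg (α := ℝ) k)
    linarith [half_lt_log_of_two_le hx]

theorem log_div_inv_pow_le (hx : 2 ≤ x) (hn : 1 ≤ n) (hnx : n ≤ x) :
    Real.log (n / (64 * x)⁻¹ ^ 32) ≤ 225 * Real.log x := by
  rw [inv_pow, div_inv_eq_mul]
  calc Real.log (n * (64 * x) ^ 32) ≤ Real.log (x * (x ^ 6 * x) ^ 32) := by
        gcongr
        exact sixty_four_le_pow_six hx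
    _ = Real.log (x ^ 225) := by rw [← pow_succ, ← pow_mul, ← pow_succ']
    _ = 225 * Real.log x := by rw [Real.log_pow, Nat.cast_ofNat]

theorem sixteen_le_inv_pow_mul_pow (hx : 2 ≤ x) : 16 ≤ (64 * x)⁻¹ ^ 32 * x ^ 230 := by
  have h64 := sixty_four_le_pow_six hx
  rw [inv_pow, ← div_eq_inv_mul, le_div_iff₀ (by positivity)]
  calc 16 * (64 * x) ^ 32 ≤ x ^ 6 * (x ^ 6 * x) ^ 32 := by
        gcongr
        linarith
    _ = x ^ 230 := by rw [← pow_succ, ← pow_mul, ← pow_add]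

theorem exists_answersWithin {F : BlackBox} (hξ : 1 ≤ ξ) (hF : F.IsAFMM ξ) :
    ∃ A : ℝ, ∀ (m : ℕ) (ε σ : ℝ), 0 < ε → ε ≤ 1 → 2 * ε ≤ m + 1 →
      σ = ε / (64 * (m + 1)) → ∃ Φ : ℕ, F.AnswersWithin (m + 1) (σ ^ 32) Φ ∧
        (Φ : ℝ) ≤ A * ((m + 1) * Real.log ((m + 1) / ε) ^ ξ) := by
  obtain ⟨K, hK⟩ := hF 32 1 (by norm_num) one_pos 2
  refine ⟨|K| * 225 ^ ξ, fun m ε σ hε hε' hε'' hσ => ?_⟩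
  have hm : (1 : ℝ) ≤ m + 1 := by linarith [Nat.cast_nonneg (α := ℝ) m]
  set x : ℝ := (m + 1) / ε with hx
  have hx2 : 2 ≤ x := (le_div_iff₀ hε).2 hε''
  have hmx : (m : ℝ) + 1 ≤ x := le_div_self (by linarith) hε hε'
  have hσx : σ = (64 * x)⁻¹ := by rw [hσ, hx]; field_simp
  have hlog0 : 0 ≤ Real.log ((m + 1) / σ ^ 32) := by
    rw [hσx, inv_pow, div_inv_eq_mul]
    exact Real.log_nonneg (one_le_mul_of_one_le_of_one_le hm (one_le_pow₀ (by linarith)))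
  have hpow : Real.log ((m + 1) / σ ^ 32) ^ ξ ≤ 225 ^ ξ * Real.log x ^ ξ := by
    rw [← Real.mul_rpow (by norm_num) (Real.log_nonneg (by linarith))]
    refine Real.rpow_le_rpow hlog0 ?_ (by linarith)
    rw [hσx]
    exact log_div_inv_pow_le hx2 hm hmx
  have hcost : 0 ≤ (m + 1) * Real.log ((m + 1) / σ ^ 32) ^ ξ := by positivity
  refine ⟨⌊|K| * ((m + 1) * Real.log ((m + 1) / σ ^ 32) ^ ξ)⌋₊, fun q hq hn hacc => ?_, ?_⟩
  · obtain ⟨hans, htime⟩ := hK q hq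
    rw [hn, hacc, Nat.cast_succ] at htime
    rw [hacc] at hans
    exact ⟨hans, Nat.le_floor (htime.trans (mul_le_mul_of_nonneg_right (le_abs_self K) hcost))⟩
  · calc _ ≤ |K| * ((m + 1) * Real.log ((m + 1) / σ ^ 32) ^ ξ) := Nat.floor_le (by positivity)
      _ ≤ |K| * ((m + 1) * (225 ^ ξ * Real.log x ^ ξ)) := by gcongr
      _ = |K| * 225 ^ ξ * ((m + 1) * Real.log x ^ ξ) := by ring

theorem one_le_two_rpow_mul_log_rpow (hξ : 1 ≤ ξ) (hx : 2 ≤ x) :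
    1 ≤ 2 ^ ξ * Real.log x ^ ξ := by
  have hlog := half_lt_log_of_two_le hx
  rw [← Real.mul_rpow zero_le_two (by linarith)]
  exact Real.one_le_rpow (by linarith) (by linarith)

theorem eig_cost_le (hl : 1 / 2 ≤ l) (hn : 1 ≤ n) (hcp : 1 ≤ c * p) (hT : T ≤ k * l)
    (hT0 : 0 ≤ T) (hΦ : Φ ≤ A * (n * p)) (hΦ0 : 0 ≤ Φ) :
    100 * (T + 1) * n + T * (Φ + 15 * n + 7) ≤
      (100 * (k + 2) * c + k * (A + 22 * c)) * (n * l * p) := by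
  have hnp : n ≤ n * (c * p) := le_mul_of_one_le_right (by linarith) hcp
  calc 100 * (T + 1) * n + T * (Φ + 15 * n + 7)
      ≤ 100 * (k * l + 2 * l) * (n * (c * p)) + k * l * (A * (n * p) + 22 * (n * (c * p))) := by
        refine add_le_add ?_ (mul_le_mul hT (by linarith) (by linarith) (hT0.trans hT))
        gcongr <;> linarith
    _ = _ := by ring

theorem columns_cost_le (hl : 1 / 2 ≤ l) (hn : 1 ≤ n) (hr : 1 ≤ r) (hcp : 1 ≤ c * p)
    (hΦ : Φ ≤ A * (n * p)) (hΦ0 : 0 ≤ Φ) :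
    Φ + 6 * n + 4 + (r * (Φ + 15 * n + 11) + 2) ≤ (4 * A + 76 * c) * (r * (n * l * p)) := by
  have hnp : n ≤ n * (c * p) := le_mul_of_one_le_right (by linarith) hcp
  calc Φ + 6 * n + 4 + (r * (Φ + 15 * n + 11) + 2)
      ≤ r * (Φ + 6 * n + 6) + r * (Φ + 15 * n + 11) := by
        linarith [le_mul_of_one_le_left (a := r) (b := Φ + 6 * n + 6) (by linarith) hr]
    _ ≤ r * (2 * (A * (n * p)) + 38 * (n * (c * p))) := by
        rw [← mul_add]
        exact mul_le_mul_of_nonneg_left (by linarith) (by linarith)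
    _ ≤ r * (2 * (A * (n * p)) + 38 * (n * (c * p))) * (2 * l) :=
        le_mul_of_one_le_right (mul_nonneg (by linarith) (by linarith)) (by linarith)
    _ = _ := by ring

theorem diag_cost_le (hl : 1 / 2 ≤ l) (hn : 1 ≤ n) (hr : 1 ≤ r) (hcp : 1 ≤ c * p)
    (hT : T ≤ k * l) (hT0 : 0 ≤ T) (hΦ : Φ ≤ A * (n * p)) (hΦ0 : 0 ≤ Φ) :
    100 * (T + 1) * n + T * (Φ + 15 * n + 7) +
        (Φ + 6 * n + 4 + (r * (Φ + 15 * n + 11) + 2)) ≤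
      (100 * (k + 2) * c + k * (A + 22 * c) + (4 * A + 76 * c)) * (r * (n * l * p)) := by
  have heig := eig_cost_le hl hn hcp hT hT0 hΦ hΦ0
  have hcost : 0 ≤ 100 * (T + 1) * n + T * (Φ + 15 * n + 7) := by positivity
  rw [add_mul, mul_left_comm _ r]
  exact add_le_add (heig.trans (le_mul_of_one_le_left (hcost.trans heig) hr))
    (columns_cost_le hl hn hr hcp hΦ hΦ0)

end Cost

section Correctness

variable {F : BlackBox} {ξ : ℝ}

theorem eigProg_correct (hξ : 1 ≤ ξ) (hF : F.IsAFMM ξ) :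
    ∃ K : ℝ, ∀ (m : ℕ) (ε α : ℝ) (z d : Fin m → ℝ), 0 < ε → ε ≤ 1 / 2 →
      specNorm (arrowhead α z d) ≤ 1 →
      ∃ (s : State) (t : ℕ), Exec F (eigProg rWidth) (eigInput ε α z d) s t ∧
        (t : ℝ) ≤ K * ((m + 1 : ℕ) * Real.log (1 / ε) * Real.log ((m + 1 : ℕ) / ε) ^ ξ) ∧
        ∃ lam : Fin (m + 1) → ℝ, IsSortedSpectrum (arrowhead α z d) lam ∧
          ∀ i, |lam i - outVector s (m + 1) i| ≤ ε := by
  obtain ⟨A, hcall⟩ := exists_answersWithin hξ hF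
  refine ⟨100 * (20 + 2) * 2 ^ ξ + 20 * (A + 22 * 2 ^ ξ), fun m ε α z d hε hε' hH => ?_⟩
  rw [specNorm_eq_norm] at hH
  have hm : (1 : ℝ) ≤ m + 1 := by linarith [Nat.cast_nonneg (α := ℝ) m]
  set σ := ε / (64 * ((m : ℝ) + 1)) with hσ
  have hσ0 : 0 < σ := by positivity
  have hmσ : (m + 1) * σ = ε / 64 := by rw [hσ]; field_simp
  have hσ' : σ ≤ ε / 64 := hmσ ▸ le_mul_of_one_le_left hσ0.le hm
  have hσpow : σ ^ 32 ≤ σ := pow_le_of_le_one hσ0.le (by linarith) (by norm_num)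
  have hε'' : 2 * ε ≤ m + 1 := by linarith
  obtain ⟨Φ, hans, hΦ⟩ := hcall m ε σ hε (by linarith) hε'' hσ
  have hx : 2 ≤ 1 / ε := by rw [le_div_iff₀ hε]; linarith
  obtain ⟨T, hT, hT'⟩ := exists_div_two_pow_le hx (k := 9) (a := 16) (y := ε / 16) (by positivity)
    (by
      calc (16 : ℝ) ≤ 1 / 16 * (64 * 2 ^ 2) := by norm_num
        _ ≤ 1 / 16 * ((1 / ε) ^ 6 * (1 / ε) ^ 2) := by
          gcongr
          exact sixty_four_le_pow_six hx
        _ = ε / 16 * (1 / ε) ^ 9 := by field_simp)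
  have hT₄ : 4 / (2 : ℝ) ^ T ≤ 16 / 2 ^ T := by gcongr; norm_num
  obtain ⟨s, t, hex, ht, L, Z, Y, e, lam, -, hper, -, hlo⟩ := eigProg_spec (F := F) (m := m)
    (r := 0) (ε := ε) (α := α) (z := toArray z) (d := toArray d) (s := eigInput ε α z d)
    (η := ε / 8) rfl rfl rfl rfl rfl rfl (fun _ => rfl) hε (by linarith) hε'' hσ
    (fun _ _ h => h.width) (by decide) (by linarith) (hT₄.trans hT)
    (hT.trans (by linarith)) hans (abs_corner_le hH) (abs_toArray_le zero_le_one (abs_diag_le hH))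
    (by simpa only [Finset.sum_range, toArray_val] using sum_sq_shaft_le hH)
  refine ⟨s, t, hex, ?_, ?_⟩
  · have ht' : (t : ℝ) ≤ 100 * (T + 1) * (m + 1) + T * (Φ + 15 * (m + 1) + 7) := by
      exact_mod_cast ht
    push_cast at hT' ⊢
    exact ht'.trans (eig_cost_le (half_lt_log_of_two_le hx).le hm
      (one_le_two_rpow_mul_log_rpow hξ ((le_div_iff₀ hε).2 hε'')) (by linarith)
      T.cast_nonneg hΦ Φ.cast_nonneg)
  · obtain ⟨U, ev, hU, hev⟩ := exists_diagonalizes_isSortedSpectrum (arrowhead_isHermitian α z d)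
    exact ⟨ev, hev, hper.abs_eigenvalue_sub_le hσ0 (by linarith) hmσ
      (by simpa only [toArray_val] using hU) hev.1 hlo⟩

theorem diagProg_correct (hξ : 1 ≤ ξ) (hF : F.IsAFMM ξ) :
    ∃ K : ℝ, ∀ (m r : ℕ) (ε α : ℝ) (z d : Fin m → ℝ) (B : Matrix (Fin (m + 1)) (Fin r) ℝ),
      1 ≤ r → 0 < ε → ε < 1 → 2 * ε ≤ (m + 1 : ℕ) → specNorm (arrowhead α z d) ≤ 1 →
      (∀ j, ‖WithLp.toLp 2 (fun i => B i j)‖ ≤ 1) →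
      ∃ (s : State) (t : ℕ), Exec F diagProg (diagInput ε α z d B) s t ∧
        (t : ℝ) ≤ K * ((m + 1 : ℕ) * r * Real.log ((m + 1 : ℕ) / ε) ^ (ξ + 1)) ∧
        ∃ Q ∈ Matrix.orthogonalGroup (Fin (m + 1)) ℝ,
          specNorm (arrowhead α z d -
            Q * Matrix.diagonal (outVector s (m + 1)) * Q.transpose) ≤ ε ∧
          ∀ i j, |(Q.transpose * B - outMatrix s (m + 1) r) i j| ≤
            ε / ((m + 1 : ℕ) : ℝ) ^ 2 := by
  obtain ⟨A, hcall⟩ := exists_answersWithin hξ hF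
  refine ⟨100 * (462 + 2) * 2 ^ ξ + 462 * (A + 22 * 2 ^ ξ) + (4 * A + 76 * 2 ^ ξ),
    fun m r ε α z d B hr hε hε' hε'' hH hB => ?_⟩
  rw [Nat.cast_succ] at hε''
  rw [specNorm_eq_norm] at hH
  have hm : (1 : ℝ) ≤ m + 1 := by linarith [Nat.cast_nonneg (α := ℝ) m]
  set σ := ε / (64 * ((m : ℝ) + 1)) with hσ
  have hσ0 : 0 < σ := by positivity
  have hmσ : (m + 1) * σ = ε / 64 := by rw [hσ]; field_simp
  have hσ' : σ ≤ ε / 64 := hmσ ▸ le_mul_of_one_le_left hσ0.le hm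
  have hσpow : σ ^ 32 ≤ σ := pow_le_of_le_one hσ0.le (by linarith) (by norm_num)
  obtain ⟨Φ, hans, hΦ⟩ := hcall m ε σ hε hε'.le hε'' hσ
  set x : ℝ := (m + 1) / ε with hxdef
  have hx : 2 ≤ x := (le_div_iff₀ hε).2 hε''
  have hσx : σ = (64 * x)⁻¹ := by rw [hσ, hxdef]; field_simp
  obtain ⟨T, hT, hT'⟩ := exists_div_two_pow_le hx (by positivity)
    (hσx ▸ sixteen_le_inv_pow_mul_pow hx : 16 ≤ σ ^ 32 * x ^ 230)
  have hT₄ : 4 / (2 : ℝ) ^ T ≤ 16 / 2 ^ T := by gcongr; norm_num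
  obtain ⟨s, t, hex, ht, hQ⟩ := diagProg_spec (F := F) (N := T) hε hε'.le hε'' hσ
    (by linarith) hT hans hH hB
  refine ⟨s, t, hex, ?_, hQ⟩
  have ht' : (t : ℝ) ≤ 100 * (T + 1) * (m + 1) + T * (Φ + 15 * (m + 1) + 7) +
      ((Φ + 6 * (m + 1) + 4) + (r * (Φ + 15 * (m + 1) + 11) + 2)) := by
    exact_mod_cast ht
  have hr' : (1 : ℝ) ≤ r := by exact_mod_cast hr
  have hcost := diag_cost_le (half_lt_log_of_two_le hx).le hm hr'
    (one_le_two_rpow_mul_log_rpow hξ hx) (k := 462) (hT'.trans_eq (by norm_num))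
    T.cast_nonneg hΦ Φ.cast_nonneg
  rw [Nat.cast_succ, Real.rpow_add_one (by linarith [half_lt_log_of_two_le hx])]
  refine (ht'.trans hcost).trans_eq ?_
  ring

end Correctness

theorem mainTheorem6 :
    (∃ P : Prog, ∀ (F : BlackBox) (ξ : ℝ), 1 ≤ ξ → F.IsAFMM ξ →
      ∃ K : ℝ, ∀ (m r : ℕ) (ε α : ℝ) (z d : Fin m → ℝ) (B : Matrix (Fin (m + 1)) (Fin r) ℝ),
        1 ≤ r → 0 < ε → ε < 1 → 2 * ε ≤ (m + 1 : ℕ) →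
        specNorm (arrowhead α z d) ≤ 1 →
        (∀ j, ‖WithLp.toLp 2 (fun i => B i j)‖ ≤ 1) →
        ∃ (s : State) (t : ℕ), Exec F P (diagInput ε α z d B) s t ∧
          (t : ℝ) ≤ K * ((m + 1 : ℕ) * r * Real.log ((m + 1 : ℕ) / ε) ^ (ξ + 1)) ∧
          ∃ Q ∈ Matrix.orthogonalGroup (Fin (m + 1)) ℝ,
            specNorm (arrowhead α z d -
              Q * Matrix.diagonal (outVector s (m + 1)) * Q.transpose) ≤ ε ∧
            ∀ i j, |(Q.transpose * B - outMatrix s (m + 1) r) i j| ≤ ε / ((m + 1 : ℕ) : ℝ) ^ 2) ∧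
    (∃ P : Prog, ∀ (F : BlackBox) (ξ : ℝ), 1 ≤ ξ → F.IsAFMM ξ →
      ∃ K : ℝ, ∀ (m : ℕ) (ε α : ℝ) (z d : Fin m → ℝ),
        0 < ε → ε ≤ 1 / 2 →
        specNorm (arrowhead α z d) ≤ 1 →
        ∃ (s : State) (t : ℕ), Exec F P (eigInput ε α z d) s t ∧
          (t : ℝ) ≤ K * ((m + 1 : ℕ) * Real.log (1 / ε) * Real.log ((m + 1 : ℕ) / ε) ^ ξ) ∧
          ∃ lam : Fin (m + 1) → ℝ, IsSortedSpectrum (arrowhead α z d) lam ∧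
            ∀ i, |lam i - outVector s (m + 1) i| ≤ ε) :=
  ⟨⟨diagProg, fun _ _ hξ hF => diagProg_correct hξ hF⟩,
    ⟨eigProg rWidth, fun _ _ hξ hF => eigProg_correct hξ hF⟩⟩
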